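/- Let $\mathcal C$ be a good subcategory of the category of C*-algebras (a full subcategory that contains $\mathbb C$ and is closed under isomorphism, ideals, quotients, extensions and the suspension $A\mapsto C_0(\mathbb R,A)$), and let $h_*=\{h_n\}_{n\in\mathbb Z}$ be a homology theory on $\mathcal C$: covariant functors $h_n:\mathcal C\to\mathrm{Ab}$ which are homotopy invariant and have, for every short exact sequence $0\to J\to A\to B\to 0$ in $\mathcal C$, a long exact sequence with natural connecting maps $\partial:h_n(B)\to h_{n-1}(J)$. Let $X$ be (the realization of) a finite dimensional, locally finite simplicial complex with skeletons $X_n$ ($X_{-1}=\emptyset$). Let $A=A(X)\in\mathcal C$ be a $C_0(X)$-algebra which is an $h_*$-fibration, i.e. for every continuous map $f:\Delta^k\to X$ from a standard simplex and every point $v\in\Delta^k$, evaluation $f^*A\to A_{f(v)}$ induces isomorphisms $h_n(f^*A)\cong h_n(A_{f(v)})$ for all $n\in\mathbb Z$. For a locally closed set $W\subseteq X$ write $A(W)$ for the restriction of $A$ to $W$; for $Z$ relatively closed in $W$ there is a short exact sequence $0\to A(W\setminus Z)\to A(W)\to A(Z)\to 0$, to which all connecting maps below belong. For an affine simplex $\sigma=\langle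 v_0,\dots,v_p\rangle:\Delta^p\to X$ with ordered vertices, whose image is the closed cell $\Delta_\sigma$ of $X$ with open cell $\mathring\Delta_\sigma$, the canonical oriented map is the composition $$\Phi_\sigma:\ h_n(A(\Delta_\sigma))\xrightarrow{\ \mathrm{ev}_{v_0,*}\ }h_n(A_{v_0})\xrightarrow{\ \partial\ }h_{n-1}(A(\mathring\Delta^1))\xrightarrow{\ \partial\ }\cdots\xrightarrow{\ \partial\ }h_{n-p}(A(\mathring\Delta^p)),$$ where $\mathring\Delta^k$ is the open cell of $\langle v_0,\dots,v_k\rangle$ (so $\mathring\Delta^p=\mathring\Delta_\sigma$) and the $k$-th connecting map belongs to $0\to A(\mathring\Delta^k)\to A(\mathring\Delta^k\cup\mathring\Delta^{k-1})\to A(\mathring\Delta^{k-1})\to 0$. Let $p\ge 1$ and $q\in\mathbb Z$, let $\sigma$ be a $p$-simplex and $\tau$ a $(p-1)$-simplex of $X$, both with ordered vertices, and for $0\le l\le p$ let $\sigma_l$ be the $l$-th face of $\sigma$ (omit $v_l$ and keep the order), with image $\Delta_{\sigma,l}$. Then $\Phi_\sigma:h_{p+q}(A(\Delta_\sigma))\to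 h_q(A(\mathring\Delta_\sigma))$ and $\Phi_\tau:h_{p+q}(A(\Delta_\tau))\to h_{q+1}(A(\mathring\Delta_\tau))$ are isomorphisms, and the $(\tau,\sigma)$-component of the differential $d_1=\partial\circ\iota_*$ of the skeletal spectral sequence, expressed through these isomorphisms, is the composition $$d_\tau^\sigma:\ h_{p+q}(A(\Delta_\tau))\xrightarrow{\Phi_\tau}h_{q+1}(A(\mathring\Delta_\tau))\to h_{q+1}(A(X_{p-1}\setminus X_{p-2}))\xrightarrow{\iota_*}h_{q+1}(A(X_{p-1}))\xrightarrow{\ \partial\ }h_q(A(X_p\setminus X_{p-1}))\to h_q(A(\mathring\Delta_\sigma))\xrightarrow{\Phi_\sigma^{-1}}h_{p+q}(A(\Delta_\sigma)),$$ where the unlabelled maps are induced by the inclusion of the ideal, respectively by the quotient map, that belongs to the open cell. It satisfies: 1. If $\Delta_\tau$ is not a face of $\Delta_\sigma$, then $d_\tau^\sigma=0$. 2. If $\Delta_\tau=\Delta_{\sigma,l}$ for some $0\le l\le p$, then the quotient map $A(\Delta_\sigma)\to A(\Delta_\tau)$ induces an isomorphism $\mathrm{res}^\sigma_\tau:h_{p+q}(A(\Delta_\sigma))\to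 h_{p+q}(A(\Delta_\tau))$, there is a unique permutation $\varphi^l_{\sigma,\tau}$ of the vertices of $\Delta^{p-1}$ such that $\tau=\sigma_l\circ\varphi^l_{\sigma,\tau}$ for the induced affine map of $\Delta^{p-1}$, and $$d_\tau^\sigma=(-1)^{p-l}\,\mathrm{sign}(\varphi^l_{\sigma,\tau})\,(\mathrm{res}^\sigma_\tau)^{-1}.$$ -/

import Mathlib

open CategoryTheory

universe u v w

namespace CStarFib

/-- A closed two-sided (automatically self-adjoint) ideal of a C*-algebra. -/
structure CStarIdeal (A : Type u) [NonUnitalCStarAlgebra A] where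
  toSubmodule : Submodule ℂ A
  mul_left_mem' : ∀ (a : A) {x : A}, x ∈ toSubmodule → a * x ∈ toSubmodule
  mul_right_mem' : ∀ (a : A) {x : A}, x ∈ toSubmodule → x * a ∈ toSubmodule
  star_mem' : ∀ {x : A}, x ∈ toSubmodule → star x ∈ toSubmodule
  isClosed' : IsClosed (toSubmodule : Set A)

namespace CStarIdeal

variable {A : Type u} [NonUnitalCStarAlgebra A]

instance : SetLike (CStarIdeal A) A where
  coe I := I.toSubmodule
  coe_injective I J h := by
    cases I; cases J; congr; exact SetLike.coe_injective h

instance : NonUnitalSubringClass (CStarIdeal A) A where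
  add_mem {I _ _} h h' := I.toSubmodule.add_mem h h'
  zero_mem I := I.toSubmodule.zero_mem
  neg_mem {I _} h := I.toSubmodule.neg_mem h
  mul_mem {I _ _} _ h' := I.mul_left_mem' _ h'

instance : SMulMemClass (CStarIdeal A) ℂ A where
  smul_mem {I} c _ h := I.toSubmodule.smul_mem c h

instance : StarMemClass (CStarIdeal A) A where
  star_mem {I _} h := I.star_mem' h

instance (I : CStarIdeal A) : IsClosed (I : Set A) := I.isClosed'

instance (I : CStarIdeal A) : IsClosed (I.toSubmodule : Set A) := I.isClosed'

theorem mul_left_mem (I : CStarIdeal A) (a : A) {x : A} (hx : x ∈ I) : a * x ∈ I :=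
  I.mul_left_mem' a hx

theorem mul_right_mem (I : CStarIdeal A) (a : A) {x : A} (hx : x ∈ I) : x * a ∈ I :=
  I.mul_right_mem' a hx

/-- The inclusion of a closed ideal, as a *-homomorphism. -/
def incl (I : CStarIdeal A) : I →⋆ₙₐ[ℂ] A where
  toFun := Subtype.val
  map_smul' _ _ := rfl
  map_zero' := rfl
  map_add' _ _ := rfl
  map_mul' _ _ := rfl
  map_star' _ := rfl

section Approx

attribute [local instance] CStarAlgebra.spectralOrder CStarAlgebra.spectralOrderedRing

theorem exists_approx_aux {B : Type v} [NonUnitalCStarAlgebra B] (φ : B →⋆ₙₐ[ℂ] A) (j : B)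
    {ε : ℝ} (hε : 0 < ε) :
    ∃ e : B, star e = e ∧ ‖j - j * e‖ < ε ∧ ∀ c : A, ‖c - c * φ e‖ ≤ ‖c‖ := by
  have hau := CStarAlgebra.increasingApproximateUnit B
  have h2 := (Metric.tendsto_nhds.1 (hau.tendsto_mul_left j)) ε hε
  have := hau.neBot
  obtain ⟨e, ⟨he1, he2⟩, he3⟩ := ((h2.and hau.eventually_nonneg).and hau.eventually_norm).exists
  refine ⟨e, (IsSelfAdjoint.of_nonneg he2).star_eq, ?_, ?_⟩
  · rw [dist_comm, dist_eq_norm] at he1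
    exact he1
  · intro c
    obtain ⟨x, hx⟩ := CStarAlgebra.nonneg_iff_eq_star_mul_self.1 he2
    have hpos : 0 ≤ ((φ e : A) : Unitization ℂ A) := by
      rw [hx, map_mul, map_star, Unitization.inr_mul, Unitization.inr_star]
      exact star_mul_self_nonneg _
    have hle : ((φ e : A) : Unitization ℂ A) ≤ 1 := by
      rw [← CStarAlgebra.norm_le_one_iff_of_nonneg _ hpos, Unitization.norm_inr]
      exact (NonUnitalStarAlgHom.norm_apply_le φ e).trans he3
    have h1e : ‖(1 : Unitization ℂ A) - ((φ e : A) : Unitization ℂ A)‖ ≤ 1 := by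
      rw [CStarAlgebra.norm_le_one_iff_of_nonneg _ (sub_nonneg.2 hle)]
      exact sub_le_self _ hpos
    rw [← Unitization.norm_inr (𝕜 := ℂ) (c - c * φ e), ← Unitization.norm_inr (𝕜 := ℂ) c]
    calc ‖((c - c * φ e : A) : Unitization ℂ A)‖
        = ‖(c : Unitization ℂ A) * (1 - ((φ e : A) : Unitization ℂ A))‖ := by
          rw [Unitization.inr_sub, Unitization.inr_mul, mul_sub, mul_one]
      _ ≤ ‖(c : Unitization ℂ A)‖ * 1 := (norm_mul_le _ _).trans (by gcongr)
      _ = _ := mul_one _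

end Approx

theorem exists_approx (I : CStarIdeal A) (j : A) (hj : j ∈ I) {ε : ℝ} (hε : 0 < ε) :
    ∃ e ∈ I, star e = e ∧ ‖j - j * e‖ < ε ∧ ∀ c : A, ‖c - c * e‖ ≤ ‖c‖ := by
  obtain ⟨e, h1, h2, h3⟩ := exists_approx_aux I.incl ⟨j, hj⟩ hε
  exact ⟨e, e.2, congrArg Subtype.val h1, h2, h3⟩

/-- The quotient of a C*-algebra by a closed ideal, with the quotient norm. -/
def Quot (I : CStarIdeal A) : Type u := A ⧸ I.toSubmodule

namespace Quot

variable (I : CStarIdeal A)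

noncomputable instance : NormedAddCommGroup I.Quot :=
  inferInstanceAs (NormedAddCommGroup (A ⧸ I.toSubmodule))

noncomputable instance : NormedSpace ℂ I.Quot :=
  inferInstanceAs (NormedSpace ℂ (A ⧸ I.toSubmodule))

instance : CompleteSpace I.Quot :=
  inferInstanceAs (CompleteSpace (A ⧸ I.toSubmodule))

/-- The class of an element in the quotient. -/
def mk (a : A) : I.Quot := Submodule.Quotient.mk a

variable {I}

theorem mk_surjective : Function.Surjective (mk I) := Submodule.Quotient.mk_surjective _

theorem mk_eq_mk {a b : A} : mk I a = mk I b ↔ a - b ∈ I := Submodule.Quotient.eq _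

theorem mk_eq_zero {a : A} : mk I a = 0 ↔ a ∈ I := Submodule.Quotient.mk_eq_zero _

theorem mk_add (a b : A) : mk I (a + b) = mk I a + mk I b := rfl
theorem mk_sub (a b : A) : mk I (a - b) = mk I a - mk I b := rfl
theorem mk_zero : mk I (0 : A) = 0 := rfl
theorem mk_smul (c : ℂ) (a : A) : mk I (c • a) = c • mk I a := rfl

theorem norm_mk_le (a : A) : ‖mk I a‖ ≤ ‖a‖ := Submodule.Quotient.norm_mk_le _ a

theorem exists_norm_lt (x : I.Quot) {ε : ℝ} (hε : 0 < ε) :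
    ∃ a, mk I a = x ∧ ‖a‖ < ‖x‖ + ε := Submodule.Quotient.norm_mk_lt x hε

instance : Mul I.Quot where
  mul := Quotient.map₂ (· * ·) (by
    intro a a' h b b' h'
    have h1 : a - a' ∈ I := (Submodule.quotientRel_def _).1 h
    have h2 : b - b' ∈ I := (Submodule.quotientRel_def _).1 h'
    refine (Submodule.quotientRel_def _).2 (?_ : a * b - a' * b' ∈ I)
    have : a * b - a' * b' = (a - a') * b + a' * (b - b') := by noncomm_ring
    rw [this]
    exact add_mem (I.mul_right_mem _ h1) (I.mul_left_mem _ h2))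

theorem mk_mul (a b : A) : mk I (a * b) = mk I a * mk I b := rfl

instance : Star I.Quot where
  star := Quotient.map star (by
    intro a b h
    have h1 : a - b ∈ I := (Submodule.quotientRel_def _).1 h
    refine (Submodule.quotientRel_def _).2 (?_ : star a - star b ∈ I)
    rw [← star_sub]
    exact star_mem h1)

theorem mk_star (a : A) : mk I (star a) = star (mk I a) := rfl

noncomputable instance : NonUnitalNormedRing I.Quot where
  dist_eq := NormedAddGroup.dist_eq
  left_distrib := by
    intro x y z
    obtain ⟨a, rfl⟩ := mk_surjective x
    obtain ⟨b, rfl⟩ := mk_surjective y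
    obtain ⟨c, rfl⟩ := mk_surjective z
    simp only [← mk_add, ← mk_mul, mul_add]
  right_distrib := by
    intro x y z
    obtain ⟨a, rfl⟩ := mk_surjective x
    obtain ⟨b, rfl⟩ := mk_surjective y
    obtain ⟨c, rfl⟩ := mk_surjective z
    simp only [← mk_add, ← mk_mul, add_mul]
  zero_mul := by
    intro x
    obtain ⟨a, rfl⟩ := mk_surjective x
    simp only [← mk_zero, ← mk_mul, zero_mul]
  mul_zero := by
    intro x
    obtain ⟨a, rfl⟩ := mk_surjective x
    simp only [← mk_zero, ← mk_mul, mul_zero]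
  mul_assoc := by
    intro x y z
    obtain ⟨a, rfl⟩ := mk_surjective x
    obtain ⟨b, rfl⟩ := mk_surjective y
    obtain ⟨c, rfl⟩ := mk_surjective z
    simp only [← mk_mul, mul_assoc]
  norm_mul_le := by
    intro x y
    have key : ∀ ε : ℝ, 0 < ε → ‖x * y‖ ≤ (‖x‖ + ε) * (‖y‖ + ε) := by
      intro ε hε
      obtain ⟨a, rfl, ha⟩ := exists_norm_lt x hε
      obtain ⟨b, rfl, hb⟩ := exists_norm_lt y hε
      calc ‖mk I a * mk I b‖ = ‖mk I (a * b)‖ := rfl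
        _ ≤ ‖a * b‖ := norm_mk_le _
        _ ≤ ‖a‖ * ‖b‖ := norm_mul_le _ _
        _ ≤ _ := by gcongr
    have hlim : Filter.Tendsto (fun ε : ℝ => (‖x‖ + ε) * (‖y‖ + ε)) (nhdsWithin 0 (Set.Ioi 0))
        (nhds (‖x‖ * ‖y‖)) := by
      have : Continuous fun ε : ℝ => (‖x‖ + ε) * (‖y‖ + ε) := by fun_prop
      have h := (this.tendsto 0).mono_left (nhdsWithin_le_nhds (s := Set.Ioi 0))
      simpa using h
    exact ge_of_tendsto hlim (by filter_upwards [self_mem_nhdsWithin] with ε hε using key ε hε)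

noncomputable instance : StarRing I.Quot where
  star_involutive := by
    intro x
    obtain ⟨a, rfl⟩ := mk_surjective x
    simp only [← mk_star, star_star]
  star_mul := by
    intro x y
    obtain ⟨a, rfl⟩ := mk_surjective x
    obtain ⟨b, rfl⟩ := mk_surjective y
    simp only [← mk_star, ← mk_mul, star_mul]
  star_add := by
    intro x y
    obtain ⟨a, rfl⟩ := mk_surjective x
    obtain ⟨b, rfl⟩ := mk_surjective y
    simp only [← mk_star, ← mk_add, star_add]

theorem norm_mul_self_le (x : I.Quot) : ‖x‖ * ‖x‖ ≤ ‖star x * x‖ := by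
  refine le_of_forall_pos_le_add fun ε hε => ?_
  obtain ⟨a, rfl⟩ := mk_surjective x
  obtain ⟨m, hm, hm'⟩ := exists_norm_lt (star (mk I a) * mk I a) (half_pos hε)
  have hj : m - star a * a ∈ I := mk_eq_mk.1 hm
  obtain ⟨e, heI, hes, hej, hec⟩ := I.exists_approx _ hj (half_pos hε)
  have hec' : ∀ c : A, ‖c - e * c‖ ≤ ‖c‖ := by
    intro c
    have := hec (star c)
    rwa [← norm_star, star_sub, star_mul, star_star, hes, norm_star] at this
  have h1 : ‖mk I a‖ ≤ ‖a - a * e‖ := by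
    have : mk I a = mk I (a - a * e) := mk_eq_mk.2 (by
      rw [sub_sub_cancel]; exact I.mul_left_mem _ heI)
    rw [this]; exact norm_mk_le _
  have h2 : star (a - a * e) * (a - a * e) =
      (star a * a - star a * a * e) - e * (star a * a - star a * a * e) := by
    rw [star_sub, star_mul, hes]; noncomm_ring
  have h3 : star a * a - star a * a * e =
      (m - m * e) - ((m - star a * a) - (m - star a * a) * e) := by noncomm_ring
  calc ‖mk I a‖ * ‖mk I a‖ ≤ ‖a - a * e‖ * ‖a - a * e‖ := by gcongr
    _ = ‖star (a - a * e) * (a - a * e)‖ := (CStarRing.norm_star_mul_self).symm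
    _ ≤ ‖star a * a - star a * a * e‖ := by rw [h2]; exact hec' _
    _ ≤ ‖m - m * e‖ + ‖(m - star a * a) - (m - star a * a) * e‖ := by
        rw [h3]; exact norm_sub_le _ _
    _ ≤ ‖m‖ + ε / 2 := by gcongr; exact hec m
    _ ≤ _ := by linarith

noncomputable instance : NonUnitalCStarAlgebra I.Quot where
  norm_mul_self_le := norm_mul_self_le
  smul_assoc := by
    intro c x y
    obtain ⟨a, rfl⟩ := mk_surjective x
    obtain ⟨b, rfl⟩ := mk_surjective y
    simp only [smul_eq_mul, ← mk_smul, ← mk_mul, smul_mul_assoc]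
  smul_comm := by
    intro c x y
    obtain ⟨a, rfl⟩ := mk_surjective x
    obtain ⟨b, rfl⟩ := mk_surjective y
    simp only [smul_eq_mul, ← mk_smul, ← mk_mul, mul_smul_comm]
  star_smul := by
    intro c x
    obtain ⟨a, rfl⟩ := mk_surjective x
    simp only [← mk_smul, ← mk_star, star_smul]

variable (I)

/-- The quotient *-homomorphism. -/
noncomputable def mkHom : A →⋆ₙₐ[ℂ] I.Quot where
  toFun := mk I
  map_smul' _ _ := rfl
  map_zero' := rfl
  map_add' _ _ := rfl
  map_mul' _ _ := rfl
  map_star' _ := rfl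

variable {I}

/-- The *-homomorphism `A/I → B` induced by a *-homomorphism `A → B` that kills `I`. -/
noncomputable def lift {B : Type v} [NonUnitalCStarAlgebra B] (f : A →⋆ₙₐ[ℂ] B)
    (hf : ∀ a ∈ I, f a = 0) : I.Quot →⋆ₙₐ[ℂ] B where
  toFun := Quotient.lift f (by
    intro a b h
    have h1 : a - b ∈ I := (Submodule.quotientRel_def _).1 h
    rw [← sub_eq_zero, ← map_sub]
    exact hf _ h1)
  map_smul' c x := by
    obtain ⟨a, rfl⟩ := mk_surjective x
    exact map_smul f c a
  map_zero' := map_zero f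
  map_add' x y := by
    obtain ⟨a, rfl⟩ := mk_surjective x
    obtain ⟨b, rfl⟩ := mk_surjective y
    exact map_add f a b
  map_mul' x y := by
    obtain ⟨a, rfl⟩ := mk_surjective x
    obtain ⟨b, rfl⟩ := mk_surjective y
    exact map_mul f a b
  map_star' x := by
    obtain ⟨a, rfl⟩ := mk_surjective x
    exact map_star f a

theorem lift_mk {B : Type v} [NonUnitalCStarAlgebra B] (f : A →⋆ₙₐ[ℂ] B)
    (hf : ∀ a ∈ I, f a = 0) (a : A) : lift f hf (mk I a) = f a := rfl

end Quot

/-- For closed ideals `I, J` of `A`, the closed ideal `I ∩ J` of `I`. -/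
noncomputable def within (I J : CStarIdeal A) : CStarIdeal I where
  toSubmodule := J.toSubmodule.comap
    ({ toFun := fun a => a.1, map_add' := fun _ _ => rfl, map_smul' := fun _ _ => rfl } :
      I →ₗ[ℂ] A)
  mul_left_mem' a _ hx := J.mul_left_mem (a : A) hx
  mul_right_mem' a _ hx := J.mul_right_mem (a : A) hx
  star_mem' hx := J.star_mem' hx
  isClosed' := J.isClosed'.preimage continuous_subtype_val

theorem mem_within {I J : CStarIdeal A} {a : I} : a ∈ within I J ↔ (a : A) ∈ J := Iff.rfl

/-- The subquotient `I / (I ∩ J)` of `A`. -/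
abbrev SubQuot (I J : CStarIdeal A) : Type u := (within I J).Quot

/-- The inclusions `I ⊆ I'` and `J ⊆ J'` induce a *-homomorphism of subquotients. -/
noncomputable def subQuotMap {I J I' J' : CStarIdeal A} (hI : (I : Set A) ⊆ I') (hJ : (J : Set A) ⊆ J') :
    SubQuot I J →⋆ₙₐ[ℂ] SubQuot I' J' :=
  Quot.lift
    ((Quot.mkHom (within I' J')).comp
      { toFun := fun a => ⟨(a : A), hI a.2⟩
        map_smul' := fun _ _ => rfl
        map_zero' := rfl
        map_add' := fun _ _ => rfl
        map_mul' := fun _ _ => rfl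
        map_star' := fun _ => rfl })
    (fun _ ha => Quot.mk_eq_zero.2 (hJ ha))

end CStarIdeal


/-- The data of a short exact sequence `0 → J → A → B → 0` of C*-algebras. -/
structure IsShortExact {J A B : Type*} [NonUnitalCStarAlgebra J] [NonUnitalCStarAlgebra A]
    [NonUnitalCStarAlgebra B] (i : J →⋆ₙₐ[ℂ] A) (q : A →⋆ₙₐ[ℂ] B) : Prop where
  injective : Function.Injective i
  surjective : Function.Surjective q
  exact : Function.Exact i q

/-- C*-algebras (not necessarily unital) with underlying type in `Type u`. -/
structure CStarAlgCat : Type (u + 1) where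
  carrier : Type u
  [str : NonUnitalCStarAlgebra carrier]

namespace CStarAlgCat

instance : CoeSort CStarAlgCat.{u} (Type u) := ⟨carrier⟩

instance (A : CStarAlgCat.{u}) : NonUnitalCStarAlgebra A := A.str

/-- The category of all C*-algebras and *-homomorphisms. -/
instance : Category CStarAlgCat.{u} where
  Hom A B := A →⋆ₙₐ[ℂ] B
  id A := NonUnitalStarAlgHom.id ℂ A
  comp f g := NonUnitalStarAlgHom.comp g f

end CStarAlgCat

open ZeroAtInfty MultiplierAlgebra

/-- A good subcategory of the category of all C*-algebras: a full subcategory that contains the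
complex numbers and is closed under ideals, quotients, extensions, suspensions and
isomorphism. -/
structure GoodSubcategory where
  prop : ObjectProperty CStarAlgCat.{u}
  complex_mem : ∀ B : CStarAlgCat.{u}, Nonempty (B ≃⋆ₐ[ℂ] ℂ) → prop B
  iso_mem : ∀ A B : CStarAlgCat.{u}, Nonempty (A ≃⋆ₐ[ℂ] B) → prop A → prop B
  ideal_mem : ∀ {J A B : CStarAlgCat.{u}} (i : J →⋆ₙₐ[ℂ] A) (q : A →⋆ₙₐ[ℂ] B),
    IsShortExact i q → prop A → prop J
  quotient_mem : ∀ {J A B : CStarAlgCat.{u}} (i : J →⋆ₙₐ[ℂ] A) (q : A →⋆ₙₐ[ℂ] B),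
    IsShortExact i q → prop A → prop B
  extension_mem : ∀ {J A B : CStarAlgCat.{u}} (i : J →⋆ₙₐ[ℂ] A) (q : A →⋆ₙₐ[ℂ] B),
    IsShortExact i q → prop J → prop B → prop A
  suspension_mem : ∀ A : CStarAlgCat.{u}, prop A → prop ⟨C₀(ℝ, A)⟩

/-- The objects of a good subcategory, with all *-homomorphisms as morphisms. -/
abbrev GoodSubcategory.Cat (C : GoodSubcategory.{u}) := C.prop.FullSubcategory

/-- Two *-homomorphisms `f₀, f₁ : A → B` are homotopic if they are the two end point evaluations of
a *-homomorphism `A → C([0,1], B)`. -/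
def Homotopic {A B : Type*} [NonUnitalCStarAlgebra A] [NonUnitalCStarAlgebra B]
    (f₀ f₁ : A →⋆ₙₐ[ℂ] B) : Prop :=
  ∃ H : A →⋆ₙₐ[ℂ] C(unitInterval, B), ∀ a, H a 0 = f₀ a ∧ H a 1 = f₁ a

/-- A short exact sequence in a good subcategory. -/
structure ShortExactSeq (C : GoodSubcategory.{u}) where
  {J A B : C.Cat}
  i : J ⟶ A
  q : A ⟶ B
  shortExact : IsShortExact i.hom q.hom

/-- A morphism of short exact sequences. -/
structure ShortExactSeq.Hom {C : GoodSubcategory.{u}} (S T : ShortExactSeq C) where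
  fJ : S.J ⟶ T.J
  fA : S.A ⟶ T.A
  fB : S.B ⟶ T.B
  comm_i : S.i ≫ fA = fJ ≫ T.i
  comm_q : S.q ≫ fB = fA ≫ T.q

/-- A homology theory on a good subcategory of C*-algebras: covariant functors `hₙ`, `n ∈ ℤ`, to
abelian groups which are homotopy invariant and have natural long exact sequences. The connecting
map `hₙ(B) → hₙ₋₁(J)` is written `bdry S n m _` with `m + 1 = n`. -/
structure HomologyTheory (C : GoodSubcategory.{u}) where
  h : ℤ → C.Cat ⥤ AddCommGrpCat.{v}
  homotopy : ∀ {A B : C.Cat} (f₀ f₁ : A ⟶ B), Homotopic f₀.hom f₁.hom →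
    ∀ n, (h n).map f₀ = (h n).map f₁
  bdry : ∀ (S : ShortExactSeq C) (n m : ℤ), m + 1 = n → ((h n).obj S.B ⟶ (h m).obj S.J)
  bdry_natural : ∀ {S T : ShortExactSeq C} (f : S.Hom T) (n m : ℤ) (hnm : m + 1 = n),
    (h n).map f.fB ≫ bdry T n m hnm = bdry S n m hnm ≫ (h m).map f.fJ
  exact_A : ∀ (S : ShortExactSeq C) (n : ℤ),
    Function.Exact ((h n).map S.i) ((h n).map S.q)
  exact_B : ∀ (S : ShortExactSeq C) (n m : ℤ) (hnm : m + 1 = n),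
    Function.Exact ((h n).map S.q) (bdry S n m hnm)
  exact_J : ∀ (S : ShortExactSeq C) (n m : ℤ) (hnm : m + 1 = n),
    Function.Exact (bdry S n m hnm) ((h m).map S.i)

namespace CStarIdeal

variable {A : Type u} [NonUnitalCStarAlgebra A]

theorem isShortExact (I : CStarIdeal A) : IsShortExact I.incl (Quot.mkHom I) where
  injective := Subtype.val_injective
  surjective := Quot.mk_surjective
  exact a := by
    refine (Quot.mk_eq_zero (I := I)).trans ⟨fun h => ⟨⟨a, h⟩, rfl⟩, ?_⟩
    rintro ⟨b, rfl⟩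
    exact b.2

end CStarIdeal

namespace GoodSubcategory

variable (C : GoodSubcategory.{u})

theorem quot_mem {A : CStarAlgCat.{u}} (hA : C.prop A) (I : CStarIdeal A) : C.prop ⟨I.Quot⟩ :=
  C.quotient_mem (J := ⟨I⟩) (A := A) (B := ⟨I.Quot⟩) _ _ I.isShortExact hA

theorem subQuot_mem {A : CStarAlgCat.{u}} (hA : C.prop A) (I J : CStarIdeal A) :
    C.prop ⟨I.SubQuot J⟩ :=
  C.quot_mem (A := ⟨I⟩)
    (C.ideal_mem (J := ⟨I⟩) (A := A) (B := ⟨I.Quot⟩) _ _ I.isShortExact hA) _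

end GoodSubcategory

/-- A `C₀(X)`-algebra: a C*-algebra with a nondegenerate *-homomorphism from `C₀(X)` to the centre
of its multiplier algebra. -/
structure C0Algebra (X : Type w) [TopologicalSpace X] where
  alg : CStarAlgCat.{u}
  Φ : C₀(X, ℂ) →⋆ₙₐ[ℂ] 𝓜(ℂ, alg)
  central : ∀ (f : C₀(X, ℂ)) (m : 𝓜(ℂ, alg)), Φ f * m = m * Φ f
  nondegenerate : (Submodule.span ℂ {b : alg | ∃ f a, b = (Φ f).fst a}).topologicalClosure = ⊤

namespace C0Algebra

variable {X : Type w} [TopologicalSpace X] (A : C0Algebra.{u} X)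

/-- The product `Φ(f) · a`. -/
noncomputable def act (f : C₀(X, ℂ)) : A.alg →L[ℂ] A.alg := (A.Φ f).fst

theorem act_mul_left (f : C₀(X, ℂ)) (b a : A.alg) : b * A.act f a = A.act f (b * a) := by
  have h := A.central f (DoubleCentralizer.coe ℂ b)
  have h1 := congrArg (fun m : 𝓜(ℂ, A.alg) => m.fst a) h
  simpa [act] using h1.symm

theorem eq_of_mul_left_eq {a b : A.alg} (h : ∀ z, z * a = z * b) : a = b := by
  have h1 : star (a - b) * (a - b) = 0 := by rw [mul_sub, h, sub_self]
  exact sub_eq_zero.1 ((CStarRing.star_mul_self_eq_zero_iff _).1 h1)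

theorem eq_of_mul_right_eq {a b : A.alg} (h : ∀ z, a * z = b * z) : a = b := by
  have h1 : (a - b) * star (a - b) = 0 := by rw [sub_mul, h, sub_self]
  exact sub_eq_zero.1 ((CStarRing.mul_star_self_eq_zero_iff _).1 h1)

theorem act_mul_right (f : C₀(X, ℂ)) (a b : A.alg) : A.act f a * b = A.act f (a * b) := by
  refine A.eq_of_mul_left_eq fun z => ?_
  rw [← mul_assoc]
  change z * (A.Φ f).fst a * b = z * (A.Φ f).fst (a * b)
  rw [← (A.Φ f).central, ← (A.Φ f).central, mul_assoc]

theorem snd_eq (f : C₀(X, ℂ)) (a : A.alg) : (A.Φ f).snd a = A.act f a := by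
  refine A.eq_of_mul_right_eq fun z => ?_
  rw [(A.Φ f).central, A.act_mul_right]
  exact A.act_mul_left f a z

theorem star_act (f : C₀(X, ℂ)) (a : A.alg) : star (A.act f a) = A.act (star f) (star a) := by
  rw [← A.snd_eq (star f), map_star A.Φ f, DoubleCentralizer.star_snd, star_star]
  rfl

theorem act_act (f g : C₀(X, ℂ)) (a : A.alg) : A.act f (A.act g a) = A.act (f * g) a := by
  simp only [act, map_mul, DoubleCentralizer.mul_fst]
  rfl

theorem norm_act_le (f : C₀(X, ℂ)) (a : A.alg) : ‖A.act f a‖ ≤ ‖f‖ * ‖a‖ := by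
  refine ((A.act f).le_opNorm a).trans ?_
  gcongr
  rw [act, DoubleCentralizer.norm_fst]
  exact NonUnitalStarAlgHom.norm_apply_le A.Φ f

/-- The linear span of all products `Φ(f) · a` where `f` vanishes outside `U`. -/
def idealSpan (U : Set X) : Submodule ℂ A.alg :=
  Submodule.span ℂ {b | ∃ (f : C₀(X, ℂ)) (a : A.alg), (∀ x ∉ U, f x = 0) ∧ b = A.act f a}

theorem closure_induction {U : Set X} (P : Submodule ℂ A.alg) (hP : IsClosed (P : Set A.alg))
    (h : ∀ (f : C₀(X, ℂ)) (a : A.alg), (∀ x ∉ U, f x = 0) → A.act f a ∈ P) :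
    (A.idealSpan U).topologicalClosure ≤ P := by
  refine Submodule.topologicalClosure_minimal _ (Submodule.span_le.2 ?_) hP
  rintro _ ⟨f, a, hf, rfl⟩
  exact h f a hf

theorem act_mem_closure {U : Set X} (f : C₀(X, ℂ)) (a : A.alg) (hf : ∀ x ∉ U, f x = 0) :
    A.act f a ∈ (A.idealSpan U).topologicalClosure :=
  Submodule.le_topologicalClosure _ (Submodule.subset_span ⟨f, a, hf, rfl⟩)

/-- The ideal `A(U) = C₀(U) · A` for open `U`: the closed span of all `Φ(f) · a` with
`f` vanishing outside `U`. -/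
noncomputable def ideal (U : Set X) : CStarIdeal A.alg where
  toSubmodule := (A.idealSpan U).topologicalClosure
  mul_left_mem' a x hx := by
    refine A.closure_induction (U := U)
      ((A.idealSpan U).topologicalClosure.comap (LinearMap.mulLeft ℂ a)) ?_ ?_ hx
    · exact (Submodule.isClosed_topologicalClosure _).preimage (continuous_const_mul a)
    · intro f b hf
      change a * A.act f b ∈ (A.idealSpan U).topologicalClosure
      rw [A.act_mul_left]
      exact A.act_mem_closure f _ hf
  mul_right_mem' a x hx := by
    refine A.closure_induction (U := U)
      ((A.idealSpan U).topologicalClosure.comap (LinearMap.mulRight ℂ a)) ?_ ?_ hx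
    · exact (Submodule.isClosed_topologicalClosure _).preimage (continuous_mul_const a)
    · intro f b hf
      change A.act f b * a ∈ (A.idealSpan U).topologicalClosure
      rw [A.act_mul_right]
      exact A.act_mem_closure f _ hf
  star_mem' {x} hx := by
    refine A.closure_induction (U := U)
      { carrier := {x | star x ∈ (A.idealSpan U).topologicalClosure}
        add_mem' := fun {x y} hx hy => by
          simp only [Set.mem_ofPred_eq, star_add] at *
          exact add_mem hx hy
        zero_mem' := by simp
        smul_mem' := fun c x hx => by
          simp only [Set.mem_ofPred_eq, star_smul] at *
          exact Submodule.smul_mem _ _ hx } ?_ ?_ hx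
    · exact (Submodule.isClosed_topologicalClosure _).preimage continuous_star
    · intro f b hf
      change star (A.act f b) ∈ (A.idealSpan U).topologicalClosure
      rw [A.star_act]
      exact A.act_mem_closure _ _ fun x hx => by simp [hf x hx]
  isClosed' := Submodule.isClosed_topologicalClosure _

theorem act_mem_ideal {U : Set X} (f : C₀(X, ℂ)) (a : A.alg) (hf : ∀ x ∉ U, f x = 0) :
    A.act f a ∈ A.ideal U := A.act_mem_closure f a hf

theorem ideal_mono {U V : Set X} (h : U ⊆ V) : (A.ideal U : Set A.alg) ⊆ A.ideal V := by
  intro a ha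
  exact A.closure_induction (U := U) (A.ideal V).toSubmodule (A.ideal V).isClosed'
    (fun f a hf => A.act_mem_ideal f a fun x hx => hf x fun hx' => hx (h hx')) ha

theorem mul_mem_ideal_inter {U V : Set X} {a b : A.alg} (ha : a ∈ A.ideal U) (hb : b ∈ A.ideal V) :
    a * b ∈ A.ideal (U ∩ V) := by
  refine A.closure_induction (U := U)
    ((A.ideal (U ∩ V)).toSubmodule.comap (LinearMap.mulRight ℂ b)) ?_ ?_ ha
  · exact (A.ideal (U ∩ V)).isClosed'.preimage (continuous_mul_const b)
  · intro f a hf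
    refine A.closure_induction (U := V)
      ((A.ideal (U ∩ V)).toSubmodule.comap (LinearMap.mulLeft ℂ (A.act f a))) ?_ ?_ hb
    · exact (A.ideal (U ∩ V)).isClosed'.preimage (continuous_const_mul _)
    · intro g b hg
      change A.act f a * A.act g b ∈ A.ideal (U ∩ V)
      rw [A.act_mul_right, A.act_mul_left, A.act_act]
      refine A.act_mem_ideal _ _ fun x hx => ?_
      rw [ZeroAtInftyContinuousMap.mul_apply]
      by_cases hxU : x ∈ U
      · rw [hg x fun h => hx ⟨hxU, h⟩, mul_zero]
      · rw [hf x hxU, zero_mul]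

theorem mem_ideal_inter {U V : Set X} {a : A.alg} (ha : a ∈ A.ideal U) (hb : a ∈ A.ideal V) :
    a ∈ A.ideal (U ∩ V) := by
  have h : a ∈ closure (A.ideal (U ∩ V) : Set A.alg) := by
    rw [Metric.mem_closure_iff]
    intro ε hε
    obtain ⟨e, he, -, hlt, -⟩ := (A.ideal V).exists_approx a hb hε
    exact ⟨a * e, A.mul_mem_ideal_inter ha he, by rwa [dist_eq_norm]⟩
  have hcl : IsClosed (A.ideal (U ∩ V) : Set A.alg) := (A.ideal (U ∩ V)).isClosed'
  rwa [hcl.closure_eq] at h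

/-- The product of a `C₀`-function with a `[0,1]`-valued continuous function. -/
noncomputable def cutoff (χ : C(X, ℝ)) (hχ : ∀ x, χ x ∈ Set.Icc (0 : ℝ) 1) (g : C₀(X, ℂ)) : C₀(X, ℂ) where
  toFun x := (χ x : ℂ) * g x
  continuous_toFun := by fun_prop
  zero_at_infty' := by
    have h := (zero_at_infty g).norm
    rw [norm_zero] at h
    refine squeeze_zero_norm (fun x => ?_) h
    rw [norm_mul, Complex.norm_real, Real.norm_of_nonneg (hχ x).1]
    exact mul_le_of_le_one_left (norm_nonneg _) (hχ x).2

theorem exists_split [T2Space X] [LocallyCompactSpace X] {U V : Set X} (hU : IsOpen U)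
    (hV : IsOpen V) (g : C₀(X, ℂ)) (hg : ∀ x ∉ U ∪ V, g x = 0) {ε : ℝ} (hε : 0 < ε) :
    ∃ f₁ f₂ : C₀(X, ℂ), (∀ x ∉ U, f₁ x = 0) ∧ (∀ x ∉ V, f₂ x = 0) ∧ ‖g - (f₁ + f₂)‖ ≤ ε := by
  have hK : IsCompact {x | ε ≤ ‖g x‖} := by
    have h := (zero_at_infty g).norm
    rw [norm_zero] at h
    have h2 : ∀ᶠ x in Filter.cocompact X, ‖g x‖ < ε := h.eventually (gt_mem_nhds hε)
    obtain ⟨t, ht, hts⟩ := Filter.mem_cocompact.1 h2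
    refine ht.of_isClosed_subset (isClosed_le continuous_const (by fun_prop)) fun x hx => ?_
    by_contra hxt
    exact absurd (show ‖g x‖ < ε from hts hxt) (not_lt.2 hx)
  obtain ⟨χ, h1, h2, h3, -⟩ := exists_continuous_sum_one_of_isOpen_isCompact (n := 2)
    (s := ![U, V]) (by intro i; fin_cases i <;> assumption) hK (by
      intro x hx
      by_contra hx'
      have : g x = 0 := hg x fun h => hx' (by
        rcases h with h | h
        · exact Set.mem_iUnion.2 ⟨0, h⟩
        · exact Set.mem_iUnion.2 ⟨1, h⟩)
      rw [Set.mem_ofPred_eq, this, norm_zero] at hx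
      linarith)
  have hs : ∀ i x, x ∉ (![U, V] : Fin 2 → Set X) i → χ i x = 0 := fun i x hx =>
    image_eq_zero_of_notMem_tsupport fun h => hx (h1 i h)
  refine ⟨cutoff (χ 0) (h3 0) g, cutoff (χ 1) (h3 1) g, fun x hx => ?_, fun x hx => ?_, ?_⟩
  · change (χ 0 x : ℂ) * g x = 0
    rw [hs 0 x hx]; simp
  · change (χ 1 x : ℂ) * g x = 0
    rw [hs 1 x hx]; simp
  · rw [← ZeroAtInftyContinuousMap.norm_toBCF_eq_norm, BoundedContinuousFunction.norm_le hε.le]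
    intro x
    change ‖g x - ((χ 0 x : ℂ) * g x + (χ 1 x : ℂ) * g x)‖ ≤ ε
    have heq : g x - ((χ 0 x : ℂ) * g x + (χ 1 x : ℂ) * g x) =
        ((1 - χ 0 x - χ 1 x : ℝ) : ℂ) * g x := by push_cast; ring
    rw [heq, norm_mul, Complex.norm_real]
    by_cases hx : ε ≤ ‖g x‖
    · have := h2 hx
      simp only [Fin.sum_univ_two, Pi.add_apply, Pi.one_apply] at this
      have h0 : 1 - χ 0 x - χ 1 x = 0 := by linarith
      rw [h0]; simp [hε.le]
    · have h4 : ‖(1 - χ 0 x - χ 1 x : ℝ)‖ ≤ 1 := by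
        rw [Real.norm_eq_abs, abs_le]
        constructor <;> linarith [(h3 0 x).1, (h3 0 x).2, (h3 1 x).1, (h3 1 x).2]
      calc _ ≤ 1 * ‖g x‖ := by gcongr
        _ ≤ ε := by rw [one_mul]; exact (not_le.1 hx).le

/-- `A(U ∪ V) = A(U) + A(V)` for open sets `U` and `V`. -/
theorem exists_mem_ideal_sub_mem [T2Space X] [LocallyCompactSpace X] {U V : Set X} (hU : IsOpen U)
    (hV : IsOpen V) {c : A.alg} (hc : c ∈ A.ideal (U ∪ V)) :
    ∃ a ∈ A.ideal U, a - c ∈ A.ideal V := by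
  let ψ : (A.ideal U).SubQuot (A.ideal V) →⋆ₙₐ[ℂ] (A.ideal V).Quot :=
    CStarIdeal.Quot.lift ((CStarIdeal.Quot.mkHom (A.ideal V)).comp (A.ideal U).incl)
      (fun a ha => CStarIdeal.Quot.mk_eq_zero.2 ha)
  have hψ : Function.Injective ψ := by
    refine (injective_iff_map_eq_zero ψ).2 fun x hx => ?_
    obtain ⟨a, rfl⟩ := CStarIdeal.Quot.mk_surjective x
    have hx' : CStarIdeal.Quot.mk (A.ideal V) (a : A.alg) = 0 := hx
    exact CStarIdeal.Quot.mk_eq_zero.2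
      (CStarIdeal.mem_within.2 ((CStarIdeal.Quot.mk_eq_zero (I := A.ideal V)).1 hx'))
  have hcl : IsClosed (Set.range ψ) :=
    (NonUnitalStarAlgHom.isometry ψ hψ).isClosedEmbedding.isClosed_range
  have hmk : Continuous (CStarIdeal.Quot.mkHom (A.ideal V)) :=
    AddMonoidHomClass.continuous_of_bound _ 1 fun a => by
      rw [one_mul]; exact CStarIdeal.Quot.norm_mk_le a
  have hmem : CStarIdeal.Quot.mkHom (A.ideal V) c ∈ Set.range ψ := by
    refine A.closure_induction (U := U ∪ V)
      { carrier := {c | CStarIdeal.Quot.mkHom (A.ideal V) c ∈ Set.range ψ}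
        add_mem' := ?_
        zero_mem' := ⟨0, by simp⟩
        smul_mem' := ?_ } (hcl.preimage hmk) ?_ hc
    · rintro x y ⟨x', hx⟩ ⟨y', hy⟩
      exact ⟨x' + y', by simp [hx, hy]⟩
    · rintro k x ⟨x', hx⟩
      exact ⟨k • x', by simp [hx]⟩
    · intro g a hg
      change CStarIdeal.Quot.mkHom (A.ideal V) (A.act g a) ∈ Set.range ψ
      rw [← hcl.closure_eq, Metric.mem_closure_iff]
      intro ε hε
      obtain ⟨f₁, f₂, h1, h2, h3⟩ := exists_split hU hV g hg
        (ε := ε / (‖a‖ + 1)) (by positivity)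
      refine ⟨_, ⟨CStarIdeal.Quot.mk _ ⟨A.act f₁ a, A.act_mem_ideal f₁ a h1⟩, rfl⟩, ?_⟩
      change dist (CStarIdeal.Quot.mkHom (A.ideal V) (A.act g a))
        (CStarIdeal.Quot.mkHom (A.ideal V) (A.act f₁ a)) < ε
      have h4 : CStarIdeal.Quot.mkHom (A.ideal V) (A.act f₂ a) = 0 :=
        CStarIdeal.Quot.mk_eq_zero.2 (A.act_mem_ideal f₂ a h2)
      have h5 : A.act (g - (f₁ + f₂)) a = A.act g a - (A.act f₁ a + A.act f₂ a) := by
        simp [act]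
      rw [dist_eq_norm]
      calc ‖CStarIdeal.Quot.mkHom (A.ideal V) (A.act g a) -
            CStarIdeal.Quot.mkHom (A.ideal V) (A.act f₁ a)‖
          = ‖CStarIdeal.Quot.mkHom (A.ideal V) (A.act (g - (f₁ + f₂)) a)‖ := by
            rw [h5, map_sub, map_add, h4, add_zero]
        _ ≤ ‖A.act (g - (f₁ + f₂)) a‖ := CStarIdeal.Quot.norm_mk_le _
        _ ≤ ‖g - (f₁ + f₂)‖ * ‖a‖ := A.norm_act_le _ _
        _ ≤ ε / (‖a‖ + 1) * ‖a‖ := by gcongr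
        _ < ε := by
            rw [div_mul_eq_mul_div, div_lt_iff₀ (by positivity)]
            nlinarith
  obtain ⟨x, hx⟩ := hmem
  obtain ⟨a, rfl⟩ := CStarIdeal.Quot.mk_surjective x
  exact ⟨a, a.2, CStarIdeal.Quot.mk_eq_mk.1 hx⟩

theorem subQuotMap_surjective [T2Space X] [LocallyCompactSpace X] {U V U' V' : Set X}
    (hU : U ⊆ U') (hV : V ⊆ V') (oU : IsOpen U) (oV' : IsOpen V') (h : U' ⊆ U ∪ V') :
    Function.Surjective (CStarIdeal.subQuotMap (A.ideal_mono hU) (A.ideal_mono hV)) := by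
  intro x
  obtain ⟨c, rfl⟩ := CStarIdeal.Quot.mk_surjective x
  obtain ⟨a, ha, hac⟩ := A.exists_mem_ideal_sub_mem oU oV' (A.ideal_mono h c.2)
  exact ⟨CStarIdeal.Quot.mk _ ⟨a, ha⟩, CStarIdeal.Quot.mk_eq_mk.2 hac⟩

theorem subQuotMap_mk_eq_zero {U V U' V' : Set X} (hU : U ⊆ U') (hV : V ⊆ V') (a : A.ideal U) :
    CStarIdeal.subQuotMap (A.ideal_mono hU) (A.ideal_mono hV) (CStarIdeal.Quot.mk _ a) = 0 ↔
      (a : A.alg) ∈ A.ideal V' :=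
  CStarIdeal.Quot.mk_eq_zero

theorem subQuotMap_injective {U V U' V' : Set X} (hU : U ⊆ U') (hV : V ⊆ V')
    (h : U ∩ V' ⊆ V) :
    Function.Injective (CStarIdeal.subQuotMap (A.ideal_mono hU) (A.ideal_mono hV)) := by
  refine (injective_iff_map_eq_zero _).2 fun x hx => ?_
  obtain ⟨a, rfl⟩ := CStarIdeal.Quot.mk_surjective x
  rw [A.subQuotMap_mk_eq_zero hU hV] at hx
  exact CStarIdeal.Quot.mk_eq_zero.2 (A.ideal_mono h (A.mem_ideal_inter a.2 hx))

end C0Algebra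

namespace GoodSubcategory

variable (C : GoodSubcategory.{u})

theorem of_surjective {A B : CStarAlgCat.{u}} (φ : A →⋆ₙₐ[ℂ] B) (hφ : Function.Surjective φ)
    (hA : C.prop A) : C.prop B := by
  let K : CStarIdeal A :=
    { toSubmodule :=
        { carrier := {a | φ a = 0}
          add_mem' := fun {a b} (ha : φ a = 0) (hb : φ b = 0) => by
            change φ (a + b) = 0
            rw [map_add, ha, hb, add_zero]
          zero_mem' := map_zero φ
          smul_mem' := fun c a (ha : φ a = 0) => by
            change φ (c • a) = 0
            rw [map_smul, ha, smul_zero] }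
      mul_left_mem' := fun b a (ha : φ a = 0) => by
        change φ (b * a) = 0
        rw [map_mul, ha, mul_zero]
      mul_right_mem' := fun b a (ha : φ a = 0) => by
        change φ (a * b) = 0
        rw [map_mul, ha, zero_mul]
      star_mem' := fun {a} (ha : φ a = 0) => by
        change φ (star a) = 0
        rw [map_star, ha, star_zero]
      isClosed' := isClosed_eq
        (AddMonoidHomClass.continuous_of_bound φ 1 fun a => by
          rw [one_mul]; exact NonUnitalStarAlgHom.norm_apply_le φ a) continuous_const }
  refine C.quotient_mem (J := ⟨K⟩) (A := A) (B := B) K.incl φ ⟨Subtype.val_injective, hφ, ?_⟩ hA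
  intro a
  refine ⟨fun h => ⟨⟨a, h⟩, rfl⟩, ?_⟩
  rintro ⟨b, rfl⟩
  exact b.2

end GoodSubcategory

/-- The standard `p`-simplex `Δᵖ`. -/
abbrev Simplex (p : ℕ) : Type := stdSimplex ℝ (Fin (p + 1))

section SimplexAlgebra

/-- The degeneracy `Δᵖ⁺¹ → Δᵖ` that adds the first two barycentric coordinates. -/
def simplexMerge {p : ℕ} (t : Simplex (p + 1)) : Simplex p :=
  ⟨fun j => t j.succ + if j = 0 then t 0 else 0, by
    refine ⟨fun j => add_nonneg (t.2.1 _) ?_, ?_⟩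
    · split_ifs
      · exact t.2.1 _
      · exact le_rfl
    · have h := t.2.2
      rw [Fin.sum_univ_succ] at h
      rw [Finset.sum_add_distrib, Finset.sum_ite_eq' Finset.univ (0 : Fin (p + 1))]
      simp only [Finset.mem_univ, if_true]
      rw [add_comm]; exact h⟩

theorem continuous_simplexMerge {p : ℕ} : Continuous (simplexMerge (p := p)) := by
  refine Continuous.subtype_mk (continuous_pi fun j => ?_) _
  have h : ∀ i : Fin (p + 2), Continuous fun t : Simplex (p + 1) => t i := fun i =>
    (continuous_apply i).comp continuous_subtype_val
  refine (h _).add ?_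
  split_ifs
  · exact h _
  · exact continuous_const

/-- The map `ℝ × Δᵖ → Δᵖ⁺¹` that splits the first barycentric coordinate. -/
def simplexSplit {p : ℕ} (u : ℝ × Simplex p) : Simplex (p + 1) :=
  ⟨Fin.cons (max 0 (min u.1 (u.2 0)))
    (fun j => u.2 j - if j = 0 then max 0 (min u.1 (u.2 0)) else 0), by
    have h0 : 0 ≤ u.2 0 := u.2.2.1 0
    refine ⟨fun j => ?_, ?_⟩
    · refine Fin.cases ?_ (fun j => ?_) j
      · simp
      · simp only [Fin.cons_succ]
        split_ifs with h
        · subst h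
          exact sub_nonneg.2 (max_le h0 (min_le_right _ _))
        · rw [sub_zero]; exact u.2.2.1 j
    · have h := u.2.2.2
      rw [Fin.sum_univ_succ]
      simp only [Fin.cons_succ, Fin.cons_zero]
      rw [Finset.sum_sub_distrib, Finset.sum_ite_eq' Finset.univ (0 : Fin (p + 1))]
      simp only [Finset.mem_univ, if_true]
      rw [add_sub_cancel]; exact h⟩

theorem continuous_simplexSplit {p : ℕ} : Continuous (simplexSplit (p := p)) := by
  have h : ∀ i : Fin (p + 1), Continuous fun u : ℝ × Simplex p => u.2 i := fun i =>
    (continuous_apply i).comp (continuous_subtype_val.comp continuous_snd)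
  have h0 : Continuous fun u : ℝ × Simplex p => max 0 (min u.1 (u.2 0)) :=
    continuous_const.max (continuous_fst.min (h 0))
  refine Continuous.subtype_mk (continuous_pi fun j => ?_) _
  refine Fin.cases ?_ (fun j => ?_) j
  · simpa using h0
  · simp only [Fin.cons_succ]
    refine (h j).sub ?_
    split_ifs
    · exact h0
    · exact continuous_const

theorem simplexSplit_merge {p : ℕ} (t : Simplex (p + 1)) :
    simplexSplit (t 0, simplexMerge t) = t := by
  have h0 : 0 ≤ t 0 := t.2.1 0
  have h1 : 0 ≤ t 1 := t.2.1 1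
  have h2 : (simplexMerge t) 0 = t 1 + t 0 := by
    change t (Fin.succ 0) + (if (0 : Fin (p + 1)) = 0 then t 0 else 0) = _
    simp
  have h3 : max 0 (min (t 0) ((simplexMerge t) 0)) = t 0 := by
    rw [h2, min_eq_left (by linarith), max_eq_right h0]
  refine Subtype.ext (funext fun j => ?_)
  refine Fin.cases ?_ (fun j => ?_) j
  · exact h3
  · change (simplexMerge t) j - (if j = 0 then max 0 (min (t 0) ((simplexMerge t) 0)) else 0) =
      t j.succ
    rw [h3]
    change t j.succ + (if j = 0 then t 0 else 0) - _ = _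
    rw [add_sub_cancel_right]

theorem GoodSubcategory.simplex_mem (C : GoodSubcategory.{u}) {A : CStarAlgCat.{u}}
    (hA : C.prop A) (p : ℕ) : C.prop ⟨C(Simplex p, A)⟩ := by
  induction p with
  | zero =>
    refine C.of_surjective (A := A) (B := ⟨C(Simplex 0, A)⟩)
      { toFun := fun a => ContinuousMap.const _ a
        map_smul' := fun _ _ => rfl
        map_zero' := rfl
        map_add' := fun _ _ => rfl
        map_mul' := fun _ _ => rfl
        map_star' := fun _ => rfl } (fun F => ?_) hA
    have hs : Subsingleton (Simplex 0) := ⟨fun s t => Subtype.ext (funext fun i => by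
      have h1 := s.2.2
      have h2 := t.2.2
      simp only [Fin.sum_univ_succ, Finset.univ_eq_empty, Finset.sum_empty, add_zero] at h1 h2
      obtain rfl : i = 0 := Fin.ext (by omega)
      exact h1.trans h2.symm)⟩
    refine ⟨F ⟨fun _ => 1, ⟨fun _ => zero_le_one, by simp⟩⟩, ?_⟩
    ext t
    exact congrArg F (Subsingleton.elim _ _)
  | succ p ih =>
    refine C.of_surjective (A := ⟨C₀(ℝ, C(Simplex p, A))⟩) (B := ⟨C(Simplex (p + 1), A)⟩)
      { toFun := fun F => ⟨fun t => F (t 0) (simplexMerge t), by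
          have h0 : Continuous fun t : Simplex (p + 1) => t 0 :=
            (continuous_apply 0).comp continuous_subtype_val
          have h1 : Continuous fun t : Simplex (p + 1) => F (t 0) := (map_continuous F).comp h0
          exact h1.eval continuous_simplexMerge⟩
        map_smul' := fun _ _ => rfl
        map_zero' := rfl
        map_add' := fun _ _ => rfl
        map_mul' := fun _ _ => rfl
        map_star' := fun _ => rfl } (fun G => ?_) (C.suspension_mem _ ih)
    let χ : ℝ → ℝ := fun t => max 0 (min 1 (2 - |t|))
    have hχ : Continuous χ := by fun_prop
    let F : C(ℝ, C(Simplex p, A)) := ContinuousMap.curry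
      ⟨fun u => (χ u.1 : ℂ) • G (simplexSplit u), by
        have := continuous_simplexSplit (p := p)
        fun_prop⟩
    refine ⟨⟨F, ?_⟩, ?_⟩
    · refine tendsto_const_nhds.congr' ?_
      filter_upwards [(isCompact_Icc (a := (-2 : ℝ)) (b := 2)).compl_mem_cocompact] with t ht
      ext y
      have ht2 : 2 ≤ |t| := by
        by_contra h
        exact ht (abs_le.1 (not_le.1 h).le)
      have hz : χ t = 0 := by
        change max 0 (min 1 (2 - |t|)) = 0
        exact max_eq_left ((min_le_right _ _).trans (by linarith))
      change (0 : A) = (χ t : ℂ) • G (simplexSplit (t, y))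
      rw [hz]; simp
    · ext t
      change (χ (t 0) : ℂ) • G (simplexSplit (t 0, simplexMerge t)) = G t
      have h0 : 0 ≤ t 0 := t.2.1 0
      have h1 : t 0 ≤ 1 := stdSimplex.le_one t 0
      have hz : χ (t 0) = 1 := by
        change max 0 (min 1 (2 - |t 0|)) = 1
        rw [abs_of_nonneg h0, min_eq_left (by linarith), max_eq_right zero_le_one]
      rw [hz, simplexSplit_merge]; simp

end SimplexAlgebra

namespace C0Algebra

variable {X : Type w} [TopologicalSpace X] (A : C0Algebra.{u} X)

/-- The fibre `A_x = A / I_x`, where `I_x` is the closed span of all `Φ(f) · a` with `f x = 0`. -/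
noncomputable def fibre (x : X) : CStarAlgCat.{u} := ⟨(A.ideal {x}ᶜ).Quot⟩

/-- The ideal of all `F ∈ C(Y) ⊗ A = C(Y, A)` with `F y ∈ I_{f y}` for all `y`. -/
noncomputable def pullbackIdeal {Y : Type} [TopologicalSpace Y] [CompactSpace Y] (f : C(Y, X)) :
    CStarIdeal C(Y, A.alg) where
  toSubmodule :=
    { carrier := {F | ∀ y, F y ∈ A.ideal {f y}ᶜ}
      add_mem' := fun hF hG y => add_mem (hF y) (hG y)
      zero_mem' := fun y => zero_mem (A.ideal {f y}ᶜ)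
      smul_mem' := fun c F hF y => (A.ideal {f y}ᶜ).toSubmodule.smul_mem c (hF y) }
  mul_left_mem' G F hF := fun y => (A.ideal {f y}ᶜ).mul_left_mem (G y) (hF y)
  mul_right_mem' G F hF := fun y => (A.ideal {f y}ᶜ).mul_right_mem (G y) (hF y)
  star_mem' {F} hF := fun y => (A.ideal {f y}ᶜ).star_mem' (hF y)
  isClosed' := by
    have h : IsClosed (⋂ y, {F : C(Y, A.alg) | F y ∈ A.ideal {f y}ᶜ}) :=
      isClosed_iInter fun y => (A.ideal {f y}ᶜ).isClosed'.preimage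
        (continuous_eval_const y)
    have h2 : {F : C(Y, A.alg) | ∀ y, F y ∈ A.ideal {f y}ᶜ} =
        ⋂ y, {F : C(Y, A.alg) | F y ∈ A.ideal {f y}ᶜ} := by
      ext F
      rw [Set.mem_iInter]
      rfl
    change IsClosed {F : C(Y, A.alg) | ∀ y, F y ∈ A.ideal {f y}ᶜ}
    rw [h2]
    exact h

/-- The pull-back `f*A = (C(Y) ⊗ A) / I_f` of `A` along a continuous map `f : Y → X` from a compact
space: the quotient of `C(Y, A)` by the ideal of all `F` whose image in the fibre `A_{f y}` vanishes
at every `y`. -/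
noncomputable def pullback {Y : Type} [TopologicalSpace Y] [CompactSpace Y] (f : C(Y, X)) : CStarAlgCat.{u} :=
  ⟨(A.pullbackIdeal f).Quot⟩

/-- The evaluation `q_y : f*A → A_{f y}`. -/
noncomputable def pullbackEval {Y : Type} [TopologicalSpace Y] [CompactSpace Y] (f : C(Y, X))
    (y : Y) : A.pullback f →⋆ₙₐ[ℂ] A.fibre (f y) :=
  CStarIdeal.Quot.lift
    ((CStarIdeal.Quot.mkHom (A.ideal {f y}ᶜ)).comp
      { toFun := fun F : C(Y, A.alg) => F y
        map_smul' := fun _ _ => rfl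
        map_zero' := rfl
        map_add' := fun _ _ => rfl
        map_mul' := fun _ _ => rfl
        map_star' := fun _ => rfl })
    (fun _ hF => CStarIdeal.Quot.mk_eq_zero.2 (hF y))

theorem fibre_mem {C : GoodSubcategory.{u}} (hA : C.prop A.alg) (x : X) : C.prop (A.fibre x) := C.quot_mem hA _

theorem pullback_mem {C : GoodSubcategory.{u}} (hA : C.prop A.alg) {p : ℕ} (f : C(Simplex p, X)) : C.prop (A.pullback f) :=
  C.quot_mem (A := ⟨C(Simplex p, A.alg)⟩) (C.simplex_mem hA p) _

/-- `A` is an `h_*`-fibration: for every continuous map `f : Δᵖ → X` and every point `v` of `Δᵖ`,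
evaluation `q_v : f*A → A_{f v}` induces isomorphisms on all the groups `h_n`. -/
def IsFibration {C : GoodSubcategory.{u}} (h : HomologyTheory.{u, v} C) (hA : C.prop A.alg) : Prop :=
  ∀ (p : ℕ) (f : C(Simplex p, X)) (v : Simplex p) (n : ℤ),
    IsIso ((h.h n).map (X := ⟨A.pullback f, A.pullback_mem hA f⟩)
      (Y := ⟨A.fibre (f v), A.fibre_mem hA (f v)⟩) (ObjectProperty.homMk (A.pullbackEval f v)))

/-- The restriction `A(W)` of `A` to a locally closed subset `W` of `X`: since `W` is the difference
of the open sets `U = X ∖ (closure W ∖ W)` and `V = X ∖ closure W`, it is `A(U) / A(V)`. For closed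
`W` this is `A / A(X ∖ W)`. -/
noncomputable def restr (W : Set X) : CStarAlgCat.{u} :=
  ⟨(A.ideal (coborder W)).SubQuot (A.ideal (closure W)ᶜ)⟩

theorem restr_mem {C : GoodSubcategory.{u}} (hA : C.prop A.alg) (W : Set X) : C.prop (A.restr W) := C.subQuot_mem hA _ _

/-- The restriction `A(W)` as an object of the good subcategory. -/
noncomputable def restrObj {C : GoodSubcategory.{u}} (hA : C.prop A.alg) (W : Set X) : C.Cat := ⟨A.restr W, A.restr_mem hA W⟩

end C0Algebra

/-- `Z` is a relatively closed subset of `Y`. -/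
structure RelClosed {X : Type w} [TopologicalSpace X] (Z Y : Set X) : Prop where
  subset : Z ⊆ Y
  closed : closure Z ∩ Y ⊆ Z

theorem RelClosed.coborder_subset {X : Type w} [TopologicalSpace X] {Z Y : Set X}
    (h : RelClosed Z Y) : coborder Y ⊆ coborder Z := by
  refine Set.compl_subset_compl.2 fun x hx => ⟨closure_mono h.subset hx.1, fun hY => ?_⟩
  exact hx.2 (h.closed ⟨hx.1, hY⟩)

theorem RelClosed.compl_closure_subset {X : Type w} [TopologicalSpace X] {Z Y : Set X}
    (h : RelClosed Z Y) : (closure Y)ᶜ ⊆ (closure Z)ᶜ :=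
  Set.compl_subset_compl.2 (closure_mono h.subset)

/-- A locally closed set `Y` is the disjoint union of a relatively closed set `Z` and the
relatively open set `O`. -/
structure IsDecomp {X : Type w} [TopologicalSpace X] (O Y Z : Set X) : Prop where
  locClosed : IsLocallyClosed Y
  relClosed : RelClosed Z Y
  diff_eq : O = Y \ Z

namespace IsDecomp

variable {X : Type w} [TopologicalSpace X] {O Y Z : Set X}

theorem subset (d : IsDecomp O Y Z) : O ⊆ Y := by rw [d.diff_eq]; exact Set.sdiff_subset

theorem isOpen_coborder (d : IsDecomp O Y Z) : IsOpen (coborder Y) := isLocallyClosed_iff_isOpen_coborder.1 d.locClosed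

theorem coborder_diff (d : IsDecomp O Y Z) : coborder Y \ Z = coborder Y ∩ (closure Z)ᶜ := by
  ext x
  refine ⟨fun h => ⟨h.1, fun hc => ?_⟩, fun h => ⟨h.1, fun hc => h.2 (subset_closure hc)⟩⟩
  have hY : x ∈ Y := by
    rw [← coborder_inter_closure (s := Y)]
    exact ⟨h.1, closure_mono d.relClosed.subset hc⟩
  exact h.2 (d.relClosed.closed ⟨hc, hY⟩)

theorem isOpen_diff (d : IsDecomp O Y Z) : IsOpen (coborder Y \ Z) := by
  rw [d.coborder_diff]
  exact d.isOpen_coborder.inter isClosed_closure.isOpen_compl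

theorem mem_of_mem (d : IsDecomp O Y Z) {x : X} (h1 : x ∈ coborder Y \ Z) (h2 : x ∈ closure Y) : x ∈ O := by
  rw [d.diff_eq]
  refine ⟨?_, h1.2⟩
  rw [← coborder_inter_closure (s := Y)]
  exact ⟨h1.1, h2⟩

theorem diff_subset (d : IsDecomp O Y Z) : coborder Y \ Z ⊆ coborder O := by
  intro x hx hx'
  exact hx'.2 (d.mem_of_mem hx (closure_mono d.subset hx'.1))

theorem compl_subset (d : IsDecomp O Y Z) : (closure Y)ᶜ ⊆ (closure O)ᶜ :=
  Set.compl_subset_compl.2 (closure_mono d.subset)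

theorem exc_union (d : IsDecomp O Y Z) : coborder O ⊆ (coborder Y \ Z) ∪ (closure O)ᶜ := by
  intro x hx
  by_cases hc : x ∈ closure O
  · left
    have hO : x ∈ O := by
      rw [← coborder_inter_closure (s := O)]
      exact ⟨hx, hc⟩
    rw [d.diff_eq] at hO
    exact ⟨subset_coborder hO.1, hO.2⟩
  · exact Or.inr hc

theorem exc_inter (d : IsDecomp O Y Z) : (coborder Y \ Z) ∩ (closure O)ᶜ ⊆ (closure Y)ᶜ :=
  fun _ hx hc => hx.2 (subset_closure (d.mem_of_mem hx.1 hc))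

theorem res_union (d : IsDecomp O Y Z) : coborder Z ⊆ coborder Y ∪ (closure Z)ᶜ := by
  intro x hx
  by_cases hc : x ∈ closure Z
  · left
    have hZ : x ∈ Z := by
      rw [← coborder_inter_closure (s := Z)]
      exact ⟨hx, hc⟩
    exact subset_coborder (d.relClosed.subset hZ)
  · exact Or.inr hc

end IsDecomp

namespace C0Algebra

variable {X : Type w} [TopologicalSpace X] (A : C0Algebra.{u} X)

/-- The quotient map `A(Y) → A(Z)` for a relatively closed subset `Z` of `Y`. -/
noncomputable def res {Z Y : Set X} (hZ : RelClosed Z Y) : A.restr Y →⋆ₙₐ[ℂ] A.restr Z :=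
  CStarIdeal.subQuotMap (A.ideal_mono hZ.coborder_subset) (A.ideal_mono hZ.compl_closure_subset)

/-- The kernel of `A(Y) → A(Z)`, as a subquotient of `A`. -/
abbrev KerModel (Y Z : Set X) : Type u :=
  (A.ideal (coborder Y \ Z)).SubQuot (A.ideal (closure Y)ᶜ)

/-- The inclusion into `A(Y)` of the kernel of `A(Y) → A(Z)`. -/
noncomputable def kerIncl (Y Z : Set X) : A.KerModel Y Z →⋆ₙₐ[ℂ] A.restr Y :=
  CStarIdeal.subQuotMap (A.ideal_mono Set.sdiff_subset) (A.ideal_mono subset_rfl)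

variable {O Y Z : Set X}

/-- The canonical map from the kernel of `A(Y) → A(Z)` to `A(O)`, `O = Y ∖ Z`. -/
noncomputable def excision (d : IsDecomp O Y Z) : A.KerModel Y Z →⋆ₙₐ[ℂ] A.restr O :=
  CStarIdeal.subQuotMap (A.ideal_mono d.diff_subset) (A.ideal_mono d.compl_subset)

theorem excision_bijective [T2Space X] [LocallyCompactSpace X] (d : IsDecomp O Y Z) : Function.Bijective (A.excision d) :=
  ⟨A.subQuotMap_injective d.diff_subset d.compl_subset d.exc_inter,
    A.subQuotMap_surjective d.diff_subset d.compl_subset d.isOpen_diff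
      isClosed_closure.isOpen_compl d.exc_union⟩

/-- The inclusion `A(O) → A(Y)` ("extension by zero") of the ideal that belongs to a relatively open
subset `O` of `Y`. -/
noncomputable def ext [T2Space X] [LocallyCompactSpace X] (d : IsDecomp O Y Z) : A.restr O →⋆ₙₐ[ℂ] A.restr Y :=
  (A.kerIncl Y Z).comp
    ((StarAlgEquiv.ofBijective (A.excision d) (A.excision_bijective d)).symm :
      A.restr O →⋆ₙₐ[ℂ] A.KerModel Y Z)

theorem ext_excision [T2Space X] [LocallyCompactSpace X] (d : IsDecomp O Y Z) (x : A.KerModel Y Z) :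
    A.ext d (A.excision d x) = A.kerIncl Y Z x :=
  congrArg (A.kerIncl Y Z)
    ((StarAlgEquiv.ofBijective (A.excision d) (A.excision_bijective d)).symm_apply_apply x)

/-- The short exact sequence `0 → A(O) → A(Y) → A(Z) → 0`. -/
theorem isShortExact [T2Space X] [LocallyCompactSpace X] (d : IsDecomp O Y Z) : IsShortExact (A.ext d) (A.res d.relClosed) where
  injective := by
    refine (injective_iff_map_eq_zero (A.ext d)).2 fun x hx => ?_
    obtain ⟨y, rfl⟩ := (A.excision_bijective d).2 x
    rw [A.ext_excision] at hx
    have h : Function.Injective (A.kerIncl Y Z) :=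
      A.subQuotMap_injective Set.sdiff_subset subset_rfl Set.inter_subset_right
    rw [h (hx.trans (map_zero (A.kerIncl Y Z)).symm), map_zero]
  surjective := A.subQuotMap_surjective d.relClosed.coborder_subset
    d.relClosed.compl_closure_subset d.isOpen_coborder isClosed_closure.isOpen_compl d.res_union
  exact x := by
    obtain ⟨a, rfl⟩ := CStarIdeal.Quot.mk_surjective x
    refine (A.subQuotMap_mk_eq_zero d.relClosed.coborder_subset
      d.relClosed.compl_closure_subset a).trans ⟨fun h => ?_, ?_⟩
    · have h1 : (a : A.alg) ∈ A.ideal (coborder Y \ Z) := by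
        rw [d.coborder_diff]
        exact A.mem_ideal_inter a.2 h
      exact ⟨A.excision d (CStarIdeal.Quot.mk _ ⟨a, h1⟩), A.ext_excision d _⟩
    · rintro ⟨y, hy⟩
      obtain ⟨y, rfl⟩ := (A.excision_bijective d).2 y
      obtain ⟨b, rfl⟩ := CStarIdeal.Quot.mk_surjective y
      rw [A.ext_excision] at hy
      have h1 : (b : A.alg) - a ∈ A.ideal (closure Y)ᶜ :=
        CStarIdeal.mem_within.1 ((CStarIdeal.Quot.mk_eq_mk
          (I := (A.ideal (coborder Y)).within (A.ideal (closure Y)ᶜ))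
          (a := ⟨b, A.ideal_mono Set.sdiff_subset b.2⟩) (b := a)).1 hy)
      have h2 : (b : A.alg) ∈ A.ideal (closure Z)ᶜ :=
        A.ideal_mono (by rw [d.coborder_diff]; exact Set.inter_subset_right) b.2
      have h3 : (a : A.alg) = b - (b - a) := by rw [sub_sub_cancel]
      rw [h3]
      exact sub_mem h2 (A.ideal_mono d.relClosed.compl_closure_subset h1)

/-- The short exact sequence `0 → A(O) → A(Y) → A(Z) → 0` in the good subcategory. -/
noncomputable def seq [T2Space X] [LocallyCompactSpace X] {C : GoodSubcategory.{u}}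
    (hA : C.prop A.alg) (d : IsDecomp O Y Z) : ShortExactSeq C where
  J := A.restrObj hA O
  A := A.restrObj hA Y
  B := A.restrObj hA Z
  i := ObjectProperty.homMk (A.ext d)
  q := ObjectProperty.homMk (A.res d.relClosed)
  shortExact := A.isShortExact d

/-- The group `h_n(A(W))`. -/
noncomputable abbrev hgrp {C : GoodSubcategory.{u}} (h : HomologyTheory.{u, v} C)
    (hA : C.prop A.alg) (n : ℤ) (W : Set X) : AddCommGrpCat.{v} := (h.h n).obj (A.restrObj hA W)

/-- The map `h_n(A(Y)) → h_n(A(Z))` for a relatively closed subset `Z` of `Y`. -/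
noncomputable def hres {C : GoodSubcategory.{u}} (h : HomologyTheory.{u, v} C)
    (hA : C.prop A.alg) (n : ℤ) (hZ : RelClosed Z Y) :
    A.hgrp h hA n Y ⟶ A.hgrp h hA n Z :=
  (h.h n).map (ObjectProperty.homMk (A.res hZ))

/-- The map `h_n(A(O)) → h_n(A(Y))` for a relatively open subset `O = Y ∖ Z` of `Y`. -/
noncomputable def hext [T2Space X] [LocallyCompactSpace X] {C : GoodSubcategory.{u}}
    (h : HomologyTheory.{u, v} C) (hA : C.prop A.alg) (n : ℤ) (d : IsDecomp O Y Z) :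
    A.hgrp h hA n O ⟶ A.hgrp h hA n Y :=
  (h.h n).map (ObjectProperty.homMk (A.ext d))

/-- The connecting map `h_n(A(Z)) → h_m(A(O))`, `m + 1 = n`, of the short exact sequence
`0 → A(O) → A(Y) → A(Z) → 0`. -/
noncomputable def hbdry [T2Space X] [LocallyCompactSpace X] {C : GoodSubcategory.{u}}
    (h : HomologyTheory.{u, v} C) (hA : C.prop A.alg) (n m : ℤ) (hnm : m + 1 = n)
    (d : IsDecomp O Y Z) :
    A.hgrp h hA n Z ⟶ A.hgrp h hA m O :=
  h.bdry (A.seq hA d) n m hnm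

end C0Algebra

/-- The geometric realization of an abstract simplicial complex: a point is a family of barycentric
coordinates supported on a face. -/
@[ext]
structure Realization {V : Type w} (K : AbstractSimplicialComplex V) where
  coord : V →₀ ℝ
  nonneg : ∀ v, 0 ≤ coord v
  sum_eq_one : (coord.sum fun _ r => r) = 1
  support_mem : coord.support ∈ K.faces

/-- A `p`-simplex of `K` together with an ordering of its vertices. -/
structure OrderedSimplex {V : Type w} (K : AbstractSimplicialComplex V) (p : ℕ) where
  vert : Fin (p + 1) ↪ V
  mem : Finset.univ.map vert ∈ K.faces

namespace OrderedSimplex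

variable {V : Type w} {K : AbstractSimplicialComplex V}

/-- The affine realization `σ : Δᵖ → |K|` of an ordered simplex: the point with barycentric
coordinates `t` is sent to the point with coordinate `t i` at the `i`-th vertex of `σ`, and `0` at
all other vertices. -/
noncomputable def toMap {p : ℕ} (σ : OrderedSimplex K p) (t : Simplex p) : Realization K :=
  have hs : ((Finsupp.equivFunOnFinite.symm (t : Fin (p + 1) → ℝ)).embDomain σ.vert).sum
      (fun _ r => r) = 1 := by
    rw [Finsupp.sum_embDomain, Finsupp.sum_fintype _ _ (fun _ => rfl)]
    exact t.2.2
  { coord := (Finsupp.equivFunOnFinite.symm (t : Fin (p + 1) → ℝ)).embDomain σ.vert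
    nonneg := fun v => by
      by_cases hv : v ∈ Set.range σ.vert
      · obtain ⟨i, rfl⟩ := hv
        rw [Finsupp.embDomain_apply_self]
        exact t.2.1 i
      · rw [Finsupp.embDomain_of_notMem_range _ _ _ hv]
    sum_eq_one := hs
    support_mem := by
      refine (K.isRelLowerSet_faces σ.mem).2 ?_ ?_
      · rw [Finsupp.support_embDomain]
        exact Finset.map_subset_map.2 (Finset.subset_univ _)
      · rw [Finsupp.support_nonempty_iff]
        intro h0
        rw [h0, Finsupp.sum_zero_index] at hs
        exact zero_ne_one hs }

theorem toMap_vert {p : ℕ} (σ : OrderedSimplex K p) (t : Simplex p) (i : Fin (p + 1)) :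
    (σ.toMap t).coord (σ.vert i) = t i := Finsupp.embDomain_apply_self _ _ _

theorem toMap_of_notMem {p : ℕ} (σ : OrderedSimplex K p) (t : Simplex p) {v : V}
    (hv : v ∉ Set.range σ.vert) : (σ.toMap t).coord v = 0 :=
  Finsupp.embDomain_of_notMem_range _ _ _ hv

/-- The `l`-th face of an ordered simplex: omit the `l`-th vertex and keep the order. -/
def face {p : ℕ} (σ : OrderedSimplex K (p + 1)) (l : Fin (p + 2)) : OrderedSimplex K p where
  vert := (Fin.succAboveEmb l).trans σ.vert
  mem := (K.isRelLowerSet_faces σ.mem).2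
    (by rw [← Finset.map_map]; exact Finset.map_subset_map.2 (Finset.subset_univ _))
    (Finset.univ_nonempty.map)

/-- The closed cell `Δ_σ` of `|K|`. -/
def cell {p : ℕ} (σ : OrderedSimplex K p) : Set (Realization K) :=
  {x | x.coord.support ⊆ Finset.univ.map σ.vert}

/-- The open cell of `|K|` that belongs to `σ`. -/
def openCell {p : ℕ} (σ : OrderedSimplex K p) : Set (Realization K) :=
  {x | x.coord.support = Finset.univ.map σ.vert}

theorem range_toMap {p : ℕ} (σ : OrderedSimplex K p) : Set.range σ.toMap = σ.cell := by
  ext x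
  constructor
  · rintro ⟨t, rfl⟩
    change (Finsupp.embDomain _ _).support ⊆ _
    rw [Finsupp.support_embDomain]
    exact Finset.map_subset_map.2 (Finset.subset_univ _)
  · intro hx
    have hx' : x.coord.support ⊆ Finset.univ.map σ.vert := hx
    refine ⟨⟨fun i => x.coord (σ.vert i), fun i => x.nonneg _, ?_⟩, ?_⟩
    · rw [← x.sum_eq_one, Finsupp.sum_of_support_subset _ hx' _ (fun _ _ => rfl), Finset.sum_map]
    · refine Realization.ext (Finsupp.ext fun v => ?_)
      by_cases hv : v ∈ Set.range σ.vert
      · obtain ⟨i, rfl⟩ := hv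
        exact σ.toMap_vert _ i
      · rw [σ.toMap_of_notMem _ hv]
        by_contra h
        obtain ⟨i, -, hi⟩ := Finset.mem_map.1 (hx' (Finsupp.mem_support_iff.2 (Ne.symm h)))
        exact hv ⟨i, hi⟩

/-- The point of `|K|` given by the first vertex `v₀` of `σ`. -/
noncomputable def pt {p : ℕ} (σ : OrderedSimplex K p) : Realization K :=
  { coord := Finsupp.single (σ.vert 0) 1
    nonneg := fun v => by
      classical
      rw [Finsupp.single_apply]
      split_ifs <;> norm_num
    sum_eq_one := by simp
    support_mem := by
      rw [Finsupp.support_single _ one_ne_zero]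
      exact K.singleton_mem _ }

end OrderedSimplex

namespace Realization

variable {V : Type w} {K : AbstractSimplicialComplex V}

/-- The weak (CW) topology on the realization: a set is open if and only if its preimage in every
simplex is open. -/
noncomputable instance : TopologicalSpace (Realization K) :=
  ⨆ (p : ℕ) (σ : OrderedSimplex K p), TopologicalSpace.coinduced σ.toMap inferInstance

theorem continuous_coord (v : V) : Continuous fun x : Realization K => x.coord v := by
  refine continuous_iSup_dom.2 fun p => continuous_iSup_dom.2 fun σ =>
    continuous_coinduced_dom.2 ?_
  by_cases hv : v ∈ Set.range σ.vert
  · obtain ⟨i, rfl⟩ := hv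
    have : (fun x : Realization K => x.coord (σ.vert i)) ∘ σ.toMap = fun t => t i :=
      funext fun t => σ.toMap_vert t i
    rw [this]
    exact (continuous_apply i).comp continuous_subtype_val
  · have : (fun x : Realization K => x.coord v) ∘ σ.toMap = fun _ => 0 :=
      funext fun t => σ.toMap_of_notMem t hv
    rw [this]
    exact continuous_const

instance : T2Space (Realization K) :=
  T2Space.of_injective_continuous (f := fun (x : Realization K) (v : V) => x.coord v)
    (fun _ _ h => Realization.ext (Finsupp.ext fun v => congrFun h v))
    (continuous_pi continuous_coord)

/-- The `n`-skeleton `X_n` of `|K|` (empty for `n < 0`): the points in the interior of simplices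
with at most `n + 1` vertices. -/
def skel (K : AbstractSimplicialComplex V) (n : ℤ) : Set (Realization K) :=
  {x | (x.coord.support.card : ℤ) ≤ n + 1}

theorem isClosed_skel (n : ℤ) : IsClosed (skel K n) := by
  have h : skel K n = ⋂ (s : Finset V) (_ : n + 1 < (s.card : ℤ)),
      ⋃ v ∈ s, {x : Realization K | x.coord v = 0} := by
    ext x
    simp only [Set.mem_iInter, Set.mem_iUnion]
    constructor
    · intro hx s hs
      by_contra hcon
      push Not at hcon
      have hsub : s ⊆ x.coord.support := fun v hv => Finsupp.mem_support_iff.2 (hcon v hv)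
      have h1 := Finset.card_le_card hsub
      have h2 : (x.coord.support.card : ℤ) ≤ n + 1 := hx
      omega
    · intro hx
      by_contra hcon
      obtain ⟨v, hv, hv0⟩ := hx x.coord.support (not_le.1 hcon)
      exact Finsupp.mem_support_iff.1 hv hv0
  rw [h]
  refine isClosed_iInter fun s => isClosed_iInter fun _ => ?_
  exact s.finite_toSet.isClosed_biUnion fun v _ =>
    isClosed_eq (continuous_coord v) continuous_const

theorem skel_mono {m n : ℤ} (h : m ≤ n) : skel K m ⊆ skel K n := fun x hx => by
  have h1 : (x.coord.support.card : ℤ) ≤ m + 1 := hx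
  change (x.coord.support.card : ℤ) ≤ n + 1
  omega

/-- `0 → A(X_n ∖ X_m) → A(X_n) → A(X_m) → 0`. -/
theorem skel_decomp {m n : ℤ} (h : m ≤ n) :
    IsDecomp (skel K n \ skel K m) (skel K n) (skel K m) where
  locClosed := (isClosed_skel n).isLocallyClosed
  relClosed := ⟨skel_mono h, by
    rw [(isClosed_skel m).closure_eq]; exact Set.inter_subset_left⟩
  diff_eq := rfl

end Realization

namespace OrderedSimplex

open Realization

variable {V : Type w} {K : AbstractSimplicialComplex V}

theorem isClosed_cell {p : ℕ} (σ : OrderedSimplex K p) : IsClosed σ.cell := by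
  have h : σ.cell = ⋂ (v : V) (_ : v ∉ Finset.univ.map σ.vert),
      {x : Realization K | x.coord v = 0} := by
    ext x
    simp only [Set.mem_iInter]
    constructor
    · intro hx v hv
      by_contra h0
      exact hv (hx (Finsupp.mem_support_iff.2 h0))
    · intro hx v hv
      by_contra h0
      exact Finsupp.mem_support_iff.1 hv (hx v h0)
  rw [h]
  exact isClosed_iInter fun v => isClosed_iInter fun _ =>
    isClosed_eq (continuous_coord v) continuous_const

theorem openCell_subset_cell {p : ℕ} (σ : OrderedSimplex K p) : σ.openCell ⊆ σ.cell :=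
  fun _ hx => (show _ = _ from hx).subset

theorem closure_openCell_subset {p : ℕ} (σ : OrderedSimplex K p) : closure σ.openCell ⊆ σ.cell :=
  closure_minimal σ.openCell_subset_cell σ.isClosed_cell

theorem card_vertices {p : ℕ} (σ : OrderedSimplex K p) :
    (Finset.univ.map σ.vert).card = p + 1 := by simp

theorem mem_openCell_iff {p : ℕ} (σ : OrderedSimplex K p) {x : Realization K} (hx : x ∈ σ.cell) :
    x ∈ σ.openCell ↔ ∀ i, x.coord (σ.vert i) ≠ 0 := by
  constructor
  · intro h i
    rw [← Finsupp.mem_support_iff, show x.coord.support = _ from h]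
    exact Finset.mem_map_of_mem _ (Finset.mem_univ i)
  · intro h
    refine Finset.Subset.antisymm hx fun v hv => ?_
    obtain ⟨i, -, rfl⟩ := Finset.mem_map.1 hv
    exact Finsupp.mem_support_iff.2 (h i)

theorem face_vert {p : ℕ} (σ : OrderedSimplex K (p + 1)) (l : Fin (p + 2)) (i : Fin (p + 1)) :
    (σ.face l).vert i = σ.vert (l.succAbove i) := rfl

theorem face_cell_subset {p : ℕ} (σ : OrderedSimplex K (p + 1)) (l : Fin (p + 2)) :
    (σ.face l).cell ⊆ σ.cell := by
  intro x hx v hv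
  obtain ⟨i, -, rfl⟩ := Finset.mem_map.1 (hx hv)
  exact Finset.mem_map_of_mem σ.vert (Finset.mem_univ _)

theorem notMem_face {p : ℕ} (σ : OrderedSimplex K (p + 1)) (l : Fin (p + 2)) :
    σ.vert l ∉ Finset.univ.map (σ.face l).vert := by
  intro h
  obtain ⟨i, -, hi⟩ := Finset.mem_map.1 h
  exact Fin.succAbove_ne l i (σ.vert.injective hi)

theorem disjoint_face_cell {p : ℕ} (σ : OrderedSimplex K (p + 1)) (l : Fin (p + 2))
    {x : Realization K} (hx : x ∈ σ.openCell) : x ∉ (σ.face l).cell := by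
  intro hc
  refine σ.notMem_face l (hc ?_)
  rw [show x.coord.support = _ from hx]
  exact Finset.mem_map_of_mem _ (Finset.mem_univ l)

/-- The union of the open cell of `σ` and the open cell of its `l`-th face. -/
def halfOpen {p : ℕ} (σ : OrderedSimplex K (p + 1)) (l : Fin (p + 2)) : Set (Realization K) :=
  σ.openCell ∪ (σ.face l).openCell

theorem halfOpen_decomp {p : ℕ} (σ : OrderedSimplex K (p + 1)) (l : Fin (p + 2)) :
    IsDecomp σ.openCell (σ.halfOpen l) (σ.face l).openCell where
  locClosed := by
    have h : σ.halfOpen l =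
        (⋂ i : Fin (p + 1), {x : Realization K | x.coord (σ.vert (l.succAbove i)) ≠ 0}) ∩ σ.cell := by
      ext x
      constructor
      · rintro (hx | hx)
        · exact ⟨Set.mem_iInter.2 fun i =>
            (σ.mem_openCell_iff (σ.openCell_subset_cell hx)).1 hx _, σ.openCell_subset_cell hx⟩
        · have hc := (σ.face l).openCell_subset_cell hx
          exact ⟨Set.mem_iInter.2 fun i => ((σ.face l).mem_openCell_iff hc).1 hx i,
            σ.face_cell_subset l hc⟩
      · rintro ⟨h1, h2⟩
        have h1' := Set.mem_iInter.1 h1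
        by_cases hl : x.coord (σ.vert l) = 0
        · right
          have hc : x ∈ (σ.face l).cell := by
            intro v hv
            obtain ⟨j, -, rfl⟩ := Finset.mem_map.1 (h2 hv)
            have hj : j ≠ l := by
              rintro rfl
              exact Finsupp.mem_support_iff.1 hv hl
            obtain ⟨i, rfl⟩ := Fin.exists_succAbove_eq hj
            exact Finset.mem_map_of_mem (σ.face l).vert (Finset.mem_univ i)
          exact ((σ.face l).mem_openCell_iff hc).2 h1'
        · left
          refine (σ.mem_openCell_iff h2).2 fun j => ?_
          by_cases hj : j = l
          · rw [hj]; exact hl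
          · obtain ⟨i, rfl⟩ := Fin.exists_succAbove_eq hj
            exact h1' i
    rw [h]
    refine IsLocallyClosed.inter (IsOpen.isLocallyClosed ?_) σ.isClosed_cell.isLocallyClosed
    exact isOpen_iInter_of_finite fun i =>
      isOpen_ne_fun (continuous_coord _) continuous_const
  relClosed := by
    refine ⟨Set.subset_union_right, ?_⟩
    rintro x ⟨hx, h | h⟩
    · exact absurd ((σ.face l).closure_openCell_subset hx) (σ.disjoint_face_cell l h)
    · exact h
  diff_eq := by
    ext x
    refine ⟨fun h => ⟨Or.inl h, fun h' => ?_⟩, fun h => h.1.resolve_right h.2⟩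
    exact σ.disjoint_face_cell l h ((σ.face l).openCell_subset_cell h')

/-- An open `p`-cell is relatively closed in `X_p ∖ X_{p-1}`. -/
theorem openCell_relClosed {p : ℕ} (σ : OrderedSimplex K p) {m n : ℤ} (hn : n = p)
    (hm : m + 1 = p) : RelClosed σ.openCell (skel K n \ skel K m) := by
  constructor
  · intro x hx
    have h1 : x.coord.support.card = p + 1 := by
      rw [show x.coord.support = _ from hx, card_vertices]
    constructor
    · change (x.coord.support.card : ℤ) ≤ n + 1
      omega
    · change ¬ (x.coord.support.card : ℤ) ≤ m + 1
      omega
  · rintro x ⟨hx, -, h2⟩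
    refine Finset.eq_of_subset_of_card_le (σ.closure_openCell_subset hx) ?_
    have h3 : ¬ (x.coord.support.card : ℤ) ≤ m + 1 := h2
    rw [card_vertices]
    omega

/-- An open `p`-cell is relatively open in `X_p ∖ X_{p-1}`. -/
theorem openCell_decomp {p : ℕ} (σ : OrderedSimplex K p) {m n : ℤ} (hn : n = p) (hm : m + 1 = p) :
    IsDecomp σ.openCell (skel K n \ skel K m) ((skel K n \ skel K m) \ σ.openCell) where
  locClosed := by
    rw [Set.sdiff_eq]
    exact (isClosed_skel n).isLocallyClosed.inter (isClosed_skel m).isOpen_compl.isLocallyClosed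
  relClosed := by
    refine ⟨Set.sdiff_subset, ?_⟩
    rintro x ⟨hx, hY⟩
    refine ⟨hY, fun hxo => ?_⟩
    have hcl : IsClosed (⋃ i : Fin (p + 1), {y : Realization K | y.coord (σ.vert i) = 0}) :=
      isClosed_iUnion_of_finite fun i => isClosed_eq (continuous_coord _) continuous_const
    have hsub : (skel K n \ skel K m) \ σ.openCell ⊆
        ⋃ i : Fin (p + 1), {y : Realization K | y.coord (σ.vert i) = 0} := by
      rintro y ⟨⟨hy, -⟩, hyo⟩
      by_contra hcon
      refine hyo (Finset.eq_of_subset_of_card_le (s := Finset.univ.map σ.vert) ?_ ?_).symm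
      · intro v hv
        obtain ⟨i, -, rfl⟩ := Finset.mem_map.1 hv
        exact Finsupp.mem_support_iff.2 fun h0 => hcon (Set.mem_iUnion.2 ⟨i, h0⟩)
      · have h3 : (y.coord.support.card : ℤ) ≤ n + 1 := hy
        rw [card_vertices]
        omega
    obtain ⟨i, hi⟩ := Set.mem_iUnion.1 (closure_minimal hsub hcl hx)
    exact (σ.mem_openCell_iff (σ.openCell_subset_cell hxo)).1 hxo i hi
  diff_eq := by
    rw [Set.sdiff_sdiff_right_self]
    exact (Set.inter_eq_right.2 (σ.openCell_relClosed hn hm).subset).symm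

theorem pt_mem_cell {p : ℕ} (σ : OrderedSimplex K p) : σ.pt ∈ σ.cell := by
  change (Finsupp.single (σ.vert 0) (1 : ℝ)).support ⊆ _
  rw [Finsupp.support_single _ one_ne_zero, Finset.singleton_subset_iff]
  exact Finset.mem_map_of_mem _ (Finset.mem_univ 0)

theorem pt_relClosed {p : ℕ} (σ : OrderedSimplex K p) : RelClosed {σ.pt} σ.cell :=
  ⟨Set.singleton_subset_iff.2 σ.pt_mem_cell, by
    rw [isClosed_singleton.closure_eq]; exact Set.inter_subset_left⟩

/-- The open cell of a `0`-simplex is the vertex. -/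
theorem openCell_zero (σ : OrderedSimplex K 0) : σ.openCell = {σ.pt} := by
  ext x
  have hm : Finset.univ.map σ.vert = {σ.vert 0} := rfl
  constructor
  · intro hx
    have hs : x.coord.support = {σ.vert 0} := hx
    have h1 := x.sum_eq_one
    rw [Finsupp.sum, hs, Finset.sum_singleton] at h1
    refine Realization.ext ?_
    change x.coord = Finsupp.single (σ.vert 0) 1
    rw [← h1]
    exact (Finsupp.support_eq_singleton.1 hs).2
  · rintro rfl
    exact Finsupp.support_single _ one_ne_zero

theorem pt_face_last {p : ℕ} (σ : OrderedSimplex K (p + 1)) :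
    (σ.face (Fin.last (p + 1))).pt = σ.pt := by
  refine Realization.ext ?_
  change Finsupp.single (σ.vert ((Fin.last (p + 1)).succAbove 0)) (1 : ℝ) =
    Finsupp.single (σ.vert 0) 1
  rw [Fin.succAbove_last, Fin.castSucc_zero]

/-- `Δ_τ` is closed in `Δ_σ` if it is a face. -/
theorem cell_relClosed {p : ℕ} (σ : OrderedSimplex K (p + 1)) (τ : OrderedSimplex K p)
    (l : Fin (p + 2)) (hl : τ.cell = (σ.face l).cell) : RelClosed τ.cell σ.cell :=
  ⟨by rw [hl]; exact σ.face_cell_subset l, by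
    rw [τ.isClosed_cell.closure_eq]; exact Set.inter_subset_left⟩

end OrderedSimplex

namespace C0Algebra

open Realization

variable {V : Type w} {K : AbstractSimplicialComplex V} [LocallyCompactSpace (Realization K)]
  (A : C0Algebra.{u} (Realization K))
  {C : GoodSubcategory.{u}} (h : HomologyTheory.{u, v} C) (hA : C.prop A.alg)

/-- For `σ = ⟨v₀, …, v_p⟩`, the chain of connecting maps
`h_n(A_{v₀}) → h_{n-1}(A(Δ°¹)) → ⋯ → h_{n-p}(A(Δ°ᵖ))`, where `Δᵏ` is the face `⟨v₀, …, v_k⟩` of `σ`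
and the `k`-th map is the connecting map of
`0 → A(Δ°ᵏ) → A(Δ°ᵏ ∪ Δ°ᵏ⁻¹) → A(Δ°ᵏ⁻¹) → 0`. The point `v₀` is called `x`, and the target degree
`n - p` is called `m`. For `p = 0` the map is the identity (`Δ°⁰ = {v₀}`). -/
noncomputable def chain (x : Realization K) : (p : ℕ) → (σ : OrderedSimplex K p) → (hx : σ.pt = x) →
    (n m : ℤ) → (hm : m + p = n) → (A.hgrp h hA n {x} ⟶ A.hgrp h hA m σ.openCell)
  | 0, σ, hx, n, m, hm =>
      eqToHom (by rw [σ.openCell_zero, hx, show n = m by simpa using hm.symm])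
  | p + 1, σ, hx, n, m, hm =>
      chain x p (σ.face (Fin.last (p + 1))) (σ.pt_face_last.trans hx) n (m + 1)
          (by push_cast at hm; linarith) ≫
        A.hbdry h hA (m + 1) m rfl (σ.halfOpen_decomp (Fin.last (p + 1)))

/-- The canonical oriented isomorphism `Φ : h_n(A(Δ_σ)) → h_{n-p}(A(Δ°_σ))`: evaluation at the
vertex `v₀` followed by the chain of connecting maps. The target degree `n - p` is called `m`. -/
noncomputable def canon {p : ℕ} (σ : OrderedSimplex K p) (n m : ℤ) (hm : m + p = n) :
    A.hgrp h hA n σ.cell ⟶ A.hgrp h hA m σ.openCell :=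
  A.hres h hA n σ.pt_relClosed ≫ A.chain h hA σ.pt p σ rfl n m hm

/-- The differential `d₁ : h_{q+1}(A(X_{p-1} ∖ X_{p-2})) → h_q(A(X_p ∖ X_{p-1}))` on the `E₁`-term
of the spectral sequence of the skeletal filtration, `d₁ = ∂ ∘ ι_*`; here `(a, b, c)` is
`(p - 2, p - 1, p)`. -/
noncomputable def d₁ (a b c : ℤ) (hab : a + 1 = b) (hbc : b + 1 = c) (q : ℤ) :
    A.hgrp h hA (q + 1) (skel K b \ skel K a) ⟶ A.hgrp h hA q (skel K c \ skel K b) :=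
  A.hext h hA (q + 1) (skel_decomp (by omega : a ≤ b)) ≫
    A.hbdry h hA (q + 1) q rfl (skel_decomp (by omega : b ≤ c))

/-- The component `d_τ^σ` of `d₁` in terms of the canonical oriented isomorphisms, for a `p`-simplex
`τ` and a `(p+1)`-simplex `σ`: the composition
`h_{q+p+1}(A(Δ_τ)) → h_{q+1}(A(Δ°_τ)) → h_{q+1}(A(X_p ∖ X_{p-1})) → h_q(A(X_{p+1} ∖ X_p)) →
h_q(A(Δ°_σ)) → h_{q+p+1}(A(Δ_σ))`
of the canonical oriented isomorphism of `τ`, the inclusion of an open cell, `d₁`, the quotient map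
to an open cell, and the inverse of the canonical oriented isomorphism of `σ`. -/
noncomputable def diff {p : ℕ} (σ : OrderedSimplex K (p + 1)) (τ : OrderedSimplex K p) (q : ℤ)
    [IsIso (A.canon h hA σ (q + (p + 1)) q (by push_cast; ring))] :
    A.hgrp h hA (q + (p + 1)) τ.cell ⟶ A.hgrp h hA (q + (p + 1)) σ.cell :=
  A.canon h hA τ (q + (p + 1)) (q + 1) (by ring) ≫
    A.hext h hA (q + 1) (τ.openCell_decomp (m := (p : ℤ) - 1) (n := p) rfl (by ring)) ≫
    A.d₁ h hA ((p : ℤ) - 1) p (p + 1) (by ring) rfl q ≫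
    A.hres h hA q (σ.openCell_relClosed (m := (p : ℤ)) (n := p + 1) (by push_cast; rfl)
      (by push_cast; ring)) ≫
    inv (A.canon h hA σ (q + (p + 1)) q _)

end C0Algebra

end CStarFib

namespace CStarFib

open ZeroAtInfty MultiplierAlgebra Topology

/-! Over locally closed sets, `A` behaves like an algebra of sections. An element of `A(W)` is
determined by its values in the fibres over `W` (`eq_zero_of_value`), because the norm over a union
of two sets is at most the maximum of the two norms, so vanishing at points spreads by compactness.
Call a *-homomorphism between section algebras a section map if it keeps the values at common points
and extends by zero. There is at most one section map between two given sets, so every square of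
restrictions and extensions by zero commutes as soon as the sets fit together, and the connecting
maps are natural for such squares (`hbdry_natural`).

Over an embedded simplex, `A` restricts to the pull-back, so the fibration property makes
restriction to a vertex, and hence to any closed face, an isomorphism on homology
(`isIso_hres_closedFace`). Removing closed faces one vertex at a time shows that the union of the
open faces between a nonempty `S` and a strictly larger face `T` has no homology
(`acyclic_stratum`). A half-open simplex is such a union; therefore every connecting map in `Φ` is
an isomorphism (`isIso_canon`).

All signs come from one fact (`hres_hbdry_add_eq_zero`). Let `Z₁` and `Z₂` be disjoint and
relatively closed in `Y`, with complement `O`. Restricting a class on `Y` to `Z₁` or to `Z₂` and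
applying the connecting map to `O` gives two classes with sum zero: their sum is a restriction
followed by the connecting map of the same exact sequence. For the two facets over a common face of
codimension two, or for the two ends of an edge, this says that exchanging the last two vertices
negates `Φ`. Other adjacent transpositions are inherited from the last face, so by induction a
permutation acts on `Φ` by its sign (`canonOn_perm`). Moving the `l`-th vertex to the end then
expresses `Φ_σ` as a sign times restriction to the `l`-th face, `Φ` of that face, and one connecting
map (`canonOn_eq_face`).

It remains to identify the component of `d₁` from `τ` to `σ`. Restricting the skeletal sequence to
the closed cell of `σ`, it factors through a section map from the open cell of `τ` to the boundary
of `σ`. If `τ` is not a face, these sets are disjoint and the component vanishes. If `τ` is a face,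
the component is the connecting map of the half-open cell, which is the last factor in the formula
for `Φ_σ`. Cancelling leaves the inverse restriction and the two signs. -/

theorem CStarIdeal.subQuotMap_mk {A : Type u} [NonUnitalCStarAlgebra A] {I J I' J' : CStarIdeal A}
    (hI : (I : Set A) ⊆ I') (hJ : (J : Set A) ⊆ J') (a : I) :
    subQuotMap hI hJ (Quot.mk (within I J) a) = Quot.mk (within I' J') ⟨a, hI a.2⟩ := rfl

/-! ### Norms over subsets, values in the fibres, and section maps. -/

namespace C0Algebra

variable {X : Type w} [TopologicalSpace X] (A : C0Algebra.{u} X)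

/-- Since `A(U) ∩ A(V) = A(U ∩ V)`, the quotient embeds in the product of the two quotients. An
injective *-homomorphism is isometric, and the product carries the maximum norm. A bound by the
maximum, not the sum, is what allows finite covers later. -/
theorem norm_mk_ideal_inter_le (U V : Set X) (a : A.alg) :
    ‖CStarIdeal.Quot.mk (A.ideal (U ∩ V)) a‖ ≤
      max ‖CStarIdeal.Quot.mk (A.ideal U) a‖ ‖CStarIdeal.Quot.mk (A.ideal V) a‖ := by
  let ψ : (A.ideal (U ∩ V)).Quot →⋆ₙₐ[ℂ] (A.ideal U).Quot × (A.ideal V).Quot :=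
    CStarIdeal.Quot.lift ((CStarIdeal.Quot.mkHom (A.ideal U)).prod
      (CStarIdeal.Quot.mkHom (A.ideal V))) fun a ha =>
      Prod.ext (CStarIdeal.Quot.mk_eq_zero.2 (A.ideal_mono Set.inter_subset_left ha))
        (CStarIdeal.Quot.mk_eq_zero.2 (A.ideal_mono Set.inter_subset_right ha))
  have hψ : Function.Injective ψ := by
    refine (injective_iff_map_eq_zero ψ).2 fun x hx => ?_
    obtain ⟨a, rfl⟩ := CStarIdeal.Quot.mk_surjective x
    have h1 : CStarIdeal.Quot.mk (A.ideal U) a = 0 := congrArg Prod.fst hx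
    have h2 : CStarIdeal.Quot.mk (A.ideal V) a = 0 := congrArg Prod.snd hx
    exact CStarIdeal.Quot.mk_eq_zero.2 (A.mem_ideal_inter
      (CStarIdeal.Quot.mk_eq_zero.1 h1) (CStarIdeal.Quot.mk_eq_zero.1 h2))
  have h := (NonUnitalStarAlgHom.isometry ψ hψ).norm_map_of_map_zero (map_zero ψ)
    (CStarIdeal.Quot.mk _ a)
  rw [← h]
  rfl

theorem norm_mk_ideal_anti {U V : Set X} (h : U ⊆ V) (a : A.alg) :
    ‖CStarIdeal.Quot.mk (A.ideal V) a‖ ≤ ‖CStarIdeal.Quot.mk (A.ideal U) a‖ := by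
  refine le_of_forall_pos_lt_add fun ε hε => ?_
  obtain ⟨b, hb, hlt⟩ := CStarIdeal.Quot.exists_norm_lt (CStarIdeal.Quot.mk (A.ideal U) a) hε
  have : CStarIdeal.Quot.mk (A.ideal V) a = CStarIdeal.Quot.mk (A.ideal V) b :=
    (CStarIdeal.Quot.mk_eq_mk.2 (A.ideal_mono h (CStarIdeal.Quot.mk_eq_mk.1 hb))).symm
  rw [this]
  exact (CStarIdeal.Quot.norm_mk_le b).trans_lt hlt

/-- If `|f| ≤ ε` on `W`, then `Φ(f) · a` has norm at most `ε ‖a‖` over `W`. -/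
theorem norm_mk_act_le {W : Set X} {f : C₀(X, ℂ)} {ε : ℝ} (hε : 0 < ε) (hf : ∀ x ∈ W, ‖f x‖ ≤ ε)
    (a : A.alg) : ‖CStarIdeal.Quot.mk (A.ideal Wᶜ) (A.act f a)‖ ≤ ε * ‖a‖ := by
  have hpos : ∀ x, 0 < max ε ‖f x‖ := fun x => lt_max_of_lt_left hε
  -- This factor is 1 where `‖f‖ ≤ ε` and scales `f` down to norm `ε` elsewhere. The truncated
  -- function agrees with `f` on `W`, so the two products have the same class.
  let χ : C(X, ℝ) := ⟨fun x => ε / max ε ‖f x‖,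
    continuous_const.div (continuous_const.max (map_continuous f).norm) fun x => (hpos x).ne'⟩
  have hχ : ∀ x, χ x ∈ Set.Icc (0 : ℝ) 1 := fun x =>
    ⟨div_nonneg hε.le (hpos x).le, (div_le_one (hpos x)).2 (le_max_left _ _)⟩
  let g := cutoff χ hχ f
  have hg : ‖g‖ ≤ ε := by
    rw [← ZeroAtInftyContinuousMap.norm_toBCF_eq_norm, BoundedContinuousFunction.norm_le hε.le]
    intro x
    change ‖((ε / max ε ‖f x‖ : ℝ) : ℂ) * f x‖ ≤ ε
    rw [norm_mul, Complex.norm_real, Real.norm_of_nonneg (show 0 ≤ ε / max ε ‖f x‖ from (hχ x).1),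
      div_mul_eq_mul_div,
      div_le_iff₀ (hpos x)]
    gcongr
    exact le_max_right _ _
  have hfg : CStarIdeal.Quot.mk (A.ideal Wᶜ) (A.act f a) =
      CStarIdeal.Quot.mk (A.ideal Wᶜ) (A.act g a) := by
    refine CStarIdeal.Quot.mk_eq_mk.2 ?_
    have : A.act f a - A.act g a = A.act (f - g) a := by simp [act]
    rw [this]
    refine A.act_mem_ideal _ _ fun x hx => ?_
    have hx' : ‖f x‖ ≤ ε := hf x (not_not.1 hx)
    change f x - ((ε / max ε ‖f x‖ : ℝ) : ℂ) * f x = 0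
    rw [max_eq_left hx', div_self hε.ne']
    simp
  rw [hfg]
  refine (CStarIdeal.Quot.norm_mk_le _).trans ((A.norm_act_le _ _).trans ?_)
  gcongr

/-- The elements whose norm tends to zero along a filter on the base. -/
noncomputable def vanishing (l : Filter X) : Submodule ℂ A.alg where
  carrier := {a | ∀ ε : ℝ, 0 < ε → ∃ W ∈ l, ‖CStarIdeal.Quot.mk (A.ideal Wᶜ) a‖ < ε}
  add_mem' := by
    intro a b ha hb ε hε
    obtain ⟨W, hW, h1⟩ := ha _ (half_pos hε)
    obtain ⟨W', hW', h2⟩ := hb _ (half_pos hε)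
    refine ⟨W ∩ W', Filter.inter_mem hW hW', ?_⟩
    have h3 := A.norm_mk_ideal_anti
      (Set.compl_subset_compl.2 (Set.inter_subset_left (s := W) (t := W'))) a
    have h4 := A.norm_mk_ideal_anti
      (Set.compl_subset_compl.2 (Set.inter_subset_right (s := W) (t := W'))) b
    rw [CStarIdeal.Quot.mk_add]
    have := norm_add_le (CStarIdeal.Quot.mk (A.ideal (W ∩ W')ᶜ) a)
      (CStarIdeal.Quot.mk (A.ideal (W ∩ W')ᶜ) b)
    linarith
  zero_mem' := fun ε hε => ⟨Set.univ, Filter.univ_mem, by rwa [CStarIdeal.Quot.mk_zero, norm_zero]⟩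
  smul_mem' := by
    intro c a ha ε hε
    obtain ⟨W, hW, h1⟩ := ha (ε / (‖c‖ + 1)) (by positivity)
    refine ⟨W, hW, ?_⟩
    rw [CStarIdeal.Quot.mk_smul, norm_smul]
    calc ‖c‖ * ‖CStarIdeal.Quot.mk (A.ideal Wᶜ) a‖ ≤ ‖c‖ * (ε / (‖c‖ + 1)) := by gcongr
      _ < ε := by
        rw [mul_div_assoc', div_lt_iff₀ (by positivity)]
        nlinarith [norm_nonneg c]

theorem isClosed_vanishing (l : Filter X) : IsClosed (A.vanishing l : Set A.alg) := by
  refine isClosed_of_closure_subset fun a ha ε hε => ?_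
  obtain ⟨b, hb, hab⟩ := Metric.mem_closure_iff.1 ha _ (half_pos hε)
  obtain ⟨W, hW, h1⟩ := hb _ (half_pos hε)
  refine ⟨W, hW, ?_⟩
  have h2 : CStarIdeal.Quot.mk (A.ideal Wᶜ) a =
      CStarIdeal.Quot.mk (A.ideal Wᶜ) (a - b) + CStarIdeal.Quot.mk (A.ideal Wᶜ) b := by
    rw [← CStarIdeal.Quot.mk_add, sub_add_cancel]
  have h3 := CStarIdeal.Quot.norm_mk_le (I := A.ideal Wᶜ) (a - b)
  rw [dist_eq_norm] at hab
  rw [h2]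
  exact (norm_add_le _ _).trans_lt (by linarith)

theorem act_mem_vanishing {l : Filter X} {f : C₀(X, ℂ)} (hf : Filter.Tendsto f l (𝓝 0))
    (a : A.alg) : A.act f a ∈ A.vanishing l := by
  intro ε hε
  have hε' : 0 < ε / (‖a‖ + 1) := by positivity
  refine ⟨{x | ‖f x‖ ≤ ε / (‖a‖ + 1)}, ?_, ?_⟩
  · have h := hf.norm
    rw [norm_zero] at h
    exact (h.eventually (gt_mem_nhds hε')).mono fun x hx => le_of_lt hx
  · refine (A.norm_mk_act_le hε' (fun x hx => hx) a).trans_lt ?_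
    rw [div_mul_eq_mul_div, div_lt_iff₀ (by positivity)]
    nlinarith [norm_nonneg a]

/-- Nondegeneracy makes every element a limit of sums of products `Φ(f) · b`, and each `f` vanishes
at infinity. -/
theorem mem_vanishing_cocompact (a : A.alg) : a ∈ A.vanishing (Filter.cocompact X) := by
  have h : a ∈ (Submodule.span ℂ {b : A.alg | ∃ f a, b = (A.Φ f).fst a}).topologicalClosure := by
    rw [A.nondegenerate]; trivial
  refine Submodule.topologicalClosure_minimal _ (Submodule.span_le.2 ?_)
    (A.isClosed_vanishing _) h
  rintro _ ⟨f, a, rfl⟩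
  exact A.act_mem_vanishing (zero_at_infty f) a

theorem mem_vanishing_nhds {x : X} {a : A.alg} (ha : a ∈ A.ideal {x}ᶜ) :
    a ∈ A.vanishing (𝓝 x) := by
  refine A.closure_induction (A.vanishing (𝓝 x)) (A.isClosed_vanishing _) (fun f a hf => ?_) ha
  refine A.act_mem_vanishing ?_ a
  have := (map_continuous f).tendsto x
  rwa [hf x fun h => h rfl] at this

theorem mem_ideal_univ (a : A.alg) : a ∈ A.ideal Set.univ := by
  have h : a ∈ (Submodule.span ℂ {b : A.alg | ∃ f a, b = (A.Φ f).fst a}).topologicalClosure := by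
    rw [A.nondegenerate]; trivial
  refine Submodule.topologicalClosure_minimal _ (Submodule.span_le.2 ?_)
    (A.ideal Set.univ).isClosed' h
  rintro _ ⟨f, a, rfl⟩
  exact A.act_mem_ideal f a fun x hx => (hx trivial).elim

/-- An element that vanishes at all points of a closed set `Z` belongs to `A(X ∖ Z)`. -/
theorem mem_ideal_compl_of_forall {Z : Set X} (hZ : IsClosed Z) {a : A.alg}
    (ha : ∀ z ∈ Z, a ∈ A.ideal {z}ᶜ) : a ∈ A.ideal Zᶜ := by
  rw [← CStarIdeal.Quot.mk_eq_zero, ← norm_le_zero_iff]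
  refine le_of_forall_pos_le_add fun ε hε => ?_
  rw [zero_add]
  -- Smallness passes to unions with the same `ε`. Compactness therefore gives it on `k ∩ Z` from
  -- neighbourhoods of the points, and the part of `Z` outside `k` lies in `W`.
  have hun : ∀ s t : Set X, ‖CStarIdeal.Quot.mk (A.ideal sᶜ) a‖ < ε →
      ‖CStarIdeal.Quot.mk (A.ideal tᶜ) a‖ < ε →
      ‖CStarIdeal.Quot.mk (A.ideal (s ∪ t)ᶜ) a‖ < ε := fun s t hs ht => by
    rw [Set.compl_union]
    exact (A.norm_mk_ideal_inter_le _ _ a).trans_lt (max_lt hs ht)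
  have hmono : ∀ s t : Set X, s ⊆ t → ‖CStarIdeal.Quot.mk (A.ideal tᶜ) a‖ < ε →
      ‖CStarIdeal.Quot.mk (A.ideal sᶜ) a‖ < ε := fun s t hst ht =>
    (A.norm_mk_ideal_anti (Set.compl_subset_compl.2 hst) a).trans_lt ht
  obtain ⟨W, hW, hWa⟩ := A.mem_vanishing_cocompact a ε hε
  obtain ⟨k, hk, hkW⟩ := Filter.mem_cocompact.1 hW
  have h1 : ‖CStarIdeal.Quot.mk (A.ideal (k ∩ Z)ᶜ) a‖ < ε := by
    refine (hk.inter_right hZ).induction_on (p := fun s => ‖CStarIdeal.Quot.mk (A.ideal sᶜ) a‖ < ε)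
      ?_ hmono hun fun x hx => ?_
    · rw [Set.compl_empty, CStarIdeal.Quot.mk_eq_zero.2 (A.mem_ideal_univ a), norm_zero]
      exact hε
    · obtain ⟨t, ht, h⟩ := A.mem_vanishing_nhds (ha x hx.2) ε hε
      exact ⟨t, mem_nhdsWithin_of_mem_nhds ht, h⟩
  refine (hmono Z ((k ∩ Z) ∪ W) (fun z hz => ?_) (hun _ _ h1 hWa)).le
  by_cases hzk : z ∈ k
  · exact Or.inl ⟨hzk, hz⟩
  · exact Or.inr (hkW hzk)

/-- The value of a section over `W` at a point of `W`. -/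
noncomputable def value {W : Set X} {w : X} (hw : w ∈ W) : A.restr W →⋆ₙₐ[ℂ] A.fibre w :=
  CStarIdeal.Quot.lift
    ((CStarIdeal.Quot.mkHom (A.ideal {w}ᶜ)).comp (A.ideal (coborder W)).incl) fun _ ha =>
    CStarIdeal.Quot.mk_eq_zero.2 (A.ideal_mono
      (Set.compl_subset_compl.2 (Set.singleton_subset_iff.2 (subset_closure hw))) ha)

theorem value_mk {W : Set X} {w : X} (hw : w ∈ W) (a : A.ideal (coborder W)) :
    A.value hw (CStarIdeal.Quot.mk _ a) = CStarIdeal.Quot.mk (A.ideal {w}ᶜ) (a : A.alg) := rfl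

/-- A representative lies in the ideal of `coborder W`, the complement of `closure W \ W`, so it
already vanishes at the limit points that are not in `W`. With the hypothesis it vanishes on the
whole closed set `closure W`, hence lies in the ideal that is divided out. -/
theorem eq_zero_of_value {W : Set X} {x : A.restr W}
    (h : ∀ w (hw : w ∈ W), A.value hw x = 0) : x = 0 := by
  obtain ⟨a, rfl⟩ := CStarIdeal.Quot.mk_surjective x
  refine CStarIdeal.Quot.mk_eq_zero.2 (CStarIdeal.mem_within.2
    (A.mem_ideal_compl_of_forall isClosed_closure ?_))
  intro z hz
  by_cases hzW : z ∈ W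
  · exact CStarIdeal.Quot.mk_eq_zero.1 ((A.value_mk hzW a).symm.trans (h z hzW))
  · refine A.ideal_mono (fun y hy => ?_) a.2
    rintro rfl
    exact hy ⟨hz, hzW⟩

theorem eq_of_value {W : Set X} {x y : A.restr W}
    (h : ∀ w (hw : w ∈ W), A.value hw x = A.value hw y) : x = y :=
  sub_eq_zero.1 (A.eq_zero_of_value fun w hw => by rw [map_sub, h w hw, sub_self])

/-- A map of section algebras that preserves the values at the common points and extends by
zero. -/
structure IsSectionMap {W W' : Set X} (f : A.restr W →⋆ₙₐ[ℂ] A.restr W') : Prop where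
  value_eq : ∀ x w (hw : w ∈ W) (hw' : w ∈ W'), A.value hw' (f x) = A.value hw x
  value_eq_zero : ∀ x w (hw' : w ∈ W'), w ∉ W → A.value hw' (f x) = 0

/-- The two conditions prescribe the value of the image at every point of `W'`. All later commuting
diagrams rest on this. -/
theorem IsSectionMap.unique {W W' : Set X} {f g : A.restr W →⋆ₙₐ[ℂ] A.restr W'}
    (hf : A.IsSectionMap f) (hg : A.IsSectionMap g) : f = g := by
  refine NonUnitalStarAlgHom.ext fun x => A.eq_of_value fun w hw' => ?_
  by_cases hw : w ∈ W
  · rw [hf.value_eq x w hw, hg.value_eq x w hw]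
  · rw [hf.value_eq_zero x w hw' hw, hg.value_eq_zero x w hw' hw]

/-- The inclusion `W ∩ W'' ⊆ W'` is needed: at a common point of source and target missing from the
middle set, the composite would be zero. -/
theorem IsSectionMap.comp {W W' W'' : Set X} {f : A.restr W →⋆ₙₐ[ℂ] A.restr W'}
    {g : A.restr W' →⋆ₙₐ[ℂ] A.restr W''} (hg : A.IsSectionMap g) (hf : A.IsSectionMap f)
    (h : W ∩ W'' ⊆ W') : A.IsSectionMap (g.comp f) where
  value_eq x w hw hw'' := by
    rw [NonUnitalStarAlgHom.comp_apply, hg.value_eq _ w (h ⟨hw, hw''⟩),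
      hf.value_eq x w hw]
  value_eq_zero x w hw'' hw := by
    rw [NonUnitalStarAlgHom.comp_apply]
    by_cases hw' : w ∈ W'
    · rw [hg.value_eq _ w hw', hf.value_eq_zero x w hw' hw]
    · exact hg.value_eq_zero _ w hw'' hw'

theorem isSectionMap_id (W : Set X) : A.IsSectionMap (NonUnitalStarAlgHom.id ℂ (A.restr W)) where
  value_eq _ _ _ _ := rfl
  value_eq_zero _ _ h h' := (h' h).elim

theorem res_mk {Z Y : Set X} (hZ : RelClosed Z Y) (a : A.ideal (coborder Y)) :
    A.res hZ (CStarIdeal.Quot.mk _ a) =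
      CStarIdeal.Quot.mk _ ⟨a, A.ideal_mono hZ.coborder_subset a.2⟩ :=
  CStarIdeal.subQuotMap_mk _ _ a

/-- On elements of `A` that represent the kernel, extension by zero does not change the
representative, although `ext` is defined through an inverse. -/
theorem ext_mk [T2Space X] [LocallyCompactSpace X] {O Y Z : Set X} (d : IsDecomp O Y Z)
    (a : A.ideal (coborder Y \ Z)) :
    A.ext d (CStarIdeal.Quot.mk _ ⟨a, A.ideal_mono d.diff_subset a.2⟩) =
      CStarIdeal.Quot.mk _ ⟨a, A.ideal_mono Set.sdiff_subset a.2⟩ := by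
  have h : A.excision d (CStarIdeal.Quot.mk _ a) =
      CStarIdeal.Quot.mk _ ⟨a, A.ideal_mono d.diff_subset a.2⟩ :=
    CStarIdeal.subQuotMap_mk _ _ a
  rw [← h, A.ext_excision]
  exact CStarIdeal.subQuotMap_mk _ _ a

theorem exists_excision_eq [T2Space X] [LocallyCompactSpace X] {O Y Z : Set X}
    (d : IsDecomp O Y Z) (x : A.restr O) : ∃ a : A.ideal (coborder Y \ Z),
      x = CStarIdeal.Quot.mk _ ⟨a, A.ideal_mono d.diff_subset a.2⟩ := by
  obtain ⟨y, rfl⟩ := (A.excision_bijective d).2 x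
  obtain ⟨a, rfl⟩ := CStarIdeal.Quot.mk_surjective y
  exact ⟨a, CStarIdeal.subQuotMap_mk _ _ a⟩

theorem isSectionMap_res {Z Y : Set X} (hZ : RelClosed Z Y) : A.IsSectionMap (A.res hZ) where
  value_eq x w hw hw' := by
    obtain ⟨a, rfl⟩ := CStarIdeal.Quot.mk_surjective x
    rw [A.res_mk hZ a, A.value_mk hw, A.value_mk hw']
  value_eq_zero x w hw' hw := (hw (hZ.subset hw')).elim

theorem isSectionMap_ext [T2Space X] [LocallyCompactSpace X] {O Y Z : Set X}
    (d : IsDecomp O Y Z) : A.IsSectionMap (A.ext d) where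
  value_eq x w hw hw' := by
    obtain ⟨a, rfl⟩ := A.exists_excision_eq d x
    rw [A.ext_mk d a, A.value_mk hw, A.value_mk hw']
  value_eq_zero x w hw' hw := by
    obtain ⟨a, rfl⟩ := A.exists_excision_eq d x
    rw [A.ext_mk d a, A.value_mk hw']
    refine CStarIdeal.Quot.mk_eq_zero.2 (A.ideal_mono ?_ a.2)
    rintro y hy rfl
    refine hw ?_
    rw [d.diff_eq]
    exact ⟨hw', hy.2⟩

end C0Algebra

end CStarFib

/-! ### Pull-backs along embedded simplices and the fibration condition. -/

namespace CStarFib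

open ZeroAtInfty MultiplierAlgebra Topology

theorem isIso_homMk_of_bijective {C : GoodSubcategory.{u}} {A B : C.Cat}
    (f : A.obj →⋆ₙₐ[ℂ] B.obj) (hf : Function.Bijective f) :
    IsIso (ObjectProperty.homMk f : A ⟶ B) := by
  let e := StarAlgEquiv.ofBijective f hf
  refine ⟨ObjectProperty.homMk (e.symm : B.obj →⋆ₙₐ[ℂ] A.obj), ?_, ?_⟩
  · apply ObjectProperty.hom_ext
    exact NonUnitalStarAlgHom.ext fun x => e.symm_apply_apply x
  · apply ObjectProperty.hom_ext
    exact NonUnitalStarAlgHom.ext fun x => e.apply_symm_apply x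

namespace C0Algebra

variable {X : Type w} [TopologicalSpace X] (A : C0Algebra.{u} X)

/-- Modulo the functions vanishing at `x`, multiplication by `f` is multiplication by `f x`. -/
theorem act_sub_smul_mem (f : C(X, ℂ)) {x : X} (g : C₀(X, ℂ)) (hg : ∀ y, g y = f y) (a : A.alg) :
    A.act g a - f x • a ∈ A.ideal {x}ᶜ := by
  have h : a ∈ (Submodule.span ℂ {b : A.alg | ∃ f a, b = (A.Φ f).fst a}).topologicalClosure := by
    rw [A.nondegenerate]; trivial
  -- The claim is closed and linear in `a`, so it is enough to treat `a = Φ(k) · b`, where `T a` is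
  -- the action of `g * k - f x • k` on `b`, a function vanishing at `x`.
  let T : A.alg →L[ℂ] A.alg := A.act g - f x • ContinuousLinearMap.id ℂ A.alg
  refine Submodule.topologicalClosure_minimal
    (t := (A.ideal {x}ᶜ).toSubmodule.comap (T : A.alg →ₗ[ℂ] A.alg)) _ (Submodule.span_le.2 ?_)
    ((A.ideal {x}ᶜ).isClosed'.preimage T.continuous) h
  rintro _ ⟨k, a, rfl⟩
  change A.act g (A.act k a) - f x • A.act k a ∈ A.ideal {x}ᶜ
  have h2 : A.act g (A.act k a) - f x • A.act k a = A.act (g * k - f x • k) a := by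
    rw [A.act_act]
    simp [act]
  rw [h2]
  refine A.act_mem_ideal _ _ fun y hy => ?_
  rw [Set.notMem_compl_iff, Set.mem_singleton_iff] at hy
  subst hy
  simp [hg]

section Pullback

variable {Y : Type} [TopologicalSpace Y] [CompactSpace Y] (f : C(Y, X))

/-- The pull-back of an element of `A`, as the class of a constant function. -/
noncomputable def pullbackConst : A.alg →⋆ₙₐ[ℂ] A.pullback f :=
  (CStarIdeal.Quot.mkHom (A.pullbackIdeal f)).comp
    { toFun := fun a => ContinuousMap.const Y a
      map_smul' := fun _ _ => rfl
      map_zero' := rfl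
      map_add' := fun _ _ => rfl
      map_mul' := fun _ _ => rfl
      map_star' := fun _ => rfl }

theorem pullbackConst_eq_zero {a : A.alg} :
    A.pullbackConst f a = 0 ↔ ∀ y, a ∈ A.ideal {f y}ᶜ :=
  CStarIdeal.Quot.mk_eq_zero

/-- Dividing out the kernel leaves an injective, hence isometric, *-homomorphism from a complete
space with the same range. -/
theorem range_pullbackConst_closed : IsClosed (Set.range (A.pullbackConst f)) := by
  let I : CStarIdeal A.alg :=
    { toSubmodule :=
        { carrier := {a | A.pullbackConst f a = 0}
          add_mem' := fun {a b} (ha : _ = 0) (hb : _ = 0) => by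
            change A.pullbackConst f (a + b) = 0
            rw [map_add, ha, hb, add_zero]
          zero_mem' := map_zero _
          smul_mem' := fun c a (ha : _ = 0) => by
            change A.pullbackConst f (c • a) = 0
            rw [map_smul, ha, smul_zero] }
      mul_left_mem' := fun b a (ha : _ = 0) => by
        change A.pullbackConst f (b * a) = 0
        rw [map_mul, ha, mul_zero]
      mul_right_mem' := fun b a (ha : _ = 0) => by
        change A.pullbackConst f (a * b) = 0
        rw [map_mul, ha, zero_mul]
      star_mem' := fun {a} (ha : _ = 0) => by
        change A.pullbackConst f (star a) = 0
        rw [map_star, ha, star_zero]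
      isClosed' := isClosed_eq
        (AddMonoidHomClass.continuous_of_bound (A.pullbackConst f) 1 fun a => by
          rw [one_mul]; exact NonUnitalStarAlgHom.norm_apply_le (A.pullbackConst f) a)
        continuous_const }
  let ψ : I.Quot →⋆ₙₐ[ℂ] A.pullback f := CStarIdeal.Quot.lift (A.pullbackConst f) fun _ ha => ha
  have hψ : Function.Injective ψ := by
    refine (injective_iff_map_eq_zero ψ).2 fun x hx => ?_
    obtain ⟨a, rfl⟩ := CStarIdeal.Quot.mk_surjective x
    exact CStarIdeal.Quot.mk_eq_zero.2 hx
  have h : Set.range (A.pullbackConst f) = Set.range ψ := by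
    ext z
    constructor
    · rintro ⟨a, rfl⟩
      exact ⟨CStarIdeal.Quot.mk _ a, rfl⟩
    · rintro ⟨x, rfl⟩
      obtain ⟨a, rfl⟩ := CStarIdeal.Quot.mk_surjective x
      exact ⟨a, rfl⟩
  rw [h]
  exact (NonUnitalStarAlgHom.isometry ψ hψ).isClosedEmbedding.isClosed_range

/-- A compactly supported real function as a function vanishing at infinity. -/
noncomputable def compactlySupported (χ : C(X, ℝ)) (hχ : HasCompactSupport χ) : C₀(X, ℂ) where
  toFun x := (χ x : ℂ)
  continuous_toFun := by fun_prop
  zero_at_infty' := by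
    have h : Filter.Tendsto χ (Filter.cocompact X) (𝓝 0) := hχ.is_zero_at_infty
    have h2 := (Complex.continuous_ofReal.tendsto 0).comp h
    rw [Complex.ofReal_zero] at h2
    exact h2

/-- An injective map from a compact space is an embedding, so `F` is almost constant on preimages of
small open sets of `X`. A partition of unity on `X` glues finitely many of its values into one
element of `A`. -/
theorem exists_pullbackConst_near [T2Space X] [LocallyCompactSpace X]
    (hf : Function.Injective f) (F : C(Y, A.alg)) {ε : ℝ} (hε : 0 < ε) :
    ∃ (a : A.alg) (G : C(Y, A.alg)),
      A.pullbackConst f a = CStarIdeal.Quot.mk (A.pullbackIdeal f) G ∧ ‖F - G‖ < ε := by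
  have hemb : IsInducing f := (f.continuous.isClosedEmbedding hf).isInducing
  have hU : ∀ y, ∃ U : Set X, IsOpen U ∧ f y ∈ U ∧ ∀ y', f y' ∈ U → ‖F y' - F y‖ < ε / 2 := by
    intro y
    have hopen : IsOpen {y' | ‖F y' - F y‖ < ε / 2} :=
      isOpen_lt (by fun_prop) continuous_const
    obtain ⟨U, hU, hUy⟩ := hemb.isOpen_iff.1 hopen
    refine ⟨U, hU, ?_, fun y' hy' => ?_⟩
    · change y ∈ f ⁻¹' U
      rw [hUy]
      change ‖F y - F y‖ < ε / 2
      rw [sub_self, norm_zero]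
      exact half_pos hε
    · have : y' ∈ f ⁻¹' U := hy'
      rw [hUy] at this
      exact this
  choose U hUo hUm hUF using hU
  have hcpt : IsCompact (Set.range f) := isCompact_range f.continuous
  obtain ⟨t, ht⟩ := hcpt.elim_finite_subcover U hUo (by
    rintro _ ⟨y, rfl⟩
    exact Set.mem_iUnion.2 ⟨y, hUm y⟩)
  let e := t.equivFin
  obtain ⟨χ, h1, h2, h3, h4⟩ := exists_continuous_sum_one_of_isOpen_isCompact
    (s := fun i => U (e.symm i)) (fun i => hUo _) hcpt (fun x hx => by
      obtain ⟨y, hy⟩ := Set.mem_iUnion.1 (ht hx)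
      obtain ⟨hyt, hxy⟩ := Set.mem_iUnion.1 hy
      exact Set.mem_iUnion.2 ⟨e ⟨y, hyt⟩, by simpa using hxy⟩)
  -- In the fibre over `f y`, acting by `χ i` is multiplication by the number `χ i (f y)`. Thus the
  -- constant function `a` and the function `G` have the same class in the pull-back, though they
  -- differ as functions.
  let a : A.alg := ∑ i, A.act (compactlySupported (χ i) (h4 i)) (F (e.symm i))
  let G : C(Y, A.alg) := ⟨fun y => ∑ i, (χ i (f y) : ℂ) • F (e.symm i), by fun_prop⟩
  have hG : A.pullbackConst f a = CStarIdeal.Quot.mk (A.pullbackIdeal f) G := by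
    refine CStarIdeal.Quot.mk_eq_mk.2 fun y => ?_
    change a - ∑ i, (χ i (f y) : ℂ) • F (e.symm i) ∈ A.ideal {f y}ᶜ
    rw [← Finset.sum_sub_distrib]
    refine sum_mem fun i _ => ?_
    exact A.act_sub_smul_mem ⟨fun x => (χ i x : ℂ), by fun_prop⟩
      (compactlySupported (χ i) (h4 i)) (fun _ => rfl) _
  refine ⟨a, G, hG, lt_of_le_of_lt ?_ (half_lt_self hε)⟩
  rw [ContinuousMap.norm_le _ (half_pos hε).le]
  intro y
  have hsum : ∑ i, χ i (f y) = 1 := by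
    have := h2 (Set.mem_range_self y)
    simpa using this
  have hsum' : ∑ i, (χ i (f y) : ℂ) = 1 := by exact_mod_cast hsum
  have heq : (F - G) y = ∑ i, (χ i (f y) : ℂ) • (F y - F (e.symm i)) := by
    change F y - ∑ i, (χ i (f y) : ℂ) • F (e.symm i) = _
    simp only [smul_sub]
    rw [Finset.sum_sub_distrib, ← Finset.sum_smul, hsum', one_smul]
  rw [heq]
  calc ‖∑ i, (χ i (f y) : ℂ) • (F y - F (e.symm i))‖
      ≤ ∑ i, ‖(χ i (f y) : ℂ) • (F y - F (e.symm i))‖ := norm_sum_le _ _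
    _ ≤ ∑ i, χ i (f y) * (ε / 2) := by
        refine Finset.sum_le_sum fun i _ => ?_
        rw [norm_smul, Complex.norm_real, Real.norm_of_nonneg (h3 i _).1]
        by_cases hi : f y ∈ U (e.symm i)
        · exact mul_le_mul_of_nonneg_left (hUF _ _ hi).le (h3 i _).1
        · rw [image_eq_zero_of_notMem_tsupport fun h => hi (h1 i h), zero_mul, zero_mul]
    _ = ε / 2 := by rw [← Finset.sum_mul, hsum, one_mul]

/-- The range is dense by the approximation above, and it is closed. -/
theorem pullbackConst_surjective [T2Space X] [LocallyCompactSpace X]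
    (hf : Function.Injective f) : Function.Surjective (A.pullbackConst f) := by
  intro z
  obtain ⟨F, hF⟩ := CStarIdeal.Quot.mk_surjective z
  have hz : z ∈ closure (Set.range (A.pullbackConst f)) := by
    rw [Metric.mem_closure_iff]
    intro ε hε
    obtain ⟨a, G, ha, hG⟩ := A.exists_pullbackConst_near f hf F hε
    refine ⟨_, ⟨a, rfl⟩, ?_⟩
    rw [dist_eq_norm, ha, ← hF]
    exact (CStarIdeal.Quot.norm_mk_le (F - G)).trans_lt hG
  rwa [(A.range_pullbackConst_closed f).closure_eq] at hz

variable {f}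

/-- The pull-back map on the sections over a set that contains the range of `f`. -/
noncomputable def pullbackRestr {Z : Set X} (hZ : ∀ y, f y ∈ Z) :
    A.restr Z →⋆ₙₐ[ℂ] A.pullback f :=
  CStarIdeal.Quot.lift ((A.pullbackConst f).comp (A.ideal (coborder Z)).incl) fun _ ha =>
    (A.pullbackConst_eq_zero f).2 fun y => A.ideal_mono
      (Set.compl_subset_compl.2 (Set.singleton_subset_iff.2 (subset_closure (hZ y)))) ha

theorem pullbackEval_pullbackRestr {Z : Set X} (hZ : ∀ y, f y ∈ Z) (y : Y) (x : A.restr Z) :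
    A.pullbackEval f y (A.pullbackRestr hZ x) = A.value (hZ y) x := by
  obtain ⟨a, rfl⟩ := CStarIdeal.Quot.mk_surjective x
  rfl

/-- Injectivity holds because evaluations of the pull-back are the values at the points of `Z`. For
surjectivity, `Z` is compact, hence closed, so every element of `A` represents a section over `Z`.
-/
theorem pullbackRestr_bijective [T2Space X] [LocallyCompactSpace X] (hf : Function.Injective f)
    {Z : Set X} (hZ : Set.range f = Z) :
    Function.Bijective (A.pullbackRestr (f := f) (Z := Z) fun y => hZ ▸ Set.mem_range_self y) := by
  subst hZ
  constructor
  · refine (injective_iff_map_eq_zero _).2 fun x hx => A.eq_zero_of_value ?_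
    rintro _ ⟨y, rfl⟩
    rw [← A.pullbackEval_pullbackRestr Set.mem_range_self, hx, map_zero]
  · intro z
    obtain ⟨a, rfl⟩ := A.pullbackConst_surjective f hf z
    have hcl : IsClosed (Set.range f) := (isCompact_range f.continuous).isClosed
    refine ⟨CStarIdeal.Quot.mk _ ⟨a, ?_⟩, rfl⟩
    rw [hcl.coborder_eq]
    exact A.mem_ideal_univ a

end Pullback

theorem value_singleton_bijective [T1Space X] (x : X) :
    Function.Bijective (A.value (Set.mem_singleton x)) := by
  constructor
  · refine (injective_iff_map_eq_zero _).2 fun s hs => A.eq_zero_of_value ?_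
    rintro _ rfl
    exact hs
  · intro z
    obtain ⟨a, rfl⟩ := CStarIdeal.Quot.mk_surjective z
    refine ⟨CStarIdeal.Quot.mk _ ⟨a, ?_⟩, rfl⟩
    rw [isClosed_singleton.coborder_eq]
    exact A.mem_ideal_univ a

/-- For an `h`-fibration, evaluation at a point of an embedded simplex is an isomorphism. -/
theorem isIso_hres_singleton [T2Space X] [LocallyCompactSpace X] {C : GoodSubcategory.{u}}
    {h : HomologyTheory.{u, v} C} {hA : C.prop A.alg} (hfib : A.IsFibration h hA) {p : ℕ}
    (f : C(Simplex p, X)) (hf : Function.Injective f) {Z : Set X} (hZ : Set.range f = Z)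
    {x : X} (hx : RelClosed {x} Z) (n : ℤ) : IsIso (A.hres h hA n hx) := by
  obtain ⟨v, hv⟩ : x ∈ Set.range f := hZ ▸ hx.subset rfl
  subst hv
  have h1 := hfib p f v n
  let P : C.Cat := ⟨A.pullback f, A.pullback_mem hA f⟩
  let B : C.Cat := ⟨A.fibre (f v), A.fibre_mem hA (f v)⟩
  let e : P ⟶ B := ObjectProperty.homMk (A.pullbackEval f v)
  let k : A.restrObj hA Z ⟶ P := ObjectProperty.homMk
    (A.pullbackRestr (f := f) (Z := Z) fun y => hZ ▸ Set.mem_range_self y)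
  let l : A.restrObj hA {f v} ⟶ B := ObjectProperty.homMk (A.value (Set.mem_singleton (f v)))
  have hk : IsIso k := isIso_homMk_of_bijective _ (A.pullbackRestr_bijective hf hZ)
  have hl : IsIso l := isIso_homMk_of_bijective _ (A.value_singleton_bijective (f v))
  have he : IsIso ((h.h n).map e) := h1
  -- Under the identifications of `A(Z)` with the pull-back and of `A({f v})` with the fibre,
  -- restriction becomes evaluation, to which the fibration hypothesis applies.
  have hsq : (ObjectProperty.homMk (A.res hx) : A.restrObj hA Z ⟶ A.restrObj hA {f v}) ≫ l =
      k ≫ e := by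
    apply ObjectProperty.hom_ext
    refine NonUnitalStarAlgHom.ext fun s => ?_
    refine ((A.isSectionMap_res hx).value_eq s (f v) (hx.subset rfl) rfl).trans ?_
    exact (A.pullbackEval_pullbackRestr (fun y => hZ ▸ Set.mem_range_self y) v s).symm
  have hsq' : A.hres h hA n hx ≫ (h.h n).map l = (h.h n).map k ≫ (h.h n).map e := by
    rw [← Functor.map_comp, ← hsq, Functor.map_comp]
    rfl
  have : IsIso (A.hres h hA n hx ≫ (h.h n).map l) := by rw [hsq']; infer_instance
  exact IsIso.of_isIso_comp_right _ ((h.h n).map l)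

end C0Algebra

end CStarFib

/-! ### Relatively closed sets, and exact sequences of section algebras in homology. -/

namespace CStarFib

section Topology

variable {X : Type w} [TopologicalSpace X] {Y Z Z₁ Z₂ C O : Set X}

theorem RelClosed.of_isClosed (hZ : IsClosed Z) (h : Z ⊆ Y) : RelClosed Z Y :=
  ⟨h, by rw [hZ.closure_eq]; exact Set.inter_subset_left⟩

theorem RelClosed.inter_isClosed (hC : IsClosed C) (h : Y ∩ C = Z) : RelClosed Z Y := by
  subst h
  refine ⟨Set.inter_subset_left, fun x hx => ⟨hx.2, ?_⟩⟩
  exact closure_minimal Set.inter_subset_right hC hx.1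

theorem RelClosed.mono {Y' : Set X} (h : RelClosed Z Y) (hZ : Z ⊆ Y') (hY : Y' ⊆ Y) :
    RelClosed Z Y' :=
  ⟨hZ, fun _ hx => h.closed ⟨hx.1, hY hx.2⟩⟩

theorem RelClosed.trans {W : Set X} (h₁ : RelClosed Z Y) (h₂ : RelClosed Y W) : RelClosed Z W :=
  ⟨h₁.subset.trans h₂.subset, fun _ hx =>
    h₁.closed ⟨hx.1, h₂.closed ⟨closure_mono h₁.subset hx.1, hx.2⟩⟩⟩

theorem RelClosed.union (h₁ : RelClosed Z₁ Y) (h₂ : RelClosed Z₂ Y) : RelClosed (Z₁ ∪ Z₂) Y := by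
  refine ⟨Set.union_subset h₁.subset h₂.subset, ?_⟩
  rw [closure_union]
  rintro x ⟨hx | hx, hY⟩
  · exact Or.inl (h₁.closed ⟨hx, hY⟩)
  · exact Or.inr (h₂.closed ⟨hx, hY⟩)

theorem RelClosed.eq_inter_closure (h : RelClosed Z Y) : Z = Y ∩ closure Z :=
  Set.Subset.antisymm (fun _ hx => ⟨h.subset hx, subset_closure hx⟩) fun _ hx => h.closed hx.symm

theorem RelClosed.isLocallyClosed (h : RelClosed Z Y) (hY : IsLocallyClosed Y) :
    IsLocallyClosed Z := by
  rw [h.eq_inter_closure]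
  exact hY.inter isClosed_closure.isLocallyClosed

theorem RelClosed.isLocallyClosed_diff (h : RelClosed Z Y) (hY : IsLocallyClosed Y) :
    IsLocallyClosed (Y \ Z) := by
  have : Y \ Z = Y ∩ (closure Z)ᶜ := by
    ext x
    exact ⟨fun hx => ⟨hx.1, fun hc => hx.2 (h.closed ⟨hc, hx.1⟩)⟩,
      fun hx => ⟨hx.1, fun hc => hx.2 (subset_closure hc)⟩⟩
  rw [this]
  exact hY.inter isClosed_closure.isOpen_compl.isLocallyClosed

end Topology

namespace C0Algebra

variable {X : Type w} [TopologicalSpace X] (A : C0Algebra.{u} X)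
  {C : GoodSubcategory.{u}} (h : HomologyTheory.{u, v} C) (hA : C.prop A.alg)

/-- The map on homology that is induced by a map of section algebras. -/
noncomputable def hmap (n : ℤ) {W W' : Set X} (f : A.restr W →⋆ₙₐ[ℂ] A.restr W') :
    A.hgrp h hA n W ⟶ A.hgrp h hA n W' :=
  (h.h n).map (ObjectProperty.homMk f)

theorem hmap_comp (n : ℤ) {W W' W'' : Set X} (f : A.restr W →⋆ₙₐ[ℂ] A.restr W')
    (g : A.restr W' →⋆ₙₐ[ℂ] A.restr W'') :
    A.hmap h hA n f ≫ A.hmap h hA n g = A.hmap h hA n (g.comp f) := by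
  rw [hmap, hmap, ← Functor.map_comp]
  rfl

theorem hmap_id (n : ℤ) (W : Set X) :
    A.hmap h hA n (NonUnitalStarAlgHom.id ℂ (A.restr W)) = 𝟙 _ :=
  (h.h n).map_id _

theorem hmap_comp_unique (n : ℤ) {W W' W'' : Set X} {f : A.restr W →⋆ₙₐ[ℂ] A.restr W'}
    {g : A.restr W' →⋆ₙₐ[ℂ] A.restr W''} {k : A.restr W →⋆ₙₐ[ℂ] A.restr W''}
    (hf : A.IsSectionMap f) (hg : A.IsSectionMap g) (hk : A.IsSectionMap k) (hW : W ∩ W'' ⊆ W') :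
    A.hmap h hA n f ≫ A.hmap h hA n g = A.hmap h hA n k := by
  rw [hmap_comp, (hg.comp A hf hW).unique A hk]

theorem hres_trans {Z Y W : Set X} (n : ℤ) (h₁ : RelClosed Y W) (h₂ : RelClosed Z Y)
    (h₃ : RelClosed Z W) : A.hres h hA n h₁ ≫ A.hres h hA n h₂ = A.hres h hA n h₃ :=
  A.hmap_comp_unique h hA n (A.isSectionMap_res h₁) (A.isSectionMap_res h₂)
    (A.isSectionMap_res h₃) fun _ hx => h₂.subset hx.2

/-- All homology groups of the sections over `W` vanish. -/
def Acyclic (W : Set X) : Prop := ∀ n, Subsingleton (A.hgrp h hA n W)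

variable {h hA} [T2Space X] [LocallyCompactSpace X]

theorem exact_hext_hres {O Y Z : Set X} (d : IsDecomp O Y Z) (n : ℤ) :
    Function.Exact (A.hext h hA n d) (A.hres h hA n d.relClosed) :=
  h.exact_A (A.seq hA d) n

theorem exact_hres_hbdry {O Y Z : Set X} (d : IsDecomp O Y Z) (n m : ℤ) (hnm : m + 1 = n) :
    Function.Exact (A.hres h hA n d.relClosed) (A.hbdry h hA n m hnm d) :=
  h.exact_B (A.seq hA d) n m hnm

theorem exact_hbdry_hext {O Y Z : Set X} (d : IsDecomp O Y Z) (n m : ℤ) (hnm : m + 1 = n) :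
    Function.Exact (A.hbdry h hA n m hnm d) (A.hext h hA m d) :=
  h.exact_J (A.seq hA d) n m hnm

theorem hres_hbdry {O Y Z : Set X} (d : IsDecomp O Y Z) (n m : ℤ) (hnm : m + 1 = n) :
    A.hres h hA n d.relClosed ≫ A.hbdry h hA n m hnm d = 0 := by
  ext x
  exact (A.exact_hres_hbdry d n m hnm).apply_apply_eq_zero x

/-- In the long exact sequence, injectivity of the restriction makes every class on `O` a boundary,
and surjectivity one degree higher makes all boundaries zero. -/
theorem acyclic_of_isIso_hres {O Y Z : Set X} (d : IsDecomp O Y Z)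
    (hi : ∀ n, IsIso (A.hres h hA n d.relClosed)) : A.Acyclic h hA O := by
  intro n
  refine ⟨fun a b => ?_⟩
  suffices hz : ∀ a : A.hgrp h hA n O, a = 0 by rw [hz a, hz b]
  intro a
  have hbij : ∀ n, Function.Bijective (A.hres h hA n d.relClosed) := fun n =>
    ConcreteCategory.bijective_of_isIso _
  have h1 : A.hext h hA n d a = 0 := by
    refine (hbij n).1 ?_
    rw [(A.exact_hext_hres d n).apply_apply_eq_zero, map_zero]
  obtain ⟨b, rfl⟩ := (A.exact_hbdry_hext d (n + 1) n rfl a).1 h1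
  obtain ⟨c, rfl⟩ := (hbij (n + 1)).2 b
  exact (A.exact_hres_hbdry d (n + 1) n rfl).apply_apply_eq_zero c

theorem Acyclic.of_decomp {O Y Z : Set X} (d : IsDecomp O Y Z) (hY : A.Acyclic h hA Y)
    (hZ : A.Acyclic h hA Z) : A.Acyclic h hA O := by
  refine A.acyclic_of_isIso_hres d fun n => ?_
  have := hY n
  have := hZ n
  refine (ConcreteCategory.isIso_iff_bijective _).2
    ⟨fun a b _ => Subsingleton.elim _ _, fun a => ⟨0, Subsingleton.elim _ _⟩⟩

/-- In the long exact sequence the groups on both sides of the connecting map belong to `Y` and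
vanish. -/
theorem Acyclic.isIso_hbdry {O Y Z : Set X} (d : IsDecomp O Y Z) (hY : A.Acyclic h hA Y)
    (n m : ℤ) (hnm : m + 1 = n) : IsIso (A.hbdry h hA n m hnm d) := by
  refine (ConcreteCategory.isIso_iff_bijective _).2
    ⟨(injective_iff_map_eq_zero' _).2 fun a => ⟨fun ha => ?_, fun ha => ?_⟩, fun a => ?_⟩
  · obtain ⟨b, rfl⟩ := (A.exact_hres_hbdry d n m hnm a).1 ha
    have := hY n
    rw [Subsingleton.elim b 0, map_zero]
  · rw [ha, map_zero]
  · have := hY m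
    exact (A.exact_hbdry_hext d n m hnm a).1 (Subsingleton.elim _ _)

/-- Naturality of the connecting map for maps of section algebras. -/
theorem hbdry_natural {O Y Z O' Y' Z' : Set X} (d : IsDecomp O Y Z) (d' : IsDecomp O' Y' Z')
    {fO : A.restr O →⋆ₙₐ[ℂ] A.restr O'} {fY : A.restr Y →⋆ₙₐ[ℂ] A.restr Y'}
    {fZ : A.restr Z →⋆ₙₐ[ℂ] A.restr Z'} (hO : A.IsSectionMap fO) (hY : A.IsSectionMap fY)
    (hZ : A.IsSectionMap fZ) (h₁ : O ∩ Y' ⊆ O') (h₂ : Y ∩ Z' ⊆ Z) (n m : ℤ) (hnm : m + 1 = n) :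
    A.hmap h hA n fZ ≫ A.hbdry h hA n m hnm d' =
      A.hbdry h hA n m hnm d ≫ A.hmap h hA m fO := by
  refine h.bdry_natural (S := A.seq hA d) (T := A.seq hA d')
    { fJ := ObjectProperty.homMk fO
      fA := ObjectProperty.homMk fY
      fB := ObjectProperty.homMk fZ
      comm_i := ?_
      comm_q := ?_ } n m hnm
  -- Both composites in each square are section maps, hence equal. The inclusions `h₁` and `h₂` are
  -- what the composites through `O'` and through `Z` require.
  · apply ObjectProperty.hom_ext
    exact (hY.comp A (A.isSectionMap_ext d) fun x hx => d.subset hx.1).unique A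
      ((A.isSectionMap_ext d').comp A hO h₁)
  · apply ObjectProperty.hom_ext
    exact (hZ.comp A (A.isSectionMap_res d.relClosed) h₂).unique A
      ((A.isSectionMap_res d'.relClosed).comp A hY fun x hx => d'.relClosed.subset hx.2)

/-- The two connecting maps of a relatively closed set with two clopen parts are opposite to each
other on classes that extend. -/
theorem hres_hbdry_add_eq_zero {O Y Y₁ Y₂ Z₁ Z₂ : Set X} (hY : IsLocallyClosed Y)
    (r₁ : RelClosed Z₁ Y) (r₂ : RelClosed Z₂ Y) (hd : Disjoint Z₁ Z₂)
    (d₁ : IsDecomp O Y₁ Z₁) (d₂ : IsDecomp O Y₂ Z₂) (h₁ : Y₁ = Y \ Z₂) (h₂ : Y₂ = Y \ Z₁)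
    (n m : ℤ) (hnm : m + 1 = n) :
    A.hres h hA n r₁ ≫ A.hbdry h hA n m hnm d₁ +
      A.hres h hA n r₂ ≫ A.hbdry h hA n m hnm d₂ = 0 := by
  have hO : O = Y \ (Z₁ ∪ Z₂) := by
    rw [d₁.diff_eq, h₁, Set.sdiff_sdiff, Set.union_comm]
  have r : RelClosed (Z₁ ∪ Z₂) Y := r₁.union r₂
  have d : IsDecomp O Y (Z₁ ∪ Z₂) := ⟨hY, r, hO⟩
  have g₁ : IsDecomp Y₁ Y Z₂ := ⟨hY, r₂, h₁⟩
  have g₂ : IsDecomp Y₂ Y Z₁ := ⟨hY, r₁, h₂⟩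
  have hZ : IsLocallyClosed (Z₁ ∪ Z₂) := r.isLocallyClosed hY
  have e₁ : IsDecomp Z₁ (Z₁ ∪ Z₂) Z₂ :=
    ⟨hZ, r₂.mono Set.subset_union_right r.subset, (hd.sup_sdiff_cancel_right).symm⟩
  have e₂ : IsDecomp Z₂ (Z₁ ∪ Z₂) Z₁ :=
    ⟨hZ, r₁.mono Set.subset_union_left r.subset, (hd.sup_sdiff_cancel_left).symm⟩
  -- `Y₁` is open in `Y` and `Z₁` is open in `Z₁ ∪ Z₂`. Extension by zero maps the sequence of `d₁`
  -- to that of `d` and is the identity on `O`.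
  have n₁ : A.hbdry h hA n m hnm d₁ = A.hext h hA n e₁ ≫ A.hbdry h hA n m hnm d := by
    have := A.hbdry_natural (h := h) (hA := hA) d₁ d (A.isSectionMap_id O) (A.isSectionMap_ext g₁)
      (A.isSectionMap_ext e₁) Set.inter_subset_left
      (fun x hx => hx.2.resolve_right fun hx2 => by
        have := hx.1; rw [h₁] at this; exact this.2 hx2) n m hnm
    rw [hmap_id, Category.comp_id] at this
    exact this.symm
  have n₂ : A.hbdry h hA n m hnm d₂ = A.hext h hA n e₂ ≫ A.hbdry h hA n m hnm d := by
    have := A.hbdry_natural (h := h) (hA := hA) d₂ d (A.isSectionMap_id O) (A.isSectionMap_ext g₂)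
      (A.isSectionMap_ext e₂) Set.inter_subset_left
      (fun x hx => hx.2.resolve_left fun hx2 => by
        have := hx.1; rw [h₂] at this; exact this.2 hx2) n m hnm
    rw [hmap_id, Category.comp_id] at this
    exact this.symm
  have s₁ : A.hext h hA n e₁ ≫ A.hres h hA n e₂.relClosed = 𝟙 _ := by
    rw [← A.hmap_id h hA n Z₁]
    exact A.hmap_comp_unique h hA n (A.isSectionMap_ext e₁) (A.isSectionMap_res _)
      (A.isSectionMap_id _) fun x hx => Or.inl hx.1
  have s₂ : A.hext h hA n e₂ ≫ A.hres h hA n e₁.relClosed = 𝟙 _ := by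
    rw [← A.hmap_id h hA n Z₂]
    exact A.hmap_comp_unique h hA n (A.isSectionMap_ext e₂) (A.isSectionMap_res _)
      (A.isSectionMap_id _) fun x hx => Or.inr hx.1
  -- Homology of the disjoint union is a direct sum: restricting to each part and extending back
  -- adds up to the identity. Hence the two connecting maps combine into one that follows the
  -- restriction from `Y` in an exact sequence.
  have hsum : A.hres h hA n e₂.relClosed ≫ A.hext h hA n e₁ +
      A.hres h hA n e₁.relClosed ≫ A.hext h hA n e₂ = 𝟙 _ := by
    ext z
    have h0 : A.hres h hA n e₁.relClosed
        (z - A.hext h hA n e₂ (A.hres h hA n e₁.relClosed z)) = 0 := by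
      have := ConcreteCategory.congr_hom s₂ (A.hres h hA n e₁.relClosed z)
      rw [map_sub]
      exact sub_eq_zero.2 this.symm
    obtain ⟨w, hw⟩ := (A.exact_hext_hres e₁ n _).1 h0
    have h3 : A.hres h hA n e₂.relClosed z = w := by
      have h4 := congrArg (A.hres h hA n e₂.relClosed) hw
      rw [map_sub, (A.exact_hext_hres e₂ n).apply_apply_eq_zero, sub_zero] at h4
      exact h4.symm.trans (ConcreteCategory.congr_hom s₁ w)
    change A.hext h hA n e₁ (A.hres h hA n e₂.relClosed z) +
      A.hext h hA n e₂ (A.hres h hA n e₁.relClosed z) = z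
    rw [h3, hw, sub_add_cancel]
  calc A.hres h hA n r₁ ≫ A.hbdry h hA n m hnm d₁ + A.hres h hA n r₂ ≫ A.hbdry h hA n m hnm d₂
      = A.hres h hA n r ≫ (A.hres h hA n e₂.relClosed ≫ A.hext h hA n e₁ +
          A.hres h hA n e₁.relClosed ≫ A.hext h hA n e₂) ≫ A.hbdry h hA n m hnm d := by
        rw [n₁, n₂, ← A.hres_trans h hA n r e₂.relClosed r₁,
          ← A.hres_trans h hA n r e₁.relClosed r₂]
        simp only [Preadditive.comp_add, Preadditive.add_comp, Category.assoc]
    _ = 0 := by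
        rw [hsum, Category.id_comp]
        exact A.hres_hbdry d n m hnm

end C0Algebra

end CStarFib

/-! ### Open faces, closed faces and acyclic strata of a simplex. -/

namespace CStarFib

namespace Realization

variable {V : Type w} {K : AbstractSimplicialComplex V}

/-- The closed face of the realization that belongs to a set of vertices. -/
def closedFace (K : AbstractSimplicialComplex V) (T : Finset V) : Set (Realization K) :=
  {x | x.coord.support ⊆ T}

/-- The open face of the realization that belongs to a set of vertices. -/
def openFace (K : AbstractSimplicialComplex V) (T : Finset V) : Set (Realization K) :=
  {x | x.coord.support = T}

/-- The union of all open faces between `S` and `T`. -/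
def stratum (K : AbstractSimplicialComplex V) (S T : Finset V) : Set (Realization K) :=
  {x | S ⊆ x.coord.support ∧ x.coord.support ⊆ T}

theorem mem_closedFace {T : Finset V} {x : Realization K} :
    x ∈ closedFace K T ↔ x.coord.support ⊆ T := Iff.rfl

theorem mem_openFace {T : Finset V} {x : Realization K} :
    x ∈ openFace K T ↔ x.coord.support = T := Iff.rfl

theorem mem_stratum {S T : Finset V} {x : Realization K} :
    x ∈ stratum K S T ↔ S ⊆ x.coord.support ∧ x.coord.support ⊆ T := Iff.rfl

theorem support_nonempty (x : Realization K) : x.coord.support.Nonempty :=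
  K.isRelLowerSet_faces.prop_of_mem x.support_mem

theorem isClosed_closedFace (T : Finset V) : IsClosed (closedFace K T) := by
  have h : closedFace K T = ⋂ (v : V) (_ : v ∉ T), {x : Realization K | x.coord v = 0} := by
    ext x
    simp only [Set.mem_iInter, mem_closedFace, Finset.subset_iff, Finsupp.mem_support_iff]
    exact forall_congr' fun v => not_imp_comm
  rw [h]
  exact isClosed_iInter fun v => isClosed_iInter fun _ =>
    isClosed_eq (continuous_coord v) continuous_const

theorem isClosed_not_subset (S : Finset V) :
    IsClosed {x : Realization K | ¬ S ⊆ x.coord.support} := by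
  have h : {x : Realization K | ¬ S ⊆ x.coord.support} =
      ⋃ v ∈ S, {x : Realization K | x.coord v = 0} := by
    ext x
    simp [Finset.not_subset]
  rw [h]
  exact S.finite_toSet.isClosed_biUnion fun v _ =>
    isClosed_eq (continuous_coord v) continuous_const

theorem isLocallyClosed_stratum (S T : Finset V) : IsLocallyClosed (stratum K S T) := by
  have h : stratum K S T = {x : Realization K | ¬ S ⊆ x.coord.support}ᶜ ∩ closedFace K T := by
    ext x
    simp [mem_stratum, mem_closedFace]
  rw [h]
  exact (isClosed_not_subset S).isOpen_compl.isLocallyClosed.inter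
    (isClosed_closedFace T).isLocallyClosed

theorem closedFace_relClosed {T T' : Finset V} (h : T' ⊆ T) :
    RelClosed (closedFace K T') (closedFace K T) :=
  .of_isClosed (isClosed_closedFace T') fun _ hx => Finset.Subset.trans hx h

theorem openFace_union_openFace [DecidableEq V] {T : Finset V} {v : V} :
    openFace K (insert v T) ∪ openFace K T = stratum K T (insert v T) := by
  ext x
  simp only [Set.mem_union, mem_openFace, mem_stratum]
  constructor
  · rintro (h | h) <;> rw [h] <;> simp
  · rintro ⟨h1, h2⟩
    by_cases hv : v ∈ x.coord.support
    · exact Or.inl (h2.antisymm (Finset.insert_subset hv h1))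
    · exact Or.inr (((Finset.subset_insert_iff_of_notMem hv).1 h2).antisymm h1)

theorem openFace_decomp [DecidableEq V] {T T' : Finset V} {v : V} (hv : v ∉ T')
    (hT : insert v T' = T) :
    IsDecomp (openFace K T) (openFace K T ∪ openFace K T') (openFace K T') := by
  have hne : T ≠ T' := by
    rintro rfl
    exact hv (hT ▸ Finset.mem_insert_self v _)
  have hsub : T' ⊆ T := hT ▸ Finset.subset_insert v T'
  refine ⟨?_, RelClosed.inter_isClosed (isClosed_closedFace T') ?_, ?_⟩
  · rw [← hT, openFace_union_openFace]
    exact isLocallyClosed_stratum _ _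
  · ext x
    simp only [Set.mem_inter_iff, Set.mem_union, mem_openFace, mem_closedFace]
    constructor
    · rintro ⟨h | h, h2⟩
      · rw [h] at h2
        exact (hne (h2.antisymm hsub)).elim
      · exact h
    · exact fun h => ⟨Or.inr h, h.subset⟩
  · ext x
    simp only [Set.mem_sdiff, Set.mem_union, mem_openFace]
    grind

/-- A support between `S` and `T` either contains `v` or stays inside `T.erase v`, and the second
case is closed. This drives the induction for acyclicity. -/
theorem stratum_decomp [DecidableEq V] {S T : Finset V} {v : V} :
    IsDecomp (stratum K (insert v S) T) (stratum K S T) (stratum K S (T.erase v)) := by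
  refine ⟨isLocallyClosed_stratum _ _,
    RelClosed.inter_isClosed (isClosed_closedFace (T.erase v)) ?_, ?_⟩
  · ext x
    simp only [Set.mem_inter_iff, mem_stratum, mem_closedFace]
    grind
  · ext x
    simp only [Set.mem_sdiff, mem_stratum]
    grind

theorem stratum_empty (T : Finset V) : stratum K ∅ T = closedFace K T := by
  ext x
  simp [mem_stratum, mem_closedFace]

end Realization

namespace OrderedSimplex

open Realization

variable {V : Type w} {K : AbstractSimplicialComplex V}

theorem eq_of_vert {p : ℕ} {σ τ : OrderedSimplex K p} (h : ∀ i, σ.vert i = τ.vert i) : σ = τ := by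
  cases σ; cases τ
  congr
  exact DFunLike.ext _ _ h

/-- The set of vertices of an ordered simplex. -/
def verts {p : ℕ} (σ : OrderedSimplex K p) : Finset V := Finset.univ.map σ.vert

theorem card_verts {p : ℕ} (σ : OrderedSimplex K p) : σ.verts.card = p + 1 := σ.card_vertices

theorem exists_verts_eq {T : Finset V} (hT : T ∈ K.faces) :
    ∃ (p : ℕ) (σ : OrderedSimplex K p), σ.verts = T := by
  have hne : T.Nonempty := K.isRelLowerSet_faces.prop_of_mem hT
  have hc : T.card - 1 + 1 = T.card := Nat.sub_add_cancel hne.card_pos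
  let e : Fin (T.card - 1 + 1) ≃ T := (finCongr hc).trans T.equivFin.symm
  let f : Fin (T.card - 1 + 1) ↪ V := e.toEmbedding.trans (Function.Embedding.subtype _)
  have hf : Finset.univ.map f = T := by
    ext v
    simp only [Finset.mem_map, Finset.mem_univ, true_and]
    constructor
    · rintro ⟨i, rfl⟩
      exact (e i).2
    · intro hv
      exact ⟨e.symm ⟨v, hv⟩, congrArg Subtype.val (e.apply_symm_apply ⟨v, hv⟩)⟩
  exact ⟨_, ⟨f, hf.symm ▸ hT⟩, hf⟩

theorem continuous_toMap {p : ℕ} (σ : OrderedSimplex K p) : Continuous σ.toMap :=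
  continuous_iff_coinduced_le.2
    (le_iSup_of_le p (le_iSup (fun σ : OrderedSimplex K p =>
      TopologicalSpace.coinduced σ.toMap inferInstance) σ))

theorem toMap_injective {p : ℕ} (σ : OrderedSimplex K p) : Function.Injective σ.toMap := by
  intro s t hst
  refine Subtype.ext (funext fun i => ?_)
  have h := congrArg (fun x : Realization K => x.coord (σ.vert i)) hst
  simp only [toMap_vert] at h
  exact h

/-- Change the order of the vertices of a simplex. -/
def perm {p : ℕ} (σ : OrderedSimplex K p) (π : Equiv.Perm (Fin (p + 1))) : OrderedSimplex K p where
  vert := π.toEmbedding.trans σ.vert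
  mem := by
    rw [← Finset.map_map, Finset.map_univ_equiv]
    exact σ.mem

theorem perm_vert {p : ℕ} (σ : OrderedSimplex K p) (π : Equiv.Perm (Fin (p + 1)))
    (i : Fin (p + 1)) : (σ.perm π).vert i = σ.vert (π i) := rfl

theorem verts_perm {p : ℕ} (σ : OrderedSimplex K p) (π : Equiv.Perm (Fin (p + 1))) :
    (σ.perm π).verts = σ.verts := by
  change Finset.univ.map (π.toEmbedding.trans σ.vert) = _
  rw [← Finset.map_map, Finset.map_univ_equiv]
  rfl

theorem perm_one {p : ℕ} (σ : OrderedSimplex K p) : σ.perm 1 = σ := eq_of_vert fun _ => rfl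

theorem verts_eq_insert [DecidableEq V] {p : ℕ} (σ : OrderedSimplex K (p + 1)) (l : Fin (p + 2)) :
    insert (σ.vert l) (σ.face l).verts = σ.verts := by
  ext v
  simp only [verts, Finset.mem_insert, Finset.mem_map, Finset.mem_univ, true_and]
  constructor
  · rintro (rfl | ⟨i, rfl⟩)
    · exact ⟨l, rfl⟩
    · exact ⟨_, rfl⟩
  · rintro ⟨i, rfl⟩
    by_cases h : i = l
    · exact Or.inl (h ▸ rfl)
    · obtain ⟨j, rfl⟩ := Fin.exists_succAbove_eq h
      exact Or.inr ⟨j, rfl⟩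

theorem verts_face [DecidableEq V] {p : ℕ} (σ : OrderedSimplex K (p + 1)) (l : Fin (p + 2)) :
    (σ.face l).verts = σ.verts.erase (σ.vert l) := by
  rw [← σ.verts_eq_insert l]
  exact (Finset.erase_insert (σ.notMem_face l)).symm

end OrderedSimplex

namespace C0Algebra

open Realization

variable {V : Type w} {K : AbstractSimplicialComplex V} [LocallyCompactSpace (Realization K)]
  (A : C0Algebra.{u} (Realization K))
  {C : GoodSubcategory.{u}} {h : HomologyTheory.{u, v} C} {hA : C.prop A.alg}

theorem isIso_hres_vertex (hfib : A.IsFibration h hA) {p : ℕ} (σ : OrderedSimplex K p)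
    {x : Realization K} (hx : RelClosed {x} σ.cell) (n : ℤ) : IsIso (A.hres h hA n hx) :=
  A.isIso_hres_singleton hfib ⟨σ.toMap, σ.continuous_toMap⟩ σ.toMap_injective σ.range_toMap hx n

/-- Restrict further to a vertex of the smaller face. Both evaluations at this point are
isomorphisms, hence so is the map between the faces. -/
theorem isIso_hres_closedFace (hfib : A.IsFibration h hA) {T T' : Finset V} (hT : T ∈ K.faces)
    (hT' : T' ∈ K.faces) (r : RelClosed (closedFace K T') (closedFace K T)) (n : ℤ) :
    IsIso (A.hres h hA n r) := by
  obtain ⟨p, σ, rfl⟩ := OrderedSimplex.exists_verts_eq hT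
  obtain ⟨q, τ, rfl⟩ := OrderedSimplex.exists_verts_eq hT'
  have t : RelClosed {τ.pt} (closedFace K τ.verts) := τ.pt_relClosed
  have h1 : IsIso (A.hres h hA n t) := A.isIso_hres_vertex hfib τ _ n
  have h2 : IsIso (A.hres h hA n (t.trans r)) := A.isIso_hres_vertex hfib σ _ n
  have h3 : IsIso (A.hres h hA n r ≫ A.hres h hA n t) := by
    rw [A.hres_trans h hA n r t (t.trans r)]
    exact h2
  exact IsIso.of_isIso_comp_right _ (A.hres h hA n t)

/-- Induction on `S`. For a single vertex the stratum is a closed face minus the opposite closed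
face, and restriction between these is an isomorphism. Adding a vertex to `S` gives an open part of
an acyclic stratum with acyclic complement. -/
theorem acyclic_stratum (hfib : A.IsFibration h hA) {S T : Finset V} (hS : S.Nonempty)
    (hST : S ⊂ T) (hT : T ∈ K.faces) :
    A.Acyclic h hA (stratum K S T) := by
  classical
  induction S using Finset.induction_on generalizing T with
  | empty => exact (Finset.not_nonempty_empty hS).elim
  | insert i S hi ih =>
    -- A vertex outside `insert i S` keeps `T.erase i` nonempty, hence a face, and strictly larger
    -- than `S`.
    obtain ⟨j, hj, hjS⟩ := Finset.exists_of_ssubset hST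
    have hjT : j ∈ T.erase i := Finset.mem_erase.2
      ⟨fun h => hjS (h ▸ Finset.mem_insert_self _ _), hj⟩
    have hT' : T.erase i ∈ K.faces :=
      (K.isRelLowerSet_faces hT).2 (Finset.erase_subset _ _) ⟨j, hjT⟩
    rcases S.eq_empty_or_nonempty with rfl | hne
    · have d := stratum_decomp (K := K) (S := ∅) (T := T) (v := i)
      rw [stratum_empty, stratum_empty] at d
      exact A.acyclic_of_isIso_hres d fun n => A.isIso_hres_closedFace hfib hT hT' _ n
    · have hS1 : S ⊆ T.erase i := fun s hs => Finset.mem_erase.2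
        ⟨fun h => hi (h ▸ hs), hST.subset (Finset.mem_insert_of_mem hs)⟩
      have hS2 : j ∉ S := fun h => hjS (Finset.mem_insert_of_mem h)
      have hS3 : S ⊂ T.erase i := (Finset.ssubset_iff_of_subset hS1).2 ⟨j, hjT, hS2⟩
      exact Acyclic.of_decomp A stratum_decomp
        (ih hne (hS3.trans_subset (Finset.erase_subset _ _)) hT) (ih hne hS3 hT')

theorem acyclic_halfOpen (hfib : A.IsFibration h hA) {p : ℕ} (σ : OrderedSimplex K (p + 1))
    (l : Fin (p + 2)) :
    A.Acyclic h hA (σ.halfOpen l) := by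
  classical
  have h1 := σ.verts_eq_insert l
  have h2 : σ.halfOpen l = stratum K (σ.face l).verts σ.verts := by
    rw [← h1, ← openFace_union_openFace, h1]
    rfl
  rw [h2]
  refine A.acyclic_stratum hfib Finset.univ_nonempty.map ?_ σ.mem
  rw [← h1]
  exact Finset.ssubset_insert (σ.notMem_face l)

/-- Each connecting map belongs to a sequence whose middle term is a half-open simplex, which is
acyclic. -/
theorem isIso_chain (hfib : A.IsFibration h hA) (x : Realization K) (p : ℕ)
    (σ : OrderedSimplex K p) (hx : σ.pt = x) (n m : ℤ) (hm : m + p = n) :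
    IsIso (A.chain h hA x p σ hx n m hm) := by
  induction p generalizing m with
  | zero =>
    rw [chain]
    infer_instance
  | succ p ih =>
    rw [chain]
    have h1 := ih (σ.face (Fin.last (p + 1))) (σ.pt_face_last.trans hx) (m + 1)
      (by push_cast at hm; linarith)
    have h2 := (A.acyclic_halfOpen hfib σ (Fin.last (p + 1))).isIso_hbdry A
      (σ.halfOpen_decomp (Fin.last (p + 1))) (m + 1) m rfl
    infer_instance

theorem isIso_canon (hfib : A.IsFibration h hA) {p : ℕ} (σ : OrderedSimplex K p)
    (n m : ℤ) (hm : m + p = n) :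
    IsIso (A.canon h hA σ n m hm) := by
  have h1 := A.isIso_hres_vertex hfib σ σ.pt_relClosed n
  have h2 := A.isIso_chain hfib σ.pt p σ rfl n m hm
  rw [canon]
  infer_instance

end C0Algebra

end CStarFib

/-! ### Opposite connecting maps, and the recursion for the canonical oriented map. -/

namespace CStarFib

namespace C0Algebra

open Realization

variable {V : Type w} {K : AbstractSimplicialComplex V} [LocallyCompactSpace (Realization K)]
  (A : C0Algebra.{u} (Realization K))
  {C : GoodSubcategory.{u}} (h : HomologyTheory.{u, v} C) (hA : C.prop A.alg)

/-- Two iterated connecting maps through the two intermediate faces are opposite. -/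
theorem hbdry_hbdry_add_eq_zero [DecidableEq V] {T T₁ T₂ S : Finset V} {v w : V} (hv : v ∉ S)
    (hw : w ∉ S) (hvw : v ≠ w) (hT₁ : insert v S = T₁) (hT₂ : insert w S = T₂)
    (h₁ : insert w T₁ = T) (n : ℤ)
    (d₁ : IsDecomp (openFace K T) (openFace K T ∪ openFace K T₁) (openFace K T₁))
    (d₂ : IsDecomp (openFace K T) (openFace K T ∪ openFace K T₂) (openFace K T₂))
    (e₁ : IsDecomp (openFace K T₁) (openFace K T₁ ∪ openFace K S) (openFace K S))
    (e₂ : IsDecomp (openFace K T₂) (openFace K T₂ ∪ openFace K S) (openFace K S)) :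
    A.hbdry h hA (n + 1 + 1) (n + 1) rfl e₁ ≫ A.hbdry h hA (n + 1) n rfl d₁ +
      A.hbdry h hA (n + 1 + 1) (n + 1) rfl e₂ ≫ A.hbdry h hA (n + 1) n rfl d₂ = 0 := by
  -- Since `T` is `S` together with `v` and `w`, the stratum `W` consists of four open faces. All
  -- set identities below are checked on these four supports.
  have hcases : ∀ s : Finset V, S ⊆ s ∧ s ⊆ T ↔ s = S ∨ s = T₁ ∨ s = T₂ ∨ s = T := by
    intro s
    constructor
    · rintro ⟨h1, h2⟩
      by_cases hvs : v ∈ s <;> by_cases hws : w ∈ s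
      · right; right; right; grind
      · right; left; grind
      · right; right; left; grind
      · left; grind
    · rintro (rfl | rfl | rfl | rfl) <;> grind
  have nS₁ : T₁ ≠ S := by grind
  have nS₂ : T₂ ≠ S := by grind
  have nS : T ≠ S := by grind
  have n₁ : T₁ ≠ T := by grind
  have hvT : v ∈ T := by grind
  have hvT₂ : v ∉ T₂ := by grind
  have n₂ : T₂ ≠ T := fun he => hvT₂ (he ▸ hvT)
  have n₁₂ : T₁ ≠ T₂ := by grind
  have s₁ : ∀ s : Finset V, s = S ∨ s = T₁ → s ⊆ T₁ := by grind
  have s₂ : ∀ s : Finset V, s = S ∨ s = T₂ → s ⊆ T₂ := by grind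
  have c₁ : ¬ T₂ ⊆ T₁ ∧ ¬ T ⊆ T₁ := by grind
  have c₂ : ¬ T₁ ⊆ T₂ ∧ ¬ T ⊆ T₂ := by grind
  have cS : ¬ T₁ ⊆ S ∧ ¬ T₂ ⊆ S ∧ ¬ T ⊆ S := by grind
  let W := stratum K S T
  let W' := W \ openFace K S
  have hW : IsLocallyClosed W := isLocallyClosed_stratum S T
  have rS : RelClosed (openFace K S) W := by
    refine RelClosed.inter_isClosed (isClosed_closedFace S) ?_
    ext x
    simp only [W, Set.mem_inter_iff, mem_stratum, mem_closedFace, mem_openFace, hcases]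
    grind
  have dW : IsDecomp W' W (openFace K S) := ⟨hW, rS, rfl⟩
  have hW' : IsLocallyClosed W' := rS.isLocallyClosed_diff hW
  have r₁ : RelClosed (openFace K T₁) W' := by
    refine RelClosed.inter_isClosed (isClosed_closedFace T₁) ?_
    ext x
    simp only [W', W, Set.mem_inter_iff, Set.mem_sdiff, mem_stratum, mem_closedFace, mem_openFace,
      hcases]
    grind
  have r₂ : RelClosed (openFace K T₂) W' := by
    refine RelClosed.inter_isClosed (isClosed_closedFace T₂) ?_
    ext x
    simp only [W', W, Set.mem_inter_iff, Set.mem_sdiff, mem_stratum, mem_closedFace, mem_openFace,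
      hcases]
    grind
  have q₁ : RelClosed (openFace K T₁ ∪ openFace K S) W := by
    refine RelClosed.inter_isClosed (isClosed_closedFace T₁) ?_
    ext x
    simp only [W, Set.mem_inter_iff, Set.mem_union, mem_stratum, mem_closedFace, mem_openFace,
      hcases]
    grind
  have q₂ : RelClosed (openFace K T₂ ∪ openFace K S) W := by
    refine RelClosed.inter_isClosed (isClosed_closedFace T₂) ?_
    ext x
    simp only [W, Set.mem_inter_iff, Set.mem_union, mem_stratum, mem_closedFace, mem_openFace,
      hcases]
    grind
  -- Both first connecting maps are restrictions of a single one, from the open face of `S` to `W'`.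
  -- What follows is then a class on `W'` restricted to the disjoint closed parts `T₁` and `T₂`, as
  -- in `hres_hbdry_add_eq_zero`.
  have b₁ : A.hbdry h hA (n + 1 + 1) (n + 1) rfl e₁ =
      A.hbdry h hA (n + 1 + 1) (n + 1) rfl dW ≫ A.hres h hA (n + 1) r₁ := by
    have := A.hbdry_natural (h := h) (hA := hA) dW e₁ (A.isSectionMap_res r₁)
      (A.isSectionMap_res q₁) (A.isSectionMap_id _)
      (fun x hx => hx.2.resolve_right hx.1.2) (fun x hx => hx.2) (n + 1 + 1) (n + 1) rfl
    rw [hmap_id, Category.id_comp] at this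
    exact this
  have b₂ : A.hbdry h hA (n + 1 + 1) (n + 1) rfl e₂ =
      A.hbdry h hA (n + 1 + 1) (n + 1) rfl dW ≫ A.hres h hA (n + 1) r₂ := by
    have := A.hbdry_natural (h := h) (hA := hA) dW e₂ (A.isSectionMap_res r₂)
      (A.isSectionMap_res q₂) (A.isSectionMap_id _)
      (fun x hx => hx.2.resolve_right hx.1.2) (fun x hx => hx.2) (n + 1 + 1) (n + 1) rfl
    rw [hmap_id, Category.id_comp] at this
    exact this
  rw [b₁, b₂, Category.assoc, Category.assoc, ← Preadditive.comp_add,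
    A.hres_hbdry_add_eq_zero hW' r₁ r₂ ?_ d₁ d₂ ?_ ?_ (n + 1) n rfl, Limits.comp_zero]
  · rw [Set.disjoint_left]
    intro x hx hx'
    exact n₁₂ (hx.symm.trans hx')
  · ext x
    simp only [W', W, Set.mem_union, Set.mem_sdiff, mem_stratum, mem_openFace, hcases]
    grind
  · ext x
    simp only [W', W, Set.mem_union, Set.mem_sdiff, mem_stratum, mem_openFace, hcases]
    grind

/-- The two connecting maps from the end points of an edge are opposite on classes that extend to
the edge. -/
theorem hres_hbdry_edge_add_eq_zero [DecidableEq V] {T T₁ T₂ : Finset V} {v w : V} (hvw : v ≠ w)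
    (hT₁ : {v} = T₁) (hT₂ : {w} = T₂) (hT : {v, w} = T) (n : ℤ)
    (r₁ : RelClosed (openFace K T₁) (closedFace K T))
    (r₂ : RelClosed (openFace K T₂) (closedFace K T))
    (d₁ : IsDecomp (openFace K T) (openFace K T ∪ openFace K T₁) (openFace K T₁))
    (d₂ : IsDecomp (openFace K T) (openFace K T ∪ openFace K T₂) (openFace K T₂)) :
    A.hres h hA (n + 1) r₁ ≫ A.hbdry h hA (n + 1) n rfl d₁ +
      A.hres h hA (n + 1) r₂ ≫ A.hbdry h hA (n + 1) n rfl d₂ = 0 := by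
  -- Supports of points are nonempty, so the closed edge has only three open faces. The closed edge
  -- itself takes the role that `W'` has in higher dimensions.
  have hcases : ∀ s : Finset V, s.Nonempty → (s ⊆ T ↔ s = T₁ ∨ s = T₂ ∨ s = T) := by
    rintro s ⟨a, ha⟩
    constructor
    · intro h1
      by_cases hvs : v ∈ s <;> by_cases hws : w ∈ s
      · right; right; grind
      · left; grind
      · right; left; grind
      · grind
    · rintro (rfl | rfl | rfl) <;> grind
  have n₁ : T₁ ≠ T := by
    rintro rfl
    have : w ∈ ({v} : Finset V) := by rw [hT₁, ← hT]; simp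
    exact hvw (Finset.mem_singleton.1 this).symm
  have n₂ : T₂ ≠ T := by
    rintro rfl
    have : v ∈ ({w} : Finset V) := by rw [hT₂, ← hT]; simp
    exact hvw (Finset.mem_singleton.1 this)
  have n₁₂ : T₁ ≠ T₂ := by
    rintro rfl
    exact hvw (Finset.singleton_injective (hT₁.trans hT₂.symm))
  refine A.hres_hbdry_add_eq_zero (isClosed_closedFace T).isLocallyClosed r₁ r₂ ?_ d₁ d₂ ?_ ?_
    (n + 1) n rfl
  · rw [Set.disjoint_left]
    intro x hx hx'
    exact n₁₂ (hx.symm.trans hx')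
  · ext x
    simp only [Set.mem_union, Set.mem_sdiff, mem_closedFace, mem_openFace,
      hcases _ x.support_nonempty]
    grind
  · ext x
    simp only [Set.mem_union, Set.mem_sdiff, mem_closedFace, mem_openFace,
      hcases _ x.support_nonempty]
    grind

/-- The canonical oriented map of an ordered simplex with vertex set `T`. -/
noncomputable def canonOn {p : ℕ} (σ : OrderedSimplex K p) : {T : Finset V} → (hT : σ.verts = T) →
    (n m : ℤ) → (hm : m + p = n) → (A.hgrp h hA n (closedFace K T) ⟶ A.hgrp h hA m (openFace K T))
  | _, rfl, n, m, hm => A.canon h hA σ n m hm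

/-- Needed because for a vertex `chain` is only a transport along the equality of the open cell with
the point. -/
theorem hres_eqToHom {X : Type w} [TopologicalSpace X] (A : C0Algebra.{u} X) (hA : C.prop A.alg)
    {Y Z Z' : Set X} (hZ : Z = Z') (n m : ℤ) (hnm : n = m)
    (r : RelClosed Z Y) (r' : RelClosed Z' Y) (e : A.hgrp h hA n Z = A.hgrp h hA m Z')
    (e' : A.hgrp h hA n Y = A.hgrp h hA m Y) :
    A.hres h hA n r ≫ eqToHom e = eqToHom e' ≫ A.hres h hA m r' := by
  subst hZ hnm
  simp

theorem canonOn_zero (σ : OrderedSimplex K 0) {T : Finset V} (hT : σ.verts = T) (n : ℤ)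
    (hn : n + (0 : ℕ) = n) (r : RelClosed (openFace K T) (closedFace K T)) :
    A.canonOn h hA σ hT n n hn = A.hres h hA n r := by
  subst hT
  exact (A.hres_eqToHom h hA σ.openCell_zero.symm n n rfl σ.pt_relClosed r _ rfl).trans
    (Category.id_comp _)

theorem hres_chain {p : ℕ} (σ : OrderedSimplex K p) {x : Realization K} (hx : σ.pt = x)
    (r : RelClosed {x} σ.cell) (n m : ℤ) (hm : m + p = n) :
    A.hres h hA n r ≫ A.chain h hA x p σ hx n m hm = A.canon h hA σ n m hm := by
  subst hx
  rfl

/-- The last face still contains the first vertex, so evaluation there factors through the closed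
last face. Keeping the vertex sets `T` and `T'` as variables lets differently ordered simplices
share the same groups. -/
theorem canonOn_succ {p : ℕ} (σ : OrderedSimplex K (p + 1)) {T T' : Finset V} (hT : σ.verts = T)
    (hT' : (σ.face (Fin.last (p + 1))).verts = T') (n m : ℤ) (hm : m + ((p + 1 : ℕ) : ℤ) = n)
    (hm' : m + 1 + (p : ℤ) = n)
    (r : RelClosed (closedFace K T') (closedFace K T))
    (d : IsDecomp (openFace K T) (openFace K T ∪ openFace K T') (openFace K T')) :
    A.canonOn h hA σ hT n m hm =
      A.hres h hA n r ≫ A.canonOn h hA (σ.face (Fin.last (p + 1))) hT' n (m + 1) hm' ≫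
        A.hbdry h hA (m + 1) m rfl d := by
  subst hT hT'
  have r₁ : RelClosed {σ.pt} (σ.face (Fin.last (p + 1))).cell := by
    rw [← σ.pt_face_last]
    exact (σ.face (Fin.last (p + 1))).pt_relClosed
  have h1 := A.hres_chain h hA (σ.face (Fin.last (p + 1))) σ.pt_face_last r₁ n (m + 1) hm'
  have h2 : A.hres h hA n r ≫ A.hres h hA n r₁ = A.hres h hA n σ.pt_relClosed :=
    A.hres_trans h hA n r r₁ σ.pt_relClosed
  change A.hres h hA n σ.pt_relClosed ≫ A.chain h hA σ.pt _ _ _ n (m + 1) _ ≫ _ =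
    A.hres h hA n r ≫ A.canon h hA (σ.face (Fin.last (p + 1))) n (m + 1) hm' ≫ _
  rw [← h1, ← h2]
  exact (Category.assoc _ _ _).trans
    (congrArg (A.hres h hA n r ≫ ·) (Category.assoc _ _ _).symm)

end C0Algebra

end CStarFib

/-! ### The sign rule for reordering the vertices. -/

namespace CStarFib

namespace OrderedSimplex

open Realization

variable {V : Type w} {K : AbstractSimplicialComplex V}

theorem face_last_vert {p : ℕ} (σ : OrderedSimplex K (p + 1)) (i : Fin (p + 1)) :
    (σ.face (Fin.last (p + 1))).vert i = σ.vert i.castSucc := by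
  rw [face_vert, Fin.succAbove_last]

/-- An adjacent transposition that fixes the last vertex descends to the last face, where the
induction hypothesis applies. -/
theorem face_perm_swap {p : ℕ} (σ : OrderedSimplex K (p + 2)) (j : Fin (p + 1)) :
    (σ.perm (Equiv.swap j.castSucc.castSucc j.castSucc.succ)).face (Fin.last (p + 2)) =
      (σ.face (Fin.last (p + 2))).perm (Equiv.swap j.castSucc j.succ) := by
  refine eq_of_vert fun i => ?_
  rw [face_last_vert, perm_vert, perm_vert, face_last_vert, Fin.succ_castSucc,
    (Fin.castSucc_injective _).swap_apply]

/-- The permuted simplex in which the last two vertices are exchanged. -/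
abbrev swapLast {p : ℕ} (σ : OrderedSimplex K (p + 1)) : OrderedSimplex K (p + 1) :=
  σ.perm (Equiv.swap (Fin.last p).castSucc (Fin.last p).succ)

theorem swapLast_vert_castSucc_last {p : ℕ} (σ : OrderedSimplex K (p + 1)) :
    σ.swapLast.vert (Fin.last p).castSucc = σ.vert (Fin.last (p + 1)) := by
  rw [perm_vert, Fin.succ_last, Equiv.swap_apply_left]

theorem face_face_swapLast {p : ℕ} (σ : OrderedSimplex K (p + 2)) :
    (σ.swapLast.face (Fin.last (p + 2))).face (Fin.last (p + 1)) =
      (σ.face (Fin.last (p + 2))).face (Fin.last (p + 1)) := by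
  refine eq_of_vert fun i => ?_
  rw [face_last_vert, face_last_vert, face_last_vert, face_last_vert, perm_vert,
    Equiv.swap_apply_of_ne_of_ne]
  · intro he
    exact (Fin.castSucc_lt_last i).ne (Fin.castSucc_injective _ he)
  · rw [Fin.succ_last]
    exact (Fin.castSucc_lt_last _).ne

theorem verts_zero (σ : OrderedSimplex K 0) : σ.verts = {σ.vert (Fin.last 0)} := rfl

theorem openFace_decomp_last [DecidableEq V] {p : ℕ} (σ : OrderedSimplex K (p + 1))
    {T T' : Finset V} (hT : σ.verts = T) (hT' : (σ.face (Fin.last (p + 1))).verts = T') :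
    IsDecomp (openFace K T) (openFace K T ∪ openFace K T') (openFace K T') := by
  subst hT hT'
  exact openFace_decomp (σ.notMem_face _) (σ.verts_eq_insert _)

theorem closedFace_relClosed_last {p : ℕ} (σ : OrderedSimplex K (p + 1)) {T T' : Finset V}
    (hT : σ.verts = T) (hT' : (σ.face (Fin.last (p + 1))).verts = T') :
    RelClosed (closedFace K T') (closedFace K T) := by
  classical
  subst hT hT'
  refine closedFace_relClosed ?_
  rw [← σ.verts_eq_insert (Fin.last (p + 1))]
  exact Finset.subset_insert _ _

theorem openFace_relClosed_of_zero (σ : OrderedSimplex K 0) {T : Finset V} (hT : σ.verts = T) :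
    RelClosed (openFace K T) (closedFace K T) := by
  subst hT
  change RelClosed σ.openCell σ.cell
  rw [σ.openCell_zero]
  exact σ.pt_relClosed

end OrderedSimplex

namespace C0Algebra

open Realization OrderedSimplex

variable {V : Type w} {K : AbstractSimplicialComplex V} [LocallyCompactSpace (Realization K)]
  (A : C0Algebra.{u} (Realization K))
  {C : GoodSubcategory.{u}} (h : HomologyTheory.{u, v} C) (hA : C.prop A.alg)

theorem canonOn_swapLast_edge (σ : OrderedSimplex K (0 + 1)) {T : Finset V} (hT : σ.verts = T)
    (hT' : σ.swapLast.verts = T) (n m : ℤ) (hm : m + ((0 + 1 : ℕ) : ℤ) = n) :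
    A.canonOn h hA σ hT n m hm + A.canonOn h hA σ.swapLast hT' n m hm = 0 := by
  classical
  have hne : σ.vert (Fin.last 0).castSucc ≠ σ.vert (Fin.last (0 + 1)) := fun he =>
    (Fin.castSucc_lt_last (Fin.last 0)).ne (σ.vert.injective he)
  obtain ⟨T₁, hT₁⟩ : ∃ T₁, (σ.face (Fin.last (0 + 1))).verts = T₁ := ⟨_, rfl⟩
  obtain ⟨T₂, hT₂⟩ : ∃ T₂, (σ.swapLast.face (Fin.last (0 + 1))).verts = T₂ := ⟨_, rfl⟩
  have r₁ := σ.closedFace_relClosed_last hT hT₁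
  have r₂ := σ.swapLast.closedFace_relClosed_last hT' hT₂
  have d₁ := σ.openFace_decomp_last hT hT₁
  have d₂ := σ.swapLast.openFace_decomp_last hT' hT₂
  have z₁ := openFace_relClosed_of_zero (σ.face (Fin.last (0 + 1))) hT₁
  have z₂ := openFace_relClosed_of_zero (σ.swapLast.face (Fin.last (0 + 1))) hT₂
  have hv : {σ.vert (Fin.last 0).castSucc} = T₁ := by
    rw [← hT₁, verts_zero, face_last_vert]
  have hw : {σ.vert (Fin.last (0 + 1))} = T₂ := by
    rw [← hT₂, verts_zero, face_last_vert, swapLast_vert_castSucc_last]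
  have hvw : {σ.vert (Fin.last 0).castSucc, σ.vert (Fin.last (0 + 1))} = T := by
    rw [← hT, ← σ.verts_eq_insert (Fin.last (0 + 1)), hT₁, ← hv, Finset.pair_comm]
  have hm' : m + 1 + ((0 : ℕ) : ℤ) = n := by push_cast at hm ⊢; linarith
  obtain ⟨hm₀, hn⟩ : m + 1 + ((0 : ℕ) : ℤ) = m + 1 ∧ n = m + 1 := by
    push_cast at hm' ⊢; constructor <;> linarith
  subst hn
  rw [A.canonOn_succ h hA σ hT hT₁ (m + 1) m hm hm₀ r₁ d₁,
    A.canonOn_succ h hA σ.swapLast hT' hT₂ (m + 1) m hm hm₀ r₂ d₂,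
    A.canonOn_zero h hA (σ.face (Fin.last (0 + 1))) hT₁ (m + 1) hm₀ z₁,
    A.canonOn_zero h hA (σ.swapLast.face (Fin.last (0 + 1))) hT₂ (m + 1) hm₀ z₂,
    ← Category.assoc, ← Category.assoc, A.hres_trans h hA _ r₁ z₁ (z₁.trans r₁),
    A.hres_trans h hA _ r₂ z₂ (z₂.trans r₂)]
  exact A.hres_hbdry_edge_add_eq_zero h hA hne hv hw hvw m (z₁.trans r₁) (z₂.trans r₂) d₁ d₂

/-- Unfold the recursion twice. Both orders reach the same face `ρ` of codimension two and return
through different facets, so the two iterated connecting maps are opposite by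
`hbdry_hbdry_add_eq_zero`. -/
theorem canonOn_swapLast_succ {p : ℕ} (σ : OrderedSimplex K (p + 1 + 1)) {T : Finset V}
    (hT : σ.verts = T) (hT' : σ.swapLast.verts = T) (n m : ℤ) (hm : m + ((p + 1 + 1 : ℕ) : ℤ) = n) :
    A.canonOn h hA σ hT n m hm + A.canonOn h hA σ.swapLast hT' n m hm = 0 := by
  classical
  have hne : σ.vert (Fin.last (p + 1)).castSucc ≠ σ.vert (Fin.last (p + 1 + 1)) := fun he =>
    (Fin.castSucc_lt_last (Fin.last (p + 1))).ne (σ.vert.injective he)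
  have r₁ := σ.closedFace_relClosed_last hT rfl
  have r₂ := σ.swapLast.closedFace_relClosed_last hT' rfl
  have d₁ := σ.openFace_decomp_last hT rfl
  have d₂ := σ.swapLast.openFace_decomp_last hT' rfl
  have hm' : m + 1 + ((p + 1 : ℕ) : ℤ) = n := by push_cast at hm ⊢; linarith
  rw [A.canonOn_succ h hA σ hT rfl n m hm hm' r₁ d₁,
    A.canonOn_succ h hA σ.swapLast hT' rfl n m hm hm' r₂ d₂]
  have hm'' : m + 1 + 1 + (p : ℤ) = n := by push_cast at hm; linarith
  obtain ⟨ρ, hρ₁⟩ : ∃ ρ, (σ.face (Fin.last (p + 2))).face (Fin.last (p + 1)) = ρ := ⟨_, rfl⟩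
  have hρ₂ : (σ.swapLast.face (Fin.last (p + 2))).face (Fin.last (p + 1)) = ρ :=
    σ.face_face_swapLast.trans hρ₁
  have v₁ := congrArg verts hρ₁
  have v₂ := congrArg verts hρ₂
  have s₁ := closedFace_relClosed_last (σ.face (Fin.last (p + 2))) rfl v₁
  have s₂ := closedFace_relClosed_last (σ.swapLast.face (Fin.last (p + 2))) rfl v₂
  have e₁ := openFace_decomp_last (σ.face (Fin.last (p + 2))) rfl v₁
  have e₂ := openFace_decomp_last (σ.swapLast.face (Fin.last (p + 2))) rfl v₂
  have hc : ∀ (ρ' : OrderedSimplex K p) (he : ρ' = ρ) (hv : ρ'.verts = ρ.verts),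
      A.canonOn h hA ρ' hv n (m + 1 + 1) hm'' = A.canonOn h hA ρ rfl n (m + 1 + 1) hm'' := by
    rintro _ rfl _
    rfl
  rw [A.canonOn_succ h hA (σ.face (Fin.last (p + 2))) rfl v₁ n (m + 1) hm' hm'' s₁ e₁,
    A.canonOn_succ h hA (σ.swapLast.face (Fin.last (p + 2))) rfl v₂ n (m + 1) hm' hm'' s₂ e₂,
    hc _ hρ₁ v₁, hc _ hρ₂ v₂]
  -- Both composites restrict directly from the closed simplex to the closed face of `ρ`, so this
  -- common factor can be taken out of the sum.
  have hr : A.hres h hA n r₂ ≫ A.hres h hA n s₂ = A.hres h hA n r₁ ≫ A.hres h hA n s₁ := by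
    rw [A.hres_trans h hA n r₂ s₂ (s₂.trans r₂), A.hres_trans h hA n r₁ s₁ (s₂.trans r₂)]
  have key := A.hbdry_hbdry_add_eq_zero h hA (S := ρ.verts) (T := T)
    (v := σ.vert (Fin.last (p + 1)).castSucc) (w := σ.vert (Fin.last (p + 2)))
    (T₁ := (σ.face (Fin.last (p + 2))).verts)
    (T₂ := (σ.swapLast.face (Fin.last (p + 2))).verts) ?_ ?_ hne ?_ ?_ ?_ m d₁ d₂ e₁ e₂
  · calc _ = (A.hres h hA n r₁ ≫ A.hres h hA n s₁) ≫ A.canonOn h hA ρ rfl n (m + 1 + 1) hm'' ≫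
          (A.hbdry h hA (m + 1 + 1) (m + 1) rfl e₁ ≫ A.hbdry h hA (m + 1) m rfl d₁ +
            A.hbdry h hA (m + 1 + 1) (m + 1) rfl e₂ ≫ A.hbdry h hA (m + 1) m rfl d₂) := by
          simp only [Preadditive.comp_add]
          nth_rewrite 2 [← hr]
          simp only [Category.assoc]
      _ = 0 := by rw [key, Limits.comp_zero, Limits.comp_zero]
  · have := (σ.face (Fin.last (p + 2))).notMem_face (Fin.last (p + 1))
    rwa [face_last_vert, hρ₁] at this
  · have := (σ.swapLast.face (Fin.last (p + 2))).notMem_face (Fin.last (p + 1))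
    rw [face_last_vert, swapLast_vert_castSucc_last, hρ₂] at this
    exact this
  · rw [← (σ.face (Fin.last (p + 2))).verts_eq_insert (Fin.last (p + 1)), face_last_vert, hρ₁]
  · rw [← (σ.swapLast.face (Fin.last (p + 2))).verts_eq_insert (Fin.last (p + 1)), face_last_vert,
      swapLast_vert_castSucc_last, hρ₂]
  · rw [σ.verts_eq_insert, hT]

theorem canonOn_swapLast {p : ℕ} (σ : OrderedSimplex K (p + 1)) {T : Finset V} (hT : σ.verts = T)
    (hT' : σ.swapLast.verts = T) (n m : ℤ) (hm : m + ((p + 1 : ℕ) : ℤ) = n) :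
    A.canonOn h hA σ hT n m hm + A.canonOn h hA σ.swapLast hT' n m hm = 0 := by
  cases p with
  | zero => exact A.canonOn_swapLast_edge h hA σ hT hT' n m hm
  | succ p => exact A.canonOn_swapLast_succ h hA σ hT hT' n m hm

/-- A permutation of the vertices changes the canonical oriented map by its sign. -/
theorem canonOn_perm {p : ℕ} (π : Equiv.Perm (Fin (p + 1))) (σ : OrderedSimplex K p) {T : Finset V}
    (hT : σ.verts = T) (hT' : (σ.perm π).verts = T) (n m : ℤ) (hm : m + (p : ℤ) = n) :
    A.canonOn h hA (σ.perm π) hT' n m hm =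
      (Equiv.Perm.sign π : ℤ) • A.canonOn h hA σ hT n m hm := by
  induction p generalizing T n m with
  | zero =>
    obtain rfl : π = 1 := Equiv.ext fun i => Subsingleton.elim (α := Fin 1) _ _
    simp only [perm_one, Equiv.Perm.sign_one, Units.val_one, one_smul]
  | succ p ih =>
    -- Adjacent transpositions generate the symmetric group as a monoid, so it suffices to treat
    -- these and products.
    have hπ : π ∈ Submonoid.closure
        (Set.range fun i : Fin (p + 1) => Equiv.swap i.castSucc i.succ) := by
      rw [Equiv.Perm.mclosure_swap_castSucc_succ]
      trivial
    induction hπ using Submonoid.closure_induction generalizing σ T n m with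
    | one => simp only [perm_one, Equiv.Perm.sign_one, Units.val_one, one_smul]
    | mul π ρ _ _ h₁ h₂ =>
      have hT₁ : (σ.perm π).verts = T := (verts_perm _ _).trans hT
      have hT₂ : ((σ.perm π).perm ρ).verts = T := (verts_perm _ _).trans hT₁
      rw [Equiv.Perm.sign_mul, Units.val_mul, mul_comm, mul_smul, ← h₁ σ hT hT₁ n m hm,
        ← h₂ (σ.perm π) hT₁ hT₂ n m hm]
      rfl
    | mem π hπ =>
      obtain ⟨i, rfl⟩ := hπ
      rw [Equiv.Perm.sign_swap (Fin.castSucc_lt_succ).ne]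
      induction i using Fin.lastCases with
      | last =>
        rw [Units.val_neg, Units.val_one, neg_smul, one_smul]
        exact eq_neg_of_add_eq_zero_right (A.canonOn_swapLast h hA σ hT hT' n m hm)
      -- This transposition leaves the last vertex in place, so it permutes only the last face, and
      -- the sign comes from the lower dimension.
      | cast j =>
        cases p with
        | zero => exact j.elim0
        | succ p =>
          classical
          have hm' : m + 1 + ((p + 1 : ℕ) : ℤ) = n := by push_cast at hm ⊢; linarith
          let τ := σ.face (Fin.last (p + 2))
          have hj := σ.face_perm_swap j
          have hv : ((σ.perm (Equiv.swap j.castSucc.castSucc j.castSucc.succ)).face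
              (Fin.last (p + 2))).verts = τ.verts := by rw [hj, verts_perm]
          have r := σ.closedFace_relClosed_last hT (T' := τ.verts) rfl
          have d := σ.openFace_decomp_last hT (T' := τ.verts) rfl
          have hc : A.canonOn h hA ((σ.perm (Equiv.swap j.castSucc.castSucc j.castSucc.succ)).face
              (Fin.last (p + 2))) hv n (m + 1) hm' =
              A.canonOn h hA (τ.perm (Equiv.swap j.castSucc j.succ)) (verts_perm _ _) n (m + 1)
                hm' := by
            congr
          rw [A.canonOn_succ h hA _ hT' hv n m hm hm' r d, hc,
            ih (Equiv.swap j.castSucc j.succ) τ rfl (verts_perm _ _) n (m + 1) hm',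
            Equiv.Perm.sign_swap (Fin.castSucc_lt_succ).ne,
            A.canonOn_succ h hA σ hT (T' := τ.verts) rfl n m hm hm' r d,
            Preadditive.zsmul_comp, Preadditive.comp_zsmul]

end C0Algebra

end CStarFib

/-! ### Section maps between disjoint sets, and the combinatorics of faces. -/

namespace CStarFib

namespace C0Algebra

variable {X : Type w} [TopologicalSpace X] (A : C0Algebra.{u} X)
  {C : GoodSubcategory.{u}} {h : HomologyTheory.{u, v} C} {hA : C.prop A.alg}
  [T2Space X] [LocallyCompactSpace X]

/-- The empty set is the complement of the whole space in itself, and the restriction there is the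
identity. -/
theorem acyclic_empty : A.Acyclic h hA ∅ := by
  have d : IsDecomp (∅ : Set X) Set.univ Set.univ :=
    ⟨isClosed_univ.isLocallyClosed, .of_isClosed isClosed_univ subset_rfl,
      Set.sdiff_self.symm⟩
  refine A.acyclic_of_isIso_hres d fun n => ?_
  have h1 : A.hres h hA n d.relClosed = 𝟙 _ := by
    rw [← A.hmap_id h hA n Set.univ]
    exact congrArg (A.hmap h hA n) ((A.isSectionMap_res _).unique A (A.isSectionMap_id _))
  rw [h1]
  infer_instance

/-- By uniqueness, a section map between disjoint sets factors through the sections over the empty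
set. -/
theorem hmap_eq_zero {W W' : Set X} (hW' : IsLocallyClosed W') (hd : Disjoint W W')
    {f : A.restr W →⋆ₙₐ[ℂ] A.restr W'} (hf : A.IsSectionMap f) (n : ℤ) :
    A.hmap h hA n f = 0 := by
  have r : RelClosed ∅ W := .of_isClosed isClosed_empty (Set.empty_subset _)
  have d : IsDecomp ∅ W' W' :=
    ⟨hW', ⟨subset_rfl, Set.inter_subset_right⟩, Set.sdiff_self.symm⟩
  rw [← A.hmap_comp_unique h hA n (A.isSectionMap_res r) (A.isSectionMap_ext d) hf
    (Set.disjoint_iff.1 hd)]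
  ext x
  have := A.acyclic_empty (h := h) (hA := hA) n
  change A.hmap h hA n (A.ext d) (A.hmap h hA n (A.res r) x) = 0
  rw [Subsingleton.elim (A.hmap h hA n (A.res r) x) 0, map_zero]

end C0Algebra

namespace OrderedSimplex

open Realization

variable {V : Type w} {K : AbstractSimplicialComplex V}

theorem verts_subset_of_cell_subset {p q : ℕ} {σ : OrderedSimplex K p} {τ : OrderedSimplex K q}
    (h : σ.cell ⊆ τ.cell) : σ.verts ⊆ τ.verts := by
  intro v hv
  let e : Fin (0 + 1) ↪ V := ⟨fun _ => v, fun i j _ => Subsingleton.elim (α := Fin 1) i j⟩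
  have hm : Finset.univ.map e = {v} := rfl
  let ρ : OrderedSimplex K 0 := ⟨e, hm.symm ▸ K.singleton_mem v⟩
  have hs : ρ.pt.coord.support = {v} := Finsupp.support_single _ one_ne_zero
  have h1 : ρ.pt ∈ τ.cell := h (by
    change ρ.pt.coord.support ⊆ σ.verts
    rw [hs]
    exact Finset.singleton_subset_iff.2 hv)
  have h2 : ρ.pt.coord.support ⊆ τ.verts := h1
  rw [hs] at h2
  exact Finset.singleton_subset_iff.1 h2

/-- By counting, exactly one vertex of `σ` is missing from `τ`; its position is `l`. -/
theorem exists_cell_eq_face {p : ℕ} (σ : OrderedSimplex K (p + 1)) (τ : OrderedSimplex K p)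
    (h : τ.verts ⊆ σ.verts) : ∃ l, τ.cell = (σ.face l).cell := by
  classical
  obtain ⟨v, hv, hvτ⟩ := Finset.exists_mem_notMem_of_card_lt_card
    (s := τ.verts) (t := σ.verts) (by rw [card_verts, card_verts]; omega)
  obtain ⟨l, -, rfl⟩ := Finset.mem_map.1 hv
  refine ⟨l, ?_⟩
  have h1 : τ.verts = (σ.face l).verts := by
    refine Finset.eq_of_subset_of_card_le ?_ (by rw [card_verts, card_verts])
    rw [verts_face]
    exact fun w hw => Finset.mem_erase.2 ⟨fun h => hvτ (h ▸ hw), h hw⟩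
  exact congrArg (closedFace K) h1

theorem exists_perm_of_verts_eq {p : ℕ} {σ τ : OrderedSimplex K p} (h : τ.verts = σ.verts) :
    ∃ π, τ = σ.perm π := by
  have h1 : ∀ i, ∃ j, σ.vert j = τ.vert i := fun i => by
    have hi : τ.vert i ∈ σ.verts := h ▸ Finset.mem_map_of_mem _ (Finset.mem_univ i)
    obtain ⟨j, -, hj⟩ := Finset.mem_map.1 hi
    exact ⟨j, hj⟩
  choose f hf using h1
  have hinj : Function.Injective f := fun i j hij =>
    τ.vert.injective (by rw [← hf i, ← hf j, hij])
  refine ⟨Equiv.ofBijective f (Finite.injective_iff_bijective.1 hinj), eq_of_vert fun i => ?_⟩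
  exact (hf i).symm

/-- Turns the geometric condition that defines `φ` into an equation between ordered simplices. -/
theorem toMap_comp_map {p : ℕ} (σ : OrderedSimplex K p) (π : Equiv.Perm (Fin (p + 1))) :
    σ.toMap ∘ stdSimplex.map π = (σ.perm π).toMap := by
  funext t
  refine Realization.ext (Finsupp.ext fun v => ?_)
  by_cases hv : v ∈ Set.range σ.vert
  · obtain ⟨i, rfl⟩ := hv
    obtain ⟨j, rfl⟩ := π.surjective i
    have h1 : ((σ.perm π).toMap t).coord (σ.vert (π j)) = t j := (σ.perm π).toMap_vert t j
    rw [h1, Function.comp_apply, toMap_vert, stdSimplex.map_coe]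
    classical
    rw [FunOnFinite.linearMap_apply_apply]
    rw [Finset.sum_eq_single j]
    · intro b hb hbj
      exact (hbj (π.injective (by simpa using hb))).elim
    · intro hj
      simp at hj
  · rw [Function.comp_apply, toMap_of_notMem _ _ hv, toMap_of_notMem]
    rintro ⟨i, rfl⟩
    exact hv ⟨π i, rfl⟩

theorem toMap_eq_iff {p : ℕ} {σ τ : OrderedSimplex K p} : σ.toMap = τ.toMap ↔ σ = τ := by
  refine ⟨fun h => eq_of_vert fun i => ?_, fun h => h ▸ rfl⟩
  classical
  have h1 := congrArg (fun x : Realization K => x.coord (σ.vert i))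
    (congrFun h (stdSimplex.vertex i))
  simp only [toMap_vert] at h1
  have h2 : (stdSimplex.vertex i : Simplex p) i = (1 : ℝ) := by simp
  rw [h2] at h1
  by_cases hv : σ.vert i ∈ Set.range τ.vert
  · obtain ⟨j, hj⟩ := hv
    rw [← hj, toMap_vert] at h1
    by_cases hij : j = i
    · rw [← hj, hij]
    · have h3 : (stdSimplex.vertex i : Simplex p) j = (0 : ℝ) := by simp [hij]
      rw [h3] at h1
      exact (one_ne_zero h1).elim
  · rw [toMap_of_notMem _ _ hv] at h1
    exact (one_ne_zero h1).elim

theorem perm_injective {p : ℕ} (σ : OrderedSimplex K p) : Function.Injective σ.perm := by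
  intro π ρ h
  refine Equiv.ext fun i => σ.vert.injective ?_
  rw [← perm_vert, ← perm_vert, h]

/-- The permutation that moves the `l`-th vertex to the end. -/
def moveLast {p : ℕ} (l : Fin (p + 2)) : Equiv.Perm (Fin (p + 2)) :=
  l.cycleRange.symm * finRotate (p + 2)

theorem sign_moveLast {p : ℕ} (l : Fin (p + 2)) :
    (Equiv.Perm.sign (moveLast l) : ℤ) = (-1) ^ (p + 1 - (l : ℕ)) := by
  -- The two cycles have signs `(-1) ^ l` and `(-1) ^ (p + 1)`. Splitting the second exponent makes
  -- `(-1) ^ l` occur twice and cancel.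
  have h1 : p + 1 = (p + 1 - (l : ℕ)) + l := by have := l.2; omega
  rw [moveLast, Equiv.Perm.sign_mul, Equiv.Perm.sign_symm, Fin.sign_cycleRange, sign_finRotate]
  change (((-1 : ℤˣ) ^ (l : ℕ) * (-1) ^ (p + 1) : ℤˣ) : ℤ) = _
  conv_lhs => rw [h1]
  push_cast
  rw [pow_add, mul_comm ((-1 : ℤ) ^ (p + 1 - (l : ℕ))), ← mul_assoc, ← pow_add, ← two_mul,
    pow_mul]
  simp

theorem face_last_perm_moveLast {p : ℕ} (σ : OrderedSimplex K (p + 1)) (l : Fin (p + 2)) :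
    (σ.perm (moveLast l)).face (Fin.last (p + 1)) = σ.face l := by
  refine eq_of_vert fun i => ?_
  rw [face_last_vert, perm_vert, face_vert]
  congr 1
  change l.cycleRange.symm (finRotate (p + 2) i.castSucc) = l.succAbove i
  rw [finRotate_apply, Fin.coeSucc_eq_succ, Fin.cycleRange_symm_succ]

end OrderedSimplex

end CStarFib

/-! ### The skeletal differential between two cells. -/

namespace CStarFib

namespace OrderedSimplex

open Realization

variable {V : Type w} {K : AbstractSimplicialComplex V}

/-- The boundary of the closed cell of a simplex. -/
def bdryCell {p : ℕ} (σ : OrderedSimplex K (p + 1)) : Set (Realization K) := σ.cell ∩ skel K p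

theorem mem_cell {p : ℕ} {σ : OrderedSimplex K p} {x : Realization K} :
    x ∈ σ.cell ↔ x.coord.support ⊆ σ.verts := Iff.rfl

theorem mem_openCell {p : ℕ} {σ : OrderedSimplex K p} {x : Realization K} :
    x ∈ σ.openCell ↔ x.coord.support = σ.verts := Iff.rfl

theorem mem_bdryCell {p : ℕ} {σ : OrderedSimplex K (p + 1)} {x : Realization K} :
    x ∈ σ.bdryCell ↔ x.coord.support ⊂ σ.verts := by
  have h1 : x ∈ skel K p ↔ x.coord.support.card ≤ p + 1 := by
    change (x.coord.support.card : ℤ) ≤ p + 1 ↔ _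
    norm_cast
  have h2 := σ.card_verts
  rw [bdryCell, Set.mem_inter_iff, mem_cell, h1]
  refine ⟨fun h => h.1.ssubset_of_ne fun he => ?_, fun h => ⟨h.subset, ?_⟩⟩
  · have := h.2
    rw [he, h2] at this
    omega
  · have := Finset.card_lt_card h
    omega

theorem isClosed_bdryCell {p : ℕ} (σ : OrderedSimplex K (p + 1)) : IsClosed σ.bdryCell :=
  σ.isClosed_cell.inter (isClosed_skel _)

theorem bdryCell_decomp {p : ℕ} (σ : OrderedSimplex K (p + 1)) :
    IsDecomp σ.openCell σ.cell σ.bdryCell := by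
  refine ⟨σ.isClosed_cell.isLocallyClosed, .of_isClosed σ.isClosed_bdryCell Set.inter_subset_left,
    ?_⟩
  ext x
  rw [Set.mem_sdiff, mem_openCell, mem_cell, mem_bdryCell]
  exact ⟨fun h => ⟨h.subset, fun h' => h'.ne h⟩,
    fun h => by_contra fun h' => h.2 (h.1.ssubset_of_ne h')⟩

theorem cell_relClosed_skel {p : ℕ} (σ : OrderedSimplex K (p + 1)) {n : ℤ} (hn : n = p + 1) :
    RelClosed σ.cell (skel K n) := by
  refine .of_isClosed σ.isClosed_cell fun x hx => ?_
  have h1 := Finset.card_le_card (mem_cell.1 hx)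
  rw [card_verts] at h1
  change (x.coord.support.card : ℤ) ≤ n + 1
  omega

theorem bdryCell_relClosed_skel {p : ℕ} (σ : OrderedSimplex K (p + 1)) :
    RelClosed σ.bdryCell (skel K p) := .of_isClosed σ.isClosed_bdryCell Set.inter_subset_right

/-- Within the closed cell, the half-open cell is the set where no coordinate at a vertex of `τ`
vanishes: by cardinality, such a support is that of `τ` or of `σ`. -/
theorem halfOpen_decomp_cell {p : ℕ} (σ : OrderedSimplex K (p + 1)) (τ : OrderedSimplex K p)
    (hτ : τ.verts ⊂ σ.verts) :
    IsDecomp (σ.openCell ∪ τ.openCell) σ.cell (σ.cell \ (σ.openCell ∪ τ.openCell)) := by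
  have h2 := σ.card_verts
  have h3 := τ.card_verts
  refine ⟨σ.isClosed_cell.isLocallyClosed,
    RelClosed.inter_isClosed (isClosed_not_subset τ.verts) ?_, ?_⟩
  · ext x
    simp only [Set.mem_inter_iff, Set.mem_sdiff, Set.mem_union, mem_cell, mem_openCell,
      Set.mem_ofPred_eq]
    refine and_congr_right fun h => not_congr ⟨fun h' => ?_, ?_⟩
    · by_cases he : x.coord.support = σ.verts
      · exact Or.inl he
      · right
        refine (Finset.eq_of_subset_of_card_le h' ?_).symm
        have := Finset.card_lt_card (h.ssubset_of_ne he)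
        omega
    · rintro (h' | h')
      · rw [h']; exact hτ.subset
      · exact h'.symm.subset
  · rw [Set.sdiff_sdiff_right_self, eq_comm, Set.inter_eq_right]
    rintro x (hx | hx)
    · exact (mem_openCell.1 hx).subset
    · rw [mem_cell, mem_openCell.1 hx]
      exact hτ.subset

end OrderedSimplex

namespace C0Algebra

open Realization OrderedSimplex

variable {V : Type w} {K : AbstractSimplicialComplex V} [LocallyCompactSpace (Realization K)]
  (A : C0Algebra.{u} (Realization K))
  {C : GoodSubcategory.{u}} (h : HomologyTheory.{u, v} C) (hA : C.prop A.alg)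

/-- The section map from an open cell of dimension `p` to the boundary of a cell of dimension
`p + 1` through which the `d₁`-differential factors. -/
theorem exists_cell_component_eq {p : ℕ} (σ : OrderedSimplex K (p + 1)) (τ : OrderedSimplex K p)
    (q : ℤ) {a c : ℤ} (hac : a + 1 = p) (hc : (p : ℤ) + 1 = c)
    (eτ : IsDecomp τ.openCell (skel K p \ skel K a) ((skel K p \ skel K a) \ τ.openCell))
    (rσ : RelClosed σ.openCell (skel K c \ skel K p)) :
    ∃ f : A.restr τ.openCell →⋆ₙₐ[ℂ] A.restr σ.bdryCell, A.IsSectionMap f ∧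
      A.hext h hA (q + 1) eτ ≫ A.d₁ h hA a p c hac hc q ≫ A.hres h hA q rσ =
        A.hmap h hA (q + 1) f ≫ A.hbdry h hA (q + 1) q rfl σ.bdryCell_decomp := by
  have eskel : IsDecomp (skel K p \ skel K a) (skel K p) (skel K a) :=
    skel_decomp (by omega)
  have dskel : IsDecomp (skel K c \ skel K p) (skel K c) (skel K p) := skel_decomp (by omega)
  -- Restriction to the closed cell maps the sequence of the two skeletons to that of the cell and
  -- its boundary. The required section map is thus extension by zero to the skeleton, followed by
  -- restriction to the boundary.
  have h1 := A.hbdry_natural (h := h) (hA := hA) dskel σ.bdryCell_decomp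
    (A.isSectionMap_res rσ) (A.isSectionMap_res (σ.cell_relClosed_skel hc.symm))
    (A.isSectionMap_res σ.bdryCell_relClosed_skel)
    (fun x hx => by
      rw [σ.bdryCell_decomp.diff_eq]
      exact ⟨hx.2, fun hx' => hx.1.2 hx'.2⟩)
    (fun x hx => hx.2.2) (q + 1) q rfl
  refine ⟨((A.res σ.bdryCell_relClosed_skel).comp (A.ext eskel)).comp (A.ext eτ), ?_, ?_⟩
  · refine ((A.isSectionMap_res _).comp A (A.isSectionMap_ext eskel) ?_).comp A
      (A.isSectionMap_ext eτ) ?_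
    · exact fun x hx => hx.2.2
    · exact fun x hx => eτ.subset hx.1
  · rw [← A.hmap_comp, ← A.hmap_comp, Category.assoc, Category.assoc, h1]
    simp only [d₁, Category.assoc]
    rfl

/-- The component factors through the boundary of `σ`, which is disjoint from the open cell of `τ`.
-/
theorem cell_component_eq_zero {p : ℕ} (σ : OrderedSimplex K (p + 1)) (τ : OrderedSimplex K p)
    (hτ : ¬ τ.verts ⊆ σ.verts) (q : ℤ) {a c : ℤ} (hac : a + 1 = p) (hc : (p : ℤ) + 1 = c)
    (eτ : IsDecomp τ.openCell (skel K p \ skel K a) ((skel K p \ skel K a) \ τ.openCell))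
    (rσ : RelClosed σ.openCell (skel K c \ skel K p)) :
    A.hext h hA (q + 1) eτ ≫ A.d₁ h hA a p c hac hc q ≫ A.hres h hA q rσ = 0 := by
  obtain ⟨f, hf, he⟩ := A.exists_cell_component_eq h hA σ τ q hac hc eτ rσ
  rw [he, A.hmap_eq_zero σ.isClosed_bdryCell.isLocallyClosed ?_ hf, Limits.zero_comp]
  rw [Set.disjoint_left]
  intro x hx hx'
  exact hτ (mem_openCell.1 hx ▸ (mem_bdryCell.1 hx').subset)

/-- Extension by zero from the half-open cell to the closed cell is a map of exact sequences that is
the identity on the open cell of `σ`. By uniqueness, its part on the open cell of `τ` is the section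
map found above. -/
theorem cell_component_eq_hbdry {p : ℕ} (σ : OrderedSimplex K (p + 1)) (τ : OrderedSimplex K p)
    (hτ : τ.verts ⊂ σ.verts) (q : ℤ) {a c : ℤ} (hac : a + 1 = p) (hc : (p : ℤ) + 1 = c)
    (eτ : IsDecomp τ.openCell (skel K p \ skel K a) ((skel K p \ skel K a) \ τ.openCell))
    (rσ : RelClosed σ.openCell (skel K c \ skel K p))
    (d : IsDecomp σ.openCell (σ.openCell ∪ τ.openCell) τ.openCell) :
    A.hext h hA (q + 1) eτ ≫ A.d₁ h hA a p c hac hc q ≫ A.hres h hA q rσ =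
      A.hbdry h hA (q + 1) q rfl d := by
  obtain ⟨f, hf, he⟩ := A.exists_cell_component_eq h hA σ τ q hac hc eτ rσ
  rw [he, A.hbdry_natural d σ.bdryCell_decomp (A.isSectionMap_id _)
    (A.isSectionMap_ext (σ.halfOpen_decomp_cell τ hτ)) hf Set.inter_subset_left ?_ (q + 1) q rfl,
    hmap_id, Category.comp_id]
  rintro x ⟨hx | hx, hx'⟩
  · exact ((mem_bdryCell.1 hx').ne hx).elim
  · exact hx

end C0Algebra

end CStarFib

/-! ### The formula for the components of the differential. -/

namespace CStarFib

namespace C0Algebra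

open Realization OrderedSimplex

variable {V : Type w} {K : AbstractSimplicialComplex V} [LocallyCompactSpace (Realization K)]
  (A : C0Algebra.{u} (Realization K))
  {C : GoodSubcategory.{u}} {h : HomologyTheory.{u, v} C} {hA : C.prop A.alg}

/-- The canonical oriented map of `σ` through its `l`-th face. -/
theorem canonOn_eq_face {p : ℕ} (σ : OrderedSimplex K (p + 1)) (l : Fin (p + 2)) {T T' : Finset V}
    (hT : σ.verts = T) (hT' : (σ.face l).verts = T') (n m : ℤ) (hm : m + ((p + 1 : ℕ) : ℤ) = n)
    (hm' : m + 1 + (p : ℤ) = n) (r : RelClosed (closedFace K T') (closedFace K T))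
    (d : IsDecomp (openFace K T) (openFace K T ∪ openFace K T') (openFace K T')) :
    A.canonOn h hA σ hT n m hm = ((-1 : ℤ) ^ (p + 1 - (l : ℕ))) •
      (A.hres h hA n r ≫ A.canonOn h hA (σ.face l) hT' n (m + 1) hm' ≫
        A.hbdry h hA (m + 1) m rfl d) := by
  obtain ⟨τ, hτ⟩ : ∃ τ, σ.face l = τ := ⟨_, rfl⟩
  have hf : (σ.perm (moveLast l)).face (Fin.last (p + 1)) = τ :=
    (σ.face_last_perm_moveLast l).trans hτ
  have hT₁ : (σ.perm (moveLast l)).verts = T := (verts_perm _ _).trans hT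
  have hv : τ.verts = T' := hτ ▸ hT'
  have hv' : ((σ.perm (moveLast l)).face (Fin.last (p + 1))).verts = T' := hf ▸ hv
  have hc : ∀ (ρ : OrderedSimplex K p) (he : ρ = τ) (hρ : ρ.verts = T'),
      A.canonOn h hA ρ hρ n (m + 1) hm' = A.canonOn h hA τ hv n (m + 1) hm' := by
    rintro _ rfl _
    rfl
  -- Once the `l`-th vertex is moved to the end, the last face is the `l`-th face of `σ`. The sign
  -- of the move occurs on both sides and squares to one.
  have h1 := A.canonOn_perm h hA (moveLast l) σ hT hT₁ n m hm
  rw [sign_moveLast] at h1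
  rw [hc _ hτ hT', ← hc _ hf hv',
    ← A.canonOn_succ h hA (σ.perm (moveLast l)) hT₁ hv' n m hm hm' r d,
    h1, smul_smul, ← pow_add, ← two_mul, pow_mul]
  simp

theorem diff_eq_zero {p : ℕ} (σ : OrderedSimplex K (p + 1)) (τ : OrderedSimplex K p) (q : ℤ)
    [IsIso (A.canon h hA σ (q + (p + 1)) q (congrArg _ (Nat.cast_succ p)))]
    (hτ : ∀ l, τ.cell ≠ (σ.face l).cell) : A.diff h hA σ τ q = 0 := by
  have h1 : ¬ τ.verts ⊆ σ.verts := fun hs => by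
    obtain ⟨l, hl⟩ := σ.exists_cell_eq_face τ hs
    exact hτ l hl
  have h2 := A.cell_component_eq_zero h hA σ τ h1 q (a := (p : ℤ) - 1) (c := p + 1) (by ring) rfl
    (τ.openCell_decomp rfl (by ring))
    (σ.openCell_relClosed (by push_cast; rfl) (by push_cast; ring))
  rw [diff]
  rw [reassoc_of% h2, Limits.zero_comp, Limits.comp_zero]

theorem diff_eq_of_face {p : ℕ} (σ : OrderedSimplex K (p + 1)) (τ : OrderedSimplex K p) (q : ℤ)
    [IsIso (A.canon h hA σ (q + (p + 1)) q (congrArg _ (Nat.cast_succ p)))] (l : Fin (p + 2))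
    (π : Equiv.Perm (Fin (p + 1))) (hτ : τ = (σ.face l).perm π) (r : RelClosed τ.cell σ.cell)
    [IsIso (A.hres h hA (q + (p + 1)) r)] :
    A.diff h hA σ τ q = ((-1 : ℤ) ^ (p + 1 - (l : ℕ)) * (Equiv.Perm.sign π : ℤ)) •
      inv (A.hres h hA (q + (p + 1)) r) := by
  classical
  have hv : (σ.face l).verts = τ.verts := by rw [hτ, verts_perm]
  have hsub : τ.verts ⊂ σ.verts := by
    rw [← hv, ← σ.verts_eq_insert l]
    exact Finset.ssubset_insert (σ.notMem_face l)
  have d : IsDecomp σ.openCell (σ.openCell ∪ τ.openCell) τ.openCell := by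
    have := openFace_decomp (K := K) (σ.notMem_face l) (σ.verts_eq_insert l)
    change IsDecomp (openFace K σ.verts) (openFace K σ.verts ∪ openFace K τ.verts)
      (openFace K τ.verts)
    rw [← hv]
    exact this
  have h1 := A.cell_component_eq_hbdry h hA σ τ hsub q (a := (p : ℤ) - 1) (c := p + 1) (by ring) rfl
    (τ.openCell_decomp rfl (by ring))
    (σ.openCell_relClosed (by push_cast; rfl) (by push_cast; ring))
    d
  have hm' : q + 1 + (p : ℤ) = q + (p + 1) := by ring
  have hm : q + ((p + 1 : ℕ) : ℤ) = q + (p + 1) := by push_cast; ring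
  -- `κ` is the canonical oriented map of the `l`-th face, typed on the cells of `τ`. It enters
  -- `Φ_σ` with the sign of `l` and `Φ_τ` with the sign of `π`.
  obtain ⟨κ, h2, h3⟩ : ∃ κ : A.hgrp h hA (q + (p + 1)) τ.cell ⟶ A.hgrp h hA (q + 1) τ.openCell,
      A.canon h hA σ (q + (p + 1)) q hm = ((-1 : ℤ) ^ (p + 1 - (l : ℕ))) •
        (A.hres h hA _ r ≫ κ ≫ A.hbdry h hA (q + 1) q rfl d) ∧
      A.canon h hA τ (q + (p + 1)) (q + 1) hm' = (Equiv.Perm.sign π : ℤ) • κ := by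
    refine ⟨A.canonOn h hA (σ.face l) hv (q + (p + 1)) (q + 1) hm',
      A.canonOn_eq_face σ l rfl hv (q + (p + 1)) q hm hm' r d, ?_⟩
    have hp := A.canonOn_perm h hA π (σ.face l) hv ((verts_perm _ _).trans hv) _ _ hm'
    refine Eq.trans ?_ hp
    subst hτ
    rfl
  rw [diff]
  -- Compare after composing with `Φ_σ`: both sides become multiples of `κ` followed by the
  -- connecting map, and the power of `-1` from `l` appears twice on the right.
  rw [reassoc_of% h1, ← Category.assoc, IsIso.comp_inv_eq, h2, h3]
  rw [Preadditive.zsmul_comp, Preadditive.zsmul_comp, Preadditive.comp_zsmul,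
    IsIso.inv_hom_id_assoc, smul_smul, mul_right_comm, ← pow_add, ← two_mul, pow_mul]
  simp

end C0Algebra

end CStarFib

theorem proposition4p9 {C : CStarFib.GoodSubcategory.{u}} (h : CStarFib.HomologyTheory.{u, v} C)
    {V : Type w} (K : AbstractSimplicialComplex V)
    [LocallyCompactSpace (CStarFib.Realization K)]
    (hdim : ∃ d : ℕ, ∀ s ∈ K.faces, s.card ≤ d + 1)
    (A : CStarFib.C0Algebra.{u} (CStarFib.Realization K)) (hA : C.prop A.alg)
    (hfib : A.IsFibration h hA) {p : ℕ} (σ : CStarFib.OrderedSimplex K (p + 1))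
    (τ : CStarFib.OrderedSimplex K p) (q : ℤ) :
    ∃ _ : IsIso (A.canon h hA σ (q + (p + 1)) q (congrArg _ (Nat.cast_succ p))),
      IsIso (A.canon h hA τ (q + (p + 1)) (q + 1) (by ring)) ∧
      ((∀ l, τ.cell ≠ (σ.face l).cell) → A.diff h hA σ τ q = 0) ∧
      ∀ (l : Fin (p + 2)) (hl : τ.cell = (σ.face l).cell),
        ∃ _ : IsIso (A.hres h hA (q + (p + 1)) (σ.cell_relClosed τ l hl)),
        ∃ φ : Equiv.Perm (Fin (p + 1)),
          (∀ ψ : Equiv.Perm (Fin (p + 1)),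
            τ.toMap = (σ.face l).toMap ∘ stdSimplex.map ψ ↔ ψ = φ) ∧
          A.diff h hA σ τ q =
            ((-1 : ℤ) ^ (p + 1 - (l : ℕ)) * (Equiv.Perm.sign φ : ℤ)) •
              inv (A.hres h hA (q + (p + 1)) (σ.cell_relClosed τ l hl)) := by
  have hσ := A.isIso_canon hfib σ (q + (p + 1)) q (congrArg _ (Nat.cast_succ p))
  refine ⟨hσ, A.isIso_canon hfib τ _ _ _, A.diff_eq_zero σ τ q, fun l hl => ?_⟩
  have hv : τ.verts = (σ.face l).verts :=
    (CStarFib.OrderedSimplex.verts_subset_of_cell_subset hl.subset).antisymm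
      (CStarFib.OrderedSimplex.verts_subset_of_cell_subset hl.symm.subset)
  obtain ⟨π, hπ⟩ := CStarFib.OrderedSimplex.exists_perm_of_verts_eq hv
  have hr : IsIso (A.hres h hA (q + (p + 1)) (σ.cell_relClosed τ l hl)) :=
    A.isIso_hres_closedFace hfib σ.mem τ.mem (σ.cell_relClosed τ l hl) _
  refine ⟨hr, π, fun ψ => ?_, A.diff_eq_of_face σ τ q l π hπ (σ.cell_relClosed τ l hl)⟩
  -- The affine condition now equates two reorderings of the same face, and distinct permutations
  -- give distinct reorderings because the vertices are distinct.
  rw [CStarFib.OrderedSimplex.toMap_comp_map, CStarFib.OrderedSimplex.toMap_eq_iff, hπ]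
  exact ⟨fun he => ((σ.face l).perm_injective he).symm, fun he => he ▸ rfl⟩
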